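/- **Conventions.** A *permutative category* is a small symmetric monoidal category $(C,\otimes,\mathbf 1,\beta)$ whose associativity and unit isomorphisms are identities. Let $\mathbf{Perm}$ be the category of permutative categories and strict symmetric monoidal functors. Its *natural model structure* has as weak equivalences the functors whose underlying functor is an equivalence of categories, as fibrations those whose underlying functor is an isofibration, and as cofibrations the maps with the left lifting property against acyclic fibrations; every object is fibrant. For a map $g:K\to L$ of $\mathbf{Perm}$, a permutative category $C$ is *$\{g\}$-local* if the map of homotopy function complexes $\mathrm{Map}^h(L,C)\to\mathrm{Map}^h(K,C)$ induced by $g$ is a weak homotopy equivalence of simplicial sets. Here $\mathrm{Map}^h(X,C)$ is computed, after a cofibrant approximation of $X$, as the nerve of the groupoid of strict symmetric monoidal functors $X\to C$ and monoidal natural isomorphisms. A permutative category $C$ is *compact closed* if each object $c$ has a dual: an object $c^\bullet$ with maps $\eta:\mathbf 1\to c^\bullet\otimes c$ and $\epsilon:c\otimes c^\bullet\to\mathbf 1$ satisfying the two triangle identities. $\mathcal F^\otimes(1)$ is the free permutative category on one generator: its objects are the natural numbers, its morphisms $m\to n$ are the bijections $\{1,\dots,m\}\to\{1,\dots,n\}$,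 and its tensor product is addition and juxtaposition. $\mathfrak{Fr}^{cc}(1)$ is the free compact closed permutative category on one generator. Its objects are finite words in the signs $+,-$. A morphism $f\to g$ is a pair $(\sigma,k)$, where $k\in\mathbb N$ is a number of circles and $\sigma$ is a bijection from the set of points of sign $-$ of $f^\bullet g$ onto the set of its points of sign $+$ (a family of arcs); here $f^\bullet$ is $f$ with all signs reversed. The composite of $(\sigma,k):f\to g$ and $(\tau,l):g\to h$ is obtained by gluing the arcs of $\sigma$ and $\tau$ at the points of $g$: its arcs are the resulting paths between points of $f$ and $h$, and its number of circles is $k+l$ plus the number of closed loops that arise. The tensor product is concatenation of words and juxtaposition of arcs, with circles added, and the symmetry interchanges blocks. **Proposition.** Let $i:\mathcal F^\otimes(1)\to\mathfrak{Fr}^{cc}(1)$ be the strict symmetric monoidal functor that sends $n$ to the word $+\cdots+$ of length $n$ and a bijection to the corresponding family of arcs without circles. A permutative category is compact closed if and only if it is an $\{i\}$-local object of the natural model category $\mathbf{Perm}$. -/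

import Mathlib

open CategoryTheory MonoidalCategory

universe u

namespace PermCC

/-- The sign of a point in an object of the free compact closed category. -/
inductive PointSign : Type
  | pos
  | neg
  deriving DecidableEq

/-- Separate the first element of `Fin (n + 1)` from the others. -/
def peel (A : Type) (n : ℕ) : A ⊕ Fin (n + 1) ≃ Option (A ⊕ Fin n) where
  toFun := Sum.elim (fun a => some (Sum.inl a))
    (Fin.cases none (fun i => some (Sum.inr i)))
  invFun := fun x => x.elim (Sum.inr 0) (Sum.map id Fin.succ)
  left_inv := by
    rintro (a | i)
    · rfl
    · refine Fin.cases ?_ (fun j => ?_) i <;> rfl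
  right_inv := by rintro (_ | (a | i)) <;> rfl

/-- A bijection `e : A ⊕ Fin n ≃ B ⊕ Fin n` is read as a family of directed arcs, one from `x` to `e x`
for each `x`. `glue n e` identifies, for each `i : Fin n`, the end `i` of an arc with the beginning
`i` of an arc. The result is the family of arcs from `A` to `B` so obtained, together with the
number of closed circles so obtained. The identifications are made one after the other: if the end
and the beginning to be identified belong to one and the same arc, then this arc is closed up to a
circle; otherwise the two arcs are concatenated (this is `Equiv.removeNone`). -/
def glue {A B : Type} : (n : ℕ) → (A ⊕ Fin n ≃ B ⊕ Fin n) → (A ≃ B) × ℕ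
  | 0, e => ((Equiv.sumEmpty A (Fin 0)).symm.trans (e.trans (Equiv.sumEmpty B (Fin 0))), 0)
  | n + 1, e =>
    let e' : Option (A ⊕ Fin n) ≃ Option (B ⊕ Fin n) :=
      (peel A n).symm.trans (e.trans (peel B n))
    let r := glue n (Equiv.removeNone e')
    (r.1, r.2 + if e' none = none then 1 else 0)

open Classical in
noncomputable def ind (p : Prop) : ℕ := if p then 1 else 0

theorem ind_and (p q : Prop) : ind (p ∧ q) = ind p * ind q := by
  by_cases hp : p <;> by_cases hq : q <;> simp [ind, hp, hq]

open Classical in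
theorem glueOne_count {X Y : Type} (e : Option X ≃ Option Y) (s : X → Bool) (t : Y → Bool) :
    (∑ c : Bool, ind (∀ x, Option.elim x c s = Option.elim (e x) c t)) =
      2 ^ (if e none = none then 1 else 0) * ind (∀ x, s x = t (Equiv.removeNone e x)) := by
  have key : ∀ c : Bool, (∀ x, Option.elim x c s = Option.elim (e x) c t) ↔
      (c = (e none).elim c t ∧ ∀ x, s x = t (Equiv.removeNone e x)) := by
    intro c
    have h1 : c = (e none).elim c t → ∀ x, (e (some x)).elim c t = t (Equiv.removeNone e x) := by
      intro hc x
      rcases h : e (some x) with _ | y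
      · have := Equiv.removeNone_none e h
        rw [← this] at hc
        simpa using hc
      · have := Equiv.removeNone_some e ⟨y, h⟩
        rw [h] at this
        simp only [Option.some.injEq] at this
        simp [this]
    constructor
    · intro h
      have h0 := h none
      refine ⟨h0, fun x => ?_⟩
      rw [← h1 h0 x]; exact h (some x)
    · rintro ⟨h0, h⟩ (_ | x)
      · exact h0
      · rw [h1 h0 x]; exact h x
  simp only [key, ind]
  rcases h : e none with _ | y
  · by_cases h2 : ∀ x, s x = t (Equiv.removeNone e x) <;> simp [h2]
  · by_cases h2 : ∀ x, s x = t (Equiv.removeNone e x)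
    · simp [h2]
    · simp [h2]

theorem glue_count {A B : Type} (n : ℕ) (e : A ⊕ Fin n ≃ B ⊕ Fin n) (s : A → Bool)
    (t : B → Bool) :
    (∑ c : Fin n → Bool, ind (∀ x, Sum.elim s c x = Sum.elim t c (e x))) =
      2 ^ (glue n e).2 * ind (∀ a, s a = t ((glue n e).1 a)) := by
  induction n with
  | zero =>
    have : ∀ a, e (Sum.inl a) = Sum.inl ((glue 0 e).1 a) := by
      intro a
      simp only [glue, Equiv.trans_apply, Equiv.sumEmpty_symm_apply]
      rcases e (Sum.inl a) with b | i
      · rfl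
      · exact i.elim0
    simp [Sum.forall, this]
    simp [glue]
  | succ n ih =>
    set e' : Option (A ⊕ Fin n) ≃ Option (B ⊕ Fin n) :=
      (peel A n).symm.trans (e.trans (peel B n)) with he'
    have h1 : glue (n + 1) e = ((glue n (Equiv.removeNone e')).1,
      (glue n (Equiv.removeNone e')).2 + if e' none = none then 1 else 0) := rfl
    rw [h1, ← Fintype.sum_equiv (Fin.consEquiv (fun _ : Fin (n + 1) => Bool)) _ _ (fun _ => rfl),
      Fintype.sum_prod_type_right]
    have h2 : ∀ (c : Bool) (d : Fin n → Bool),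
        (∀ x, Sum.elim s (Fin.consEquiv (fun _ : Fin (n + 1) => Bool) (c, d)) x =
          Sum.elim t (Fin.consEquiv (fun _ : Fin (n + 1) => Bool) (c, d)) (e x)) ↔
        ∀ x, Option.elim x c (Sum.elim s d) = Option.elim (e' x) c (Sum.elim t d) := by
      intro c d
      have hB : ∀ (D : Type) (r : D → Bool) (y : D ⊕ Fin (n + 1)),
          Sum.elim r (Fin.consEquiv (fun _ : Fin (n + 1) => Bool) (c, d)) y =
          Option.elim (peel D n y) c (Sum.elim r d) := by
        rintro D r (y | i)
        · rfl
        · refine Fin.cases ?_ (fun j => ?_) i <;> simp [peel, Fin.consEquiv]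
      simp only [hB]
      rw [← (peel A n).forall_congr_right (q := fun x => Option.elim x c (Sum.elim s d) =
        Option.elim (e' x) c (Sum.elim t d))]
      simp [he']
    simp only [h2, glueOne_count]
    have := ih (Equiv.removeNone e')
    rw [← Finset.mul_sum, this, pow_add]
    ring

/-- Objects of the free compact closed permutative category on one generator `+`: finite words in
the signs `+` and `-`. -/
@[ext]
structure FrCC : Type u where
  word : List PointSign

namespace FrCC

/-- The points of sign `+` of `f`, numbered from left to right. -/
abbrev P (f : FrCC.{u}) : Type := Fin (f.word.count .pos)
/-- The points of sign `-` of `f`, numbered from left to right. -/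
abbrev N (f : FrCC.{u}) : Type := Fin (f.word.count .neg)

/-- A morphism `f ⟶ g`: a total pairing of the word `f• g`, where `f•` is `f` with all signs
reversed, that is, a bijection from the points of sign `-` of `f• g` (the positive points of `f` and
the negative points of `g`) onto its points of sign `+` (the negative points of `f` and the positive
points of `g`), together with a number of closed circles. -/
@[ext]
structure Hom (f g : FrCC.{u}) : Type u where
  arcs : f.P ⊕ g.N ≃ f.N ⊕ g.P
  circles : ℕ

/-- Rearrangement of the summands for the sources of the arcs. -/
def regroupS (A B C D : Type) : ((A ⊕ D) ⊕ B) ⊕ C ≃ (A ⊕ B) ⊕ (C ⊕ D) where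
  toFun := Sum.elim (Sum.elim (Sum.elim (Sum.inl ∘ Sum.inl) (Sum.inr ∘ Sum.inr))
    (Sum.inl ∘ Sum.inr)) (Sum.inr ∘ Sum.inl)
  invFun := Sum.elim (Sum.elim (Sum.inl ∘ Sum.inl ∘ Sum.inl) (Sum.inl ∘ Sum.inr))
    (Sum.elim Sum.inr (Sum.inl ∘ Sum.inl ∘ Sum.inr))
  left_inv := by rintro (((_ | _) | _) | _) <;> rfl
  right_inv := by rintro ((_ | _) | (_ | _)) <;> rfl

/-- Rearrangement of the summands for the targets of the arcs. -/
def regroupT (A B C D : Type) : (A ⊕ C) ⊕ (B ⊕ D) ≃ ((A ⊕ D) ⊕ B) ⊕ C where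
  toFun := Sum.elim (Sum.elim (Sum.inl ∘ Sum.inl ∘ Sum.inl) Sum.inr)
    (Sum.elim (Sum.inl ∘ Sum.inr) (Sum.inl ∘ Sum.inl ∘ Sum.inr))
  invFun := Sum.elim (Sum.elim (Sum.elim (Sum.inl ∘ Sum.inl) (Sum.inr ∘ Sum.inr))
    (Sum.inr ∘ Sum.inl)) (Sum.inl ∘ Sum.inr)
  left_inv := by rintro ((_ | _) | (_ | _)) <;> rfl
  right_inv := by rintro (((_ | _) | _) | _) <;> rfl

/-- The arcs of `σ : f ⟶ g` and of `τ : g ⟶ h` taken together. -/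
def union {f g h : FrCC.{u}} (σ : Hom f g) (τ : Hom g h) :
    ((f.P ⊕ h.N) ⊕ g.N) ⊕ g.P ≃ ((f.N ⊕ h.P) ⊕ g.N) ⊕ g.P :=
  (regroupS f.P g.N g.P h.N).trans
    ((Equiv.sumCongr σ.arcs τ.arcs).trans (regroupT f.N g.N g.P h.P))

/-- Composition: the arcs of `σ` and `τ` are glued at all the points of the middle object `g`; the
closed circles that arise are added to the circles of `σ` and of `τ`. -/
def Hom.comp {f g h : FrCC.{u}} (σ : Hom f g) (τ : Hom g h) : Hom f h :=
  let r := glue _ (union σ τ)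
  let s := glue _ r.1
  ⟨s.1, σ.circles + τ.circles + (r.2 + s.2)⟩

/-- The morphism without circles whose arcs join each point of `f` to a point of the same sign
of `g`, as prescribed by two bijections. -/
def Hom.rel {f g : FrCC.{u}} (π : f.P ≃ g.P) (ν : f.N ≃ g.N) : Hom f g :=
  ⟨(Equiv.sumCongr π ν.symm).trans (Equiv.sumComm _ _), 0⟩

def Hom.id (f : FrCC.{u}) : Hom f f := Hom.rel (Equiv.refl _) (Equiv.refl _)

/-- Two-colourings of the points of `f`; a device for the verification of the category axioms. -/
abbrev Col (f : FrCC.{u}) : Type := (f.P → Bool) × (f.N → Bool)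

/-- The number of two-colourings of `σ` that restrict to `a` and `b` at the ends. It determines
`σ`, and it turns composition into matrix multiplication. -/
noncomputable def Hom.wt {f g : FrCC.{u}} (σ : Hom f g) (a : Col f) (b : Col g) : ℕ :=
  2 ^ σ.circles * ind (∀ x, Sum.elim a.1 b.2 x = Sum.elim a.2 b.1 (σ.arcs x))

theorem Hom.wt_ext {f g : FrCC.{u}} {σ τ : Hom f g} (h : ∀ a b, σ.wt a b = τ.wt a b) :
    σ = τ := by
  classical
  have key : ∀ t : f.N ⊕ g.P → Bool, (∀ x, t (σ.arcs x) = t (τ.arcs x)) ∧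
      σ.circles = τ.circles := by
    intro t
    have := h (fun x => t (σ.arcs (Sum.inl x)), fun x => t (Sum.inl x))
      (fun x => t (Sum.inr x), fun x => t (σ.arcs (Sum.inr x)))
    have e1 : ∀ x : f.P ⊕ g.N, Sum.elim (fun x => t (σ.arcs (Sum.inl x)))
        (fun x => t (σ.arcs (Sum.inr x))) x = t (σ.arcs x) := by
      rintro (x | x) <;> rfl
    have e2 : ∀ x : f.N ⊕ g.P, Sum.elim (fun x => t (Sum.inl x))
        (fun x => t (Sum.inr x)) x = t x := by
      rintro (x | x) <;> rfl
    simp only [wt, ind, e1, e2, implies_true, if_true, mul_one, mul_ite, mul_zero] at this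
    split_ifs at this with h1
    · exact ⟨h1, Nat.pow_right_injective le_rfl this⟩
    · exact absurd this (by positivity)
  have h2 := (key fun _ => true).2
  have h1 : σ.arcs = τ.arcs := by
    ext x : 1
    have := (key fun y => decide (y = σ.arcs x)).1 x
    simp only [decide_true] at this
    exact (of_decide_eq_true this.symm).symm
  exact Hom.ext h1 h2

theorem Hom.wt_comp {f g h : FrCC.{u}} (σ : Hom f g) (τ : Hom g h) (a : Col f) (c : Col h) :
    (σ.comp τ).wt a c = ∑ b : Col g, σ.wt a b * τ.wt b c := by
  classical
  have hx : ∀ (b₁ : g.P → Bool) (b₂ : g.N → Bool),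
      (∀ x, Sum.elim (Sum.elim (Sum.elim a.1 c.2) b₂) b₁ x =
        Sum.elim (Sum.elim (Sum.elim a.2 c.1) b₂) b₁ (union σ τ x)) ↔
      ((∀ x, Sum.elim a.1 b₂ x = Sum.elim a.2 b₁ (σ.arcs x)) ∧
        (∀ x, Sum.elim b₁ c.2 x = Sum.elim b₂ c.1 (τ.arcs x))) := by
    intro b₁ b₂
    have hT : ∀ y, Sum.elim (Sum.elim (Sum.elim a.2 c.1) b₂) b₁ (regroupT f.N g.N g.P h.P y) =
        Sum.elim (Sum.elim a.2 b₁) (Sum.elim b₂ c.1) y := by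
      rintro ((_ | _) | (_ | _)) <;> rfl
    have hS : ∀ y, Sum.elim (Sum.elim (Sum.elim a.1 c.2) b₂) b₁ y =
        Sum.elim (Sum.elim a.1 b₂) (Sum.elim b₁ c.2) (regroupS f.P g.N g.P h.N y) := by
      rintro (((_ | _) | _) | _) <;> rfl
    simp only [hS, union, Equiv.trans_apply, hT]
    rw [(regroupS f.P g.N g.P h.N).forall_congr_right
      (q := fun y => Sum.elim (Sum.elim a.1 b₂) (Sum.elim b₁ c.2) y =
        Sum.elim (Sum.elim a.2 b₁) (Sum.elim b₂ c.1) (Equiv.sumCongr σ.arcs τ.arcs y)),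
      Sum.forall]
    rfl
  have h1 : ∀ b : Col g, σ.wt a b * τ.wt b c = 2 ^ (σ.circles + τ.circles) *
      ind (∀ x, Sum.elim (Sum.elim (Sum.elim a.1 c.2) b.2) b.1 x =
        Sum.elim (Sum.elim (Sum.elim a.2 c.1) b.2) b.1 (union σ τ x)) := by
    intro b
    simp only [hx, wt, ind_and, pow_add]
    ring
  simp only [h1]
  rw [← Finset.mul_sum, Fintype.sum_prod_type_right]
  simp only [glue_count, ← Finset.mul_sum]
  simp only [wt, comp, pow_add, mul_assoc]

theorem Hom.wt_rel {f g : FrCC.{u}} (π : f.P ≃ g.P) (ν : f.N ≃ g.N) (a : Col f) (b : Col g) :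
    (Hom.rel π ν).wt a b = if a = (b.1 ∘ π, b.2 ∘ ν) then 1 else 0 := by
  classical
  have : (∀ x, Sum.elim a.1 b.2 x = Sum.elim a.2 b.1 ((Hom.rel π ν).arcs x)) ↔
      a = (b.1 ∘ π, b.2 ∘ ν) := by
    rw [Sum.forall, Prod.ext_iff, funext_iff, funext_iff, ← ν.forall_congr_right]
    simp [rel, eq_comm]
  simp only [wt, this]
  simp [rel, ind]

theorem Hom.wt_comp_rel {f g h : FrCC.{u}} (σ : Hom f g) (π : g.P ≃ h.P) (ν : g.N ≃ h.N)
    (a : Col f) (c : Col h) :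
    (σ.comp (Hom.rel π ν)).wt a c = σ.wt a (c.1 ∘ π, c.2 ∘ ν) := by
  rw [wt_comp]
  simp [wt_rel]

theorem Hom.wt_rel_comp {f g h : FrCC.{u}} (π : f.P ≃ g.P) (ν : f.N ≃ g.N) (τ : Hom g h)
    (a : Col f) (c : Col h) :
    ((Hom.rel π ν).comp τ).wt a c = τ.wt (a.1 ∘ π.symm, a.2 ∘ ν.symm) c := by
  have : ∀ b : Col g, a = (b.1 ∘ π, b.2 ∘ ν) ↔ b = (a.1 ∘ π.symm, a.2 ∘ ν.symm) := by
    intro b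
    constructor
    · rintro rfl; simp [Function.comp_assoc]
    · rintro rfl; simp [Function.comp_assoc]
  rw [wt_comp]
  simp [wt_rel, this]

instance : Category.{u} FrCC.{u} where
  Hom := Hom
  id := Hom.id
  comp := Hom.comp
  id_comp σ := Hom.wt_ext fun a b => by rw [Hom.id, Hom.wt_rel_comp]; rfl
  comp_id σ := Hom.wt_ext fun a b => by rw [Hom.id, Hom.wt_comp_rel]; rfl
  assoc σ τ υ := Hom.wt_ext fun a d => by
    simp only [Hom.wt_comp, Finset.sum_mul, Finset.mul_sum, mul_assoc]
    exact Finset.sum_comm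

/-- The tensor product of objects is concatenation of words. -/
def tensorObj (f g : FrCC.{u}) : FrCC.{u} := ⟨f.word ++ g.word⟩

def unit : FrCC.{u} := ⟨[]⟩

theorem tensorObj_assoc (f g h : FrCC.{u}) :
    tensorObj (tensorObj f g) h = tensorObj f (tensorObj g h) :=
  FrCC.ext (List.append_assoc _ _ _)

theorem unit_tensorObj (f : FrCC.{u}) : tensorObj unit f = f := FrCC.ext (List.nil_append _)

theorem tensorObj_unit (f : FrCC.{u}) : tensorObj f unit = f := FrCC.ext (List.append_nil _)

theorem count_tensorObj (f g : FrCC.{u}) (s : PointSign) :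
    (tensorObj f g).word.count s = f.word.count s + g.word.count s := List.count_append

def segSplit {m a b : ℕ} (h : m = a + b) : Fin m ≃ Fin a ⊕ Fin b :=
  (finCongr h).trans finSumFinEquiv.symm

def splitP (f g : FrCC.{u}) : (tensorObj f g).P ≃ f.P ⊕ g.P :=
  segSplit (count_tensorObj f g _)

def splitN (f g : FrCC.{u}) : (tensorObj f g).N ≃ f.N ⊕ g.N :=
  segSplit (count_tensorObj f g _)

/-- The tensor product of morphisms is juxtaposition. -/
def Hom.tensor {f g f' g' : FrCC.{u}} (σ : Hom f g) (σ' : Hom f' g') :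
    Hom (tensorObj f f') (tensorObj g g') where
  arcs := (Equiv.sumCongr (splitP f f') (splitN g g')).trans
    ((Equiv.sumSumSumComm _ _ _ _).trans
      ((Equiv.sumCongr σ.arcs σ'.arcs).trans
        ((Equiv.sumSumSumComm _ _ _ _).trans
          (Equiv.sumCongr (splitN f f') (splitP g g')).symm)))
  circles := σ.circles + σ'.circles

def Col.fst {f g : FrCC.{u}} (a : Col (tensorObj f g)) : Col f :=
  (a.1 ∘ (splitP f g).symm ∘ Sum.inl, a.2 ∘ (splitN f g).symm ∘ Sum.inl)

def Col.snd {f g : FrCC.{u}} (a : Col (tensorObj f g)) : Col g :=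
  (a.1 ∘ (splitP f g).symm ∘ Sum.inr, a.2 ∘ (splitN f g).symm ∘ Sum.inr)

theorem Hom.wt_tensor {f g f' g' : FrCC.{u}} (σ : Hom f g) (σ' : Hom f' g')
    (a : Col (tensorObj f f')) (b : Col (tensorObj g g')) :
    (σ.tensor σ').wt a b = σ.wt a.fst b.fst * σ'.wt a.snd b.snd := by
  have h : (∀ x, Sum.elim a.1 b.2 x = Sum.elim a.2 b.1 ((σ.tensor σ').arcs x)) ↔
      ((∀ x, Sum.elim a.fst.1 b.fst.2 x = Sum.elim a.fst.2 b.fst.1 (σ.arcs x)) ∧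
        (∀ x, Sum.elim a.snd.1 b.snd.2 x = Sum.elim a.snd.2 b.snd.1 (σ'.arcs x))) := by
    let S : (tensorObj f f').P ⊕ (tensorObj g g').N ≃ (f.P ⊕ g.N) ⊕ (f'.P ⊕ g'.N) :=
      (Equiv.sumCongr (splitP f f') (splitN g g')).trans (Equiv.sumSumSumComm _ _ _ _)
    let T : (f.N ⊕ g.P) ⊕ (f'.N ⊕ g'.P) ≃ (tensorObj f f').N ⊕ (tensorObj g g').P :=
      (Equiv.sumSumSumComm _ _ _ _).trans (Equiv.sumCongr (splitN f f') (splitP g g')).symm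
    have hS : ∀ y, Sum.elim a.1 b.2 (S.symm y) =
        Sum.elim (Sum.elim a.fst.1 b.fst.2) (Sum.elim a.snd.1 b.snd.2) y := by
      rintro ((_ | _) | (_ | _)) <;> rfl
    have hT : ∀ y, Sum.elim a.2 b.1 (T y) =
        Sum.elim (Sum.elim a.fst.2 b.fst.1) (Sum.elim a.snd.2 b.snd.1) y := by
      rintro ((_ | _) | (_ | _)) <;> rfl
    have hA : ∀ y, (σ.tensor σ').arcs (S.symm y) = T (Equiv.sumCongr σ.arcs σ'.arcs y) := by
      intro y
      have : (σ.tensor σ').arcs = S.trans ((Equiv.sumCongr σ.arcs σ'.arcs).trans T) := rfl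
      rw [this]
      simp
    rw [← S.symm.forall_congr_right]
    simp only [hS, hA, hT, Sum.forall]
    rfl
  simp only [wt, h, ind_and]
  simp only [tensor, pow_add]
  ring

def colEquiv (f g : FrCC.{u}) : Col (tensorObj f g) ≃ Col f × Col g where
  toFun a := (a.fst, a.snd)
  invFun p := (Sum.elim p.1.1 p.2.1 ∘ splitP f g, Sum.elim p.1.2 p.2.2 ∘ splitN f g)
  left_inv a := by
    refine Prod.ext (funext fun x => ?_) (funext fun x => ?_)
    · obtain ⟨y, rfl⟩ := (splitP f g).symm.surjective x
      rcases y with y | y <;> simp [Col.fst, Col.snd]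
    · obtain ⟨y, rfl⟩ := (splitN f g).symm.surjective x
      rcases y with y | y <;> simp [Col.fst, Col.snd]
  right_inv p := by
    refine Prod.ext (Prod.ext (funext fun x => ?_) (funext fun x => ?_))
      (Prod.ext (funext fun x => ?_) (funext fun x => ?_)) <;> simp [Col.fst, Col.snd]

theorem Hom.tensor_comp {f g h f' g' h' : FrCC.{u}} (σ : Hom f g) (τ : Hom g h)
    (σ' : Hom f' g') (τ' : Hom g' h') :
    (σ.tensor σ').comp (τ.tensor τ') = (σ.comp τ).tensor (σ'.comp τ') := by
  refine wt_ext fun a c => ?_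
  simp only [wt_comp, wt_tensor, Fintype.sum_mul_sum]
  rw [← Fintype.sum_prod_type', ← Fintype.sum_equiv (colEquiv g g') _ _ (fun _ => rfl)]
  refine Finset.sum_congr rfl fun b _ => ?_
  simp only [colEquiv, Equiv.coe_fn_mk]
  ring

theorem Hom.rel_tensor {f g f' g' : FrCC.{u}} (π : f.P ≃ g.P) (ν : f.N ≃ g.N)
    (π' : f'.P ≃ g'.P) (ν' : f'.N ≃ g'.N) :
    (Hom.rel π ν).tensor (Hom.rel π' ν') =
      Hom.rel ((splitP f f').trans ((Equiv.sumCongr π π').trans (splitP g g').symm))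
        ((splitN f f').trans ((Equiv.sumCongr ν ν').trans (splitN g g').symm)) := by
  refine Hom.ext (Equiv.ext ?_) rfl
  rintro (x | x)
  · obtain ⟨y, rfl⟩ := (splitP f f').symm.surjective x
    rcases y with y | y <;> simp [tensor, rel]
  · obtain ⟨y, rfl⟩ := (splitN g g').symm.surjective x
    rcases y with y | y <;> simp [tensor, rel]

theorem Hom.rel_comp_rel {f g h : FrCC.{u}} (π : f.P ≃ g.P) (ν : f.N ≃ g.N)
    (π' : g.P ≃ h.P) (ν' : g.N ≃ h.N) :
    (Hom.rel π ν).comp (Hom.rel π' ν') = Hom.rel (π.trans π') (ν.trans ν') := by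
  refine wt_ext fun a c => ?_
  rw [wt_comp_rel, wt_rel, wt_rel]
  rfl

theorem eqToHom_eq {f g : FrCC.{u}} (h : f = g) :
    eqToHom h = Hom.rel (finCongr (by rw [h])) (finCongr (by rw [h])) := by
  subst h
  rfl

@[simps]
def relIso {f g : FrCC.{u}} (π : f.P ≃ g.P) (ν : f.N ≃ g.N) : f ≅ g where
  hom := Hom.rel π ν
  inv := Hom.rel π.symm ν.symm
  hom_inv_id := (Hom.rel_comp_rel _ _ _ _).trans (by simp; rfl)
  inv_hom_id := (Hom.rel_comp_rel _ _ _ _).trans (by simp; rfl)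

theorem tensor_id (f g : FrCC.{u}) : (Hom.id f).tensor (Hom.id g) = Hom.id (tensorObj f g) := by
  rw [Hom.id, Hom.id, Hom.rel_tensor]
  simp [Hom.id]

theorem eqToHom_tensor_eqToHom {f g f' g' : FrCC.{u}} (h : f = g) (h' : f' = g') :
    Hom.tensor (eqToHom h) (eqToHom h') =
      (eqToHom (by rw [h, h']) : tensorObj f f' ⟶ tensorObj g g') := by
  subst h h'
  exact tensor_id _ _

theorem Hom.wt_comp_eqToHom {f g h : FrCC.{u}} (σ : f ⟶ g) (e : g = h) (a : Col f) (c : Col h) :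
    Hom.wt (σ ≫ eqToHom e) a c = Hom.wt σ a (c.1 ∘ Fin.cast (by rw [e]), c.2 ∘ Fin.cast (by rw [e])) := by
  subst e
  simp

theorem Hom.wt_eqToHom_comp {f g h : FrCC.{u}} (e : f = g) (σ : g ⟶ h) (a : Col f) (c : Col h) :
    Hom.wt (eqToHom e ≫ σ) a c = Hom.wt σ (a.1 ∘ Fin.cast (by rw [e]), a.2 ∘ Fin.cast (by rw [e])) c := by
  subst e
  simp

theorem val_splitP_inl {f g : FrCC.{u}} (i : f.P) :
    ((splitP f g).symm (Sum.inl i)).val = i.val := rfl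

theorem val_splitP_inr {f g : FrCC.{u}} (i : g.P) :
    ((splitP f g).symm (Sum.inr i)).val = f.word.count .pos + i.val := rfl

theorem val_splitN_inl {f g : FrCC.{u}} (i : f.N) :
    ((splitN f g).symm (Sum.inl i)).val = i.val := rfl

theorem val_splitN_inr {f g : FrCC.{u}} (i : g.N) :
    ((splitN f g).symm (Sum.inr i)).val = f.word.count .neg + i.val := rfl

theorem Hom.tensor_assoc {f₁ f₂ f₃ g₁ g₂ g₃ : FrCC.{u}} (σ : f₁ ⟶ g₁) (τ : f₂ ⟶ g₂)
    (υ : f₃ ⟶ g₃) :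
    (((Hom.tensor (Hom.tensor σ τ) υ) :
        tensorObj (tensorObj f₁ f₂) f₃ ⟶ tensorObj (tensorObj g₁ g₂) g₃) ≫
        eqToHom (tensorObj_assoc g₁ g₂ g₃)) =
      eqToHom (tensorObj_assoc f₁ f₂ f₃) ≫ (Hom.tensor σ (Hom.tensor τ υ)) := by
  refine Hom.wt_ext fun a c => ?_
  rw [Hom.wt_comp_eqToHom, Hom.wt_eqToHom_comp, Hom.wt_tensor, Hom.wt_tensor, Hom.wt_tensor,
    Hom.wt_tensor, mul_assoc]
  congr 1
  congr 2
  · refine Prod.ext (funext fun x => congrArg a.1 (Fin.ext ?_))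
      (funext fun x => congrArg a.2 (Fin.ext ?_)) <;>
    simp [val_splitP_inr, val_splitN_inr, count_tensorObj, add_assoc]
  · refine Prod.ext (funext fun x => congrArg c.1 (Fin.ext ?_))
      (funext fun x => congrArg c.2 (Fin.ext ?_)) <;>
    simp [val_splitP_inr, val_splitN_inr, count_tensorObj, add_assoc]

theorem Hom.wt_id {f : FrCC.{u}} (a b : Col f) : (Hom.id f).wt a b = if a = b then 1 else 0 := by
  rw [Hom.id, wt_rel]; rfl

theorem Hom.unit_tensor {f g : FrCC.{u}} (σ : f ⟶ g) :
    ((Hom.tensor (Hom.id unit) σ) : tensorObj unit f ⟶ tensorObj unit g) ≫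
        eqToHom (unit_tensorObj g) = eqToHom (unit_tensorObj f) ≫ σ := by
  refine Hom.wt_ext fun a c => ?_
  rw [Hom.wt_comp_eqToHom, Hom.wt_eqToHom_comp, Hom.wt_tensor, Hom.wt_id, if_pos, one_mul]
  · congr 1
    · refine Prod.ext (funext fun x => congrArg a.1 (Fin.ext ?_))
        (funext fun x => congrArg a.2 (Fin.ext ?_))
      · exact (val_splitP_inr (f := unit) x).trans (Nat.zero_add _)
      · exact (val_splitN_inr (f := unit) x).trans (Nat.zero_add _)
    · refine Prod.ext (funext fun x => congrArg c.1 (Fin.ext ?_))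
        (funext fun x => congrArg c.2 (Fin.ext ?_))
      · exact (val_splitP_inr (f := unit) x).trans (Nat.zero_add _)
      · exact (val_splitN_inr (f := unit) x).trans (Nat.zero_add _)
  · exact Prod.ext (funext fun x => Fin.elim0 x) (funext fun x => Fin.elim0 x)

theorem Hom.tensor_unit {f g : FrCC.{u}} (σ : f ⟶ g) :
    ((Hom.tensor σ (Hom.id unit)) : tensorObj f unit ⟶ tensorObj g unit) ≫
        eqToHom (tensorObj_unit g) = eqToHom (tensorObj_unit f) ≫ σ := by
  refine Hom.wt_ext fun a c => ?_
  rw [Hom.wt_comp_eqToHom, Hom.wt_eqToHom_comp, Hom.wt_tensor, Hom.wt_id, if_pos, mul_one]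
  · rfl
  · exact Prod.ext (funext fun x => Fin.elim0 x) (funext fun x => Fin.elim0 x)

theorem pentagon_aux (f g h k : FrCC.{u}) :
    (Hom.tensor (eqToHom (tensorObj_assoc f g h)) (Hom.id k) :
        tensorObj (tensorObj (tensorObj f g) h) k ⟶ tensorObj (tensorObj f (tensorObj g h)) k) ≫
      eqToHom (tensorObj_assoc f (tensorObj g h) k) ≫
        (Hom.tensor (Hom.id f) (eqToHom (tensorObj_assoc g h k)) :
          tensorObj f (tensorObj (tensorObj g h) k) ⟶ tensorObj f (tensorObj g (tensorObj h k))) =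
      eqToHom (tensorObj_assoc (tensorObj f g) h k) ≫
        eqToHom (tensorObj_assoc f g (tensorObj h k)) := by
  have h1 := eqToHom_tensor_eqToHom (tensorObj_assoc f g h) (rfl : k = k)
  have h2 := eqToHom_tensor_eqToHom (rfl : f = f) (tensorObj_assoc g h k)
  rw [eqToHom_refl] at h1 h2
  change Hom.tensor _ (Hom.id k) = _ at h1
  change Hom.tensor (Hom.id f) _ = _ at h2
  rw [h1, h2]
  simp

theorem triangle_aux (f g : FrCC.{u}) :
    eqToHom (tensorObj_assoc f unit g) ≫
      (Hom.tensor (Hom.id f) (eqToHom (unit_tensorObj g)) :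
        tensorObj f (tensorObj unit g) ⟶ tensorObj f g) =
      Hom.tensor (eqToHom (tensorObj_unit f)) (Hom.id g) := by
  have h1 := eqToHom_tensor_eqToHom (rfl : f = f) (unit_tensorObj g)
  have h2 := eqToHom_tensor_eqToHom (tensorObj_unit f) (rfl : g = g)
  rw [eqToHom_refl] at h1 h2
  change Hom.tensor (Hom.id f) _ = _ at h1
  change Hom.tensor _ (Hom.id g) = _ at h2
  rw [h1, h2]
  simp

instance : MonoidalCategoryStruct FrCC.{u} where
  tensorObj := tensorObj
  tensorHom := Hom.tensor
  whiskerLeft f _ _ σ := Hom.tensor (Hom.id f) σ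
  whiskerRight σ f := Hom.tensor σ (Hom.id f)
  tensorUnit := unit
  associator _ _ _ := eqToIso (tensorObj_assoc _ _ _)
  leftUnitor _ := eqToIso (unit_tensorObj _)
  rightUnitor _ := eqToIso (tensorObj_unit _)

instance : MonoidalCategory FrCC.{u} := MonoidalCategory.ofTensorHom
  (id_tensorHom_id := tensor_id)
  (id_tensorHom := fun _ _ _ _ => rfl)
  (tensorHom_id := fun _ _ => rfl)
  (tensorHom_comp_tensorHom := fun σ σ' τ τ' => Hom.tensor_comp σ τ σ' τ')
  (associator_naturality := fun σ τ υ => Hom.tensor_assoc σ τ υ)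
  (leftUnitor_naturality := fun σ => Hom.unit_tensor σ)
  (rightUnitor_naturality := fun σ => Hom.tensor_unit σ)
  (pentagon := pentagon_aux)
  (triangle := triangle_aux)

/-- The symmetry interchanges the two blocks of points. -/
def braid (f g : FrCC.{u}) : tensorObj f g ≅ tensorObj g f :=
  relIso ((splitP f g).trans ((Equiv.sumComm _ _).trans (splitP g f).symm))
    ((splitN f g).trans ((Equiv.sumComm _ _).trans (splitN g f).symm))

theorem braid_symm (f g : FrCC.{u}) : (braid f g).hom ≫ (braid g f).hom = 𝟙 _ := by
  refine (Hom.rel_comp_rel _ _ _ _).trans ?_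
  refine congrArg₂ Hom.rel (Equiv.ext fun x => ?_) (Equiv.ext fun x => ?_)
  · obtain ⟨y, rfl⟩ := (splitP f g).symm.surjective x
    rcases y with y | y <;> simp
  · obtain ⟨y, rfl⟩ := (splitN f g).symm.surjective x
    rcases y with y | y <;> simp

theorem braid_natural {f g f' g' : FrCC.{u}} (σ : f ⟶ g) (τ : f' ⟶ g') :
    (Hom.tensor σ τ : tensorObj f f' ⟶ tensorObj g g') ≫ (braid g g').hom =
      (braid f f').hom ≫ (Hom.tensor τ σ : tensorObj f' f ⟶ tensorObj g' g) := by
  refine Hom.wt_ext fun a c => ?_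
  refine (Hom.wt_comp_rel _ _ _ _ _).trans ?_
  refine Eq.trans ?_ (Hom.wt_rel_comp _ _ _ _ _).symm
  rw [Hom.wt_tensor, Hom.wt_tensor, mul_comm]
  congr 2
  all_goals
    refine Prod.ext (funext fun x => ?_) (funext fun x => ?_) <;> simp [Col.fst, Col.snd]

theorem val_flip {a b m n : ℕ} (hm : m = a + b) (hn : n = b + a) (x : Fin m) :
    ((segSplit hn).symm
      (Equiv.sumComm (Fin a) (Fin b) (segSplit hm x))).val =
      if x.val < a then b + x.val else x.val - a := by
  subst hm hn
  refine Fin.addCases (fun i => ?_) (fun i => ?_) x <;> simp [segSplit]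

theorem val_map {a b a' b' m n : ℕ} (hm : m = a + b) (hn : n = a' + b') (π : Fin a ≃ Fin a')
    (π' : Fin b ≃ Fin b') (x : Fin m) :
    ((segSplit hn).symm
      (Equiv.sumCongr π π' (segSplit hm x))).val =
      if h : x.val < a then (π ⟨x.val, h⟩).val else
        a' + (π' ⟨x.val - a, by omega⟩).val := by
  subst hm hn
  refine Fin.addCases (fun i => ?_) (fun i => ?_) x <;> simp [segSplit]

theorem hexagon₁ (f g h : FrCC.{u}) :
    eqToHom (tensorObj_assoc f g h) ≫ (braid f (tensorObj g h)).hom ≫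
        eqToHom (tensorObj_assoc g h f) =
      (Hom.tensor (braid f g).hom (Hom.id h) :
        tensorObj (tensorObj f g) h ⟶ tensorObj (tensorObj g f) h) ≫
        eqToHom (tensorObj_assoc g f h) ≫ Hom.tensor (Hom.id g) (braid f h).hom := by
  simp only [eqToHom_eq, braid, relIso_hom, Hom.id, Hom.rel_tensor]
  change Hom.comp _ (Hom.comp _ _) = Hom.comp _ (Hom.comp _ _)
  simp only [Hom.rel_comp_rel]
  refine congrArg₂ Hom.rel (Equiv.ext fun x => Fin.ext ?_) (Equiv.ext fun x => Fin.ext ?_)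
  · have hx := x.isLt
    simp only [count_tensorObj] at hx
    simp only [splitP, Equiv.trans_apply, finCongr_apply, Fin.val_cast, val_flip, val_map,
      Equiv.refl_apply, count_tensorObj]
    split_ifs <;> omega
  · have hx := x.isLt
    simp only [count_tensorObj] at hx
    simp only [splitN, Equiv.trans_apply, finCongr_apply, Fin.val_cast, val_flip, val_map,
      Equiv.refl_apply, count_tensorObj]
    split_ifs <;> omega

theorem hexagon₂ (f g h : FrCC.{u}) :
    eqToHom (tensorObj_assoc f g h).symm ≫ (braid (tensorObj f g) h).hom ≫
        eqToHom (tensorObj_assoc h f g).symm =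
      (Hom.tensor (Hom.id f) (braid g h).hom :
        tensorObj f (tensorObj g h) ⟶ tensorObj f (tensorObj h g)) ≫
        eqToHom (tensorObj_assoc f h g).symm ≫ Hom.tensor (braid f h).hom (Hom.id g) := by
  simp only [eqToHom_eq, braid, relIso_hom, Hom.id, Hom.rel_tensor]
  change Hom.comp _ (Hom.comp _ _) = Hom.comp _ (Hom.comp _ _)
  simp only [Hom.rel_comp_rel]
  refine congrArg₂ Hom.rel (Equiv.ext fun x => Fin.ext ?_) (Equiv.ext fun x => Fin.ext ?_)
  · have hx := x.isLt
    simp only [count_tensorObj] at hx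
    simp only [splitP, Equiv.trans_apply, finCongr_apply, Fin.val_cast, val_flip, val_map,
      Equiv.refl_apply, count_tensorObj]
    split_ifs <;> omega
  · have hx := x.isLt
    simp only [count_tensorObj] at hx
    simp only [splitN, Equiv.trans_apply, finCongr_apply, Fin.val_cast, val_flip, val_map,
      Equiv.refl_apply, count_tensorObj]
    split_ifs <;> omega

instance : SymmetricCategory FrCC.{u} where
  braiding := braid
  braiding_naturality_right f _ _ σ := braid_natural (Hom.id f) σ
  braiding_naturality_left σ f := braid_natural σ (Hom.id f)
  hexagon_forward := hexagon₁
  hexagon_reverse := hexagon₂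
  symmetry := braid_symm

end FrCC

/-- A symmetric monoidal category is permutative if its associators and unitors are identities,
so that its tensor product is strictly associative and strictly unital. -/
class IsPermutative (C : Type*) [Category C] [MonoidalCategory C] : Prop where
  tensor_assoc (X Y Z : C) : (X ⊗ Y) ⊗ Z = X ⊗ (Y ⊗ Z)
  unit_tensor (X : C) : 𝟙_ C ⊗ X = X
  tensor_unit (X : C) : X ⊗ 𝟙_ C = X
  associator_eq (X Y Z : C) : α_ X Y Z = eqToIso (tensor_assoc X Y Z)
  leftUnitor_eq (X : C) : λ_ X = eqToIso (unit_tensor X)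
  rightUnitor_eq (X : C) : ρ_ X = eqToIso (tensor_unit X)

instance : IsPermutative FrCC.{u} where
  tensor_assoc := FrCC.tensorObj_assoc
  unit_tensor := FrCC.unit_tensorObj
  tensor_unit := FrCC.tensorObj_unit
  associator_eq _ _ _ := rfl
  leftUnitor_eq _ := rfl
  rightUnitor_eq _ := rfl

/-- Objects of the free permutative category on one generator: natural numbers. -/
@[ext]
structure FreePerm : Type u where
  card : ℕ

namespace FreePerm

/-- Morphisms `m ⟶ n` are the bijections from `{0, …, m - 1}` to `{0, …, n - 1}`. -/
@[ext]
structure Hom (m n : FreePerm.{u}) : Type u where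
  toEquiv : Fin m.card ≃ Fin n.card

instance : Category.{u} FreePerm.{u} where
  Hom := Hom
  id m := ⟨Equiv.refl _⟩
  comp σ τ := ⟨σ.toEquiv.trans τ.toEquiv⟩

def tensorObj (m n : FreePerm.{u}) : FreePerm.{u} := ⟨m.card + n.card⟩

def unit : FreePerm.{u} := ⟨0⟩

def tensorMor {m n m' n' : FreePerm.{u}} (σ : m ⟶ n) (τ : m' ⟶ n') :
    tensorObj m m' ⟶ tensorObj n n' :=
  Hom.mk <| finSumFinEquiv.symm.trans ((Equiv.sumCongr σ.toEquiv τ.toEquiv).trans finSumFinEquiv)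

theorem tensorObj_assoc (l m n : FreePerm.{u}) :
    tensorObj (tensorObj l m) n = tensorObj l (tensorObj m n) := FreePerm.ext (Nat.add_assoc _ _ _)

theorem unit_tensorObj (m : FreePerm.{u}) : tensorObj unit m = m := FreePerm.ext (Nat.zero_add _)

theorem tensorObj_unit (m : FreePerm.{u}) : tensorObj m unit = m := FreePerm.ext (Nat.add_zero _)

theorem hom_ext {m n : FreePerm.{u}} {σ τ : m ⟶ n}
    (h : ∀ x : Fin m.card, (σ.toEquiv x).val = (τ.toEquiv x).val) : σ = τ :=
  Hom.ext (Equiv.ext fun x => Fin.ext (h x))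

theorem comp_apply {l m n : FreePerm.{u}} (σ : l ⟶ m) (τ : m ⟶ n) (x : Fin l.card) :
    Hom.toEquiv (σ ≫ τ) x = τ.toEquiv (σ.toEquiv x) := rfl

theorem eqToHom_val {m n : FreePerm.{u}} (h : m = n) (x : Fin m.card) :
    (Hom.toEquiv (eqToHom h) x).val = x.val := by
  subst h
  rfl

theorem tensor_val {m n m' n' : FreePerm.{u}} (σ : m ⟶ n) (τ : m' ⟶ n')
    (x : Fin (tensorObj m m').card) :
    ((Hom.toEquiv (tensorMor σ τ)) x).val = if h : x.val < m.card then (σ.toEquiv ⟨x.val, h⟩).val else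
      n.card + (τ.toEquiv ⟨x.val - m.card, by
        have h : x.val < m.card + m'.card := x.isLt
        omega⟩).val :=
  FrCC.val_map (m := (tensorObj m m').card) (n := (tensorObj n n').card) rfl rfl _ _ x

def braid (m n : FreePerm.{u}) : tensorObj m n ≅ tensorObj n m where
  hom := ⟨finAddFlip⟩
  inv := ⟨finAddFlip⟩
  hom_inv_id := Hom.ext (Equiv.ext fun x => by
    change finAddFlip (finAddFlip x) = x
    exact finAddFlip.symm_apply_apply x)
  inv_hom_id := Hom.ext (Equiv.ext fun x => by
    change finAddFlip (finAddFlip x) = x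
    exact finAddFlip.symm_apply_apply x)

instance : MonoidalCategoryStruct FreePerm.{u} where
  tensorObj := tensorObj
  tensorHom := tensorMor
  whiskerLeft m _ _ σ := tensorMor (𝟙 m) σ
  whiskerRight σ m := tensorMor σ (𝟙 m)
  tensorUnit := unit
  associator _ _ _ := eqToIso (tensorObj_assoc _ _ _)
  leftUnitor _ := eqToIso (unit_tensorObj _)
  rightUnitor _ := eqToIso (tensorObj_unit _)

theorem card_tensorObj (m n : FreePerm.{u}) : (tensorObj m n).card = m.card + n.card := rfl

theorem id_apply (m : FreePerm.{u}) (x : Fin m.card) : Hom.toEquiv (𝟙 m) x = x := rfl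

theorem tensor_id (m n : FreePerm.{u}) : tensorMor (𝟙 m) (𝟙 n) = 𝟙 (tensorObj m n) := by
  refine hom_ext fun x => ?_
  rw [tensor_val]
  simp only [id_apply]
  split_ifs <;> omega

theorem tensor_comp {l m n l' m' n' : FreePerm.{u}} (σ : l ⟶ m) (σ' : l' ⟶ m') (τ : m ⟶ n)
    (τ' : m' ⟶ n') :
    (tensorMor σ σ' : tensorObj l l' ⟶ tensorObj m m') ≫
      (tensorMor τ τ' : tensorObj m m' ⟶ tensorObj n n') = tensorMor (σ ≫ τ) (σ' ≫ τ') := by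
  refine Hom.ext (Equiv.ext fun x => ?_)
  change finSumFinEquiv (Equiv.sumCongr τ.toEquiv τ'.toEquiv (finSumFinEquiv.symm
    (finSumFinEquiv (Equiv.sumCongr σ.toEquiv σ'.toEquiv (finSumFinEquiv.symm x))))) =
    finSumFinEquiv (Equiv.sumCongr (Hom.toEquiv (σ ≫ τ)) (Hom.toEquiv (σ' ≫ τ'))
      (finSumFinEquiv.symm x))
  rw [Equiv.symm_apply_apply]
  rcases finSumFinEquiv.symm x with y | y <;> rfl

theorem tensor_assoc {l m n l' m' n' : FreePerm.{u}} (σ : l ⟶ l') (τ : m ⟶ m') (υ : n ⟶ n') :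
    (tensorMor (tensorMor σ τ) υ :
        tensorObj (tensorObj l m) n ⟶ tensorObj (tensorObj l' m') n') ≫
        eqToHom (tensorObj_assoc l' m' n') =
      eqToHom (tensorObj_assoc l m n) ≫ tensorMor σ (tensorMor τ υ) := by
  refine hom_ext fun x => ?_
  have hx : x.val < l.card + m.card + n.card := x.isLt
  rw [comp_apply, eqToHom_val, comp_apply, tensor_val, tensor_val]
  simp only [eqToHom_val, tensor_val]
  simp only [card_tensorObj, Nat.sub_sub]
  split_ifs <;> first | rfl | omega

theorem unit_tensor {m n : FreePerm.{u}} (σ : m ⟶ n) :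
    (tensorMor (𝟙 unit) σ : tensorObj unit m ⟶ tensorObj unit n) ≫
        eqToHom (unit_tensorObj n) = eqToHom (unit_tensorObj m) ≫ σ := by
  refine hom_ext fun x => ?_
  have h0 : (unit.{u}).card = 0 := rfl
  have hx : (Hom.toEquiv (eqToHom (unit_tensorObj m)) x) = ⟨x.val - unit.card, by
    have h : x.val < unit.card + m.card := x.isLt
    omega⟩ := Fin.ext (eqToHom_val _ _)
  rw [comp_apply, comp_apply, eqToHom_val, tensor_val, hx, dif_neg (by simp [h0])]
  exact Nat.zero_add _

theorem tensor_unit {m n : FreePerm.{u}} (σ : m ⟶ n) :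
    (tensorMor σ (𝟙 unit) : tensorObj m unit ⟶ tensorObj n unit) ≫
        eqToHom (tensorObj_unit n) = eqToHom (tensorObj_unit m) ≫ σ := by
  refine hom_ext fun x => ?_
  have hx : (Hom.toEquiv (eqToHom (tensorObj_unit m)) x) = ⟨x.val, x.isLt⟩ :=
    Fin.ext (by rw [eqToHom_val])
  have hx' : x.val < m.card := x.isLt
  rw [comp_apply, comp_apply, eqToHom_val, tensor_val, hx, dif_pos hx']

theorem eqToHom_tensor_eqToHom {m n m' n' : FreePerm.{u}} (h : m = n) (h' : m' = n') :
    tensorMor (eqToHom h) (eqToHom h') =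
      (eqToHom (by rw [h, h']) : tensorObj m m' ⟶ tensorObj n n') := by
  subst h h'
  exact tensor_id _ _

theorem pentagon_aux (k l m n : FreePerm.{u}) :
    (tensorMor (eqToHom (tensorObj_assoc k l m)) (𝟙 n) :
        tensorObj (tensorObj (tensorObj k l) m) n ⟶ tensorObj (tensorObj k (tensorObj l m)) n) ≫
      eqToHom (tensorObj_assoc k (tensorObj l m) n) ≫
        (tensorMor (𝟙 k) (eqToHom (tensorObj_assoc l m n)) :
          tensorObj k (tensorObj (tensorObj l m) n) ⟶ tensorObj k (tensorObj l (tensorObj m n))) =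
      eqToHom (tensorObj_assoc (tensorObj k l) m n) ≫
        eqToHom (tensorObj_assoc k l (tensorObj m n)) := by
  have h1 := eqToHom_tensor_eqToHom (tensorObj_assoc k l m) (rfl : n = n)
  have h2 := eqToHom_tensor_eqToHom (rfl : k = k) (tensorObj_assoc l m n)
  rw [eqToHom_refl] at h1 h2
  rw [h1, h2]
  simp

theorem triangle_aux (m n : FreePerm.{u}) :
    eqToHom (tensorObj_assoc m unit n) ≫
      (tensorMor (𝟙 m) (eqToHom (unit_tensorObj n)) :
        tensorObj m (tensorObj unit n) ⟶ tensorObj m n) =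
      tensorMor (eqToHom (tensorObj_unit m)) (𝟙 n) := by
  have h1 := eqToHom_tensor_eqToHom (rfl : m = m) (unit_tensorObj n)
  have h2 := eqToHom_tensor_eqToHom (tensorObj_unit m) (rfl : n = n)
  rw [eqToHom_refl] at h1 h2
  rw [h1, h2]
  simp

instance : MonoidalCategory FreePerm.{u} := MonoidalCategory.ofTensorHom
  (id_tensorHom_id := tensor_id)
  (id_tensorHom := fun _ _ _ _ => rfl)
  (tensorHom_id := fun _ _ => rfl)
  (tensorHom_comp_tensorHom := tensor_comp)
  (associator_naturality := tensor_assoc)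
  (leftUnitor_naturality := unit_tensor)
  (rightUnitor_naturality := tensor_unit)
  (pentagon := pentagon_aux)
  (triangle := triangle_aux)

theorem braid_val (m n : FreePerm.{u}) (x : Fin (tensorObj m n).card) :
    (Hom.toEquiv (braid m n).hom x).val =
      if x.val < m.card then n.card + x.val else x.val - m.card :=
  FrCC.val_flip (m := (tensorObj m n).card) (n := (tensorObj n m).card) rfl rfl x

theorem braid_natural {m n m' n' : FreePerm.{u}} (σ : m ⟶ n) (τ : m' ⟶ n') :
    (tensorMor σ τ : tensorObj m m' ⟶ tensorObj n n') ≫ (braid n n').hom =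
      (braid m m').hom ≫ (tensorMor τ σ : tensorObj m' m ⟶ tensorObj n' n) := by
  refine Hom.ext (Equiv.ext fun x => ?_)
  change finSumFinEquiv (Equiv.sumComm _ _ (finSumFinEquiv.symm (finSumFinEquiv
    (Equiv.sumCongr σ.toEquiv τ.toEquiv (finSumFinEquiv.symm x))))) =
    finSumFinEquiv (Equiv.sumCongr τ.toEquiv σ.toEquiv (finSumFinEquiv.symm
      (finSumFinEquiv (Equiv.sumComm _ _ (finSumFinEquiv.symm x)))))
  rw [Equiv.symm_apply_apply, Equiv.symm_apply_apply]
  rcases finSumFinEquiv.symm x with y | y <;> rfl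

theorem hexagon₁ (l m n : FreePerm.{u}) :
    eqToHom (tensorObj_assoc l m n) ≫ (braid l (tensorObj m n)).hom ≫
        eqToHom (tensorObj_assoc m n l) =
      (tensorMor (braid l m).hom (𝟙 n) :
        tensorObj (tensorObj l m) n ⟶ tensorObj (tensorObj m l) n) ≫
        eqToHom (tensorObj_assoc m l n) ≫ tensorMor (𝟙 m) (braid l n).hom := by
  refine hom_ext fun x => ?_
  have hx : x.val < l.card + m.card + n.card := x.isLt
  rw [comp_apply, comp_apply, comp_apply, comp_apply]
  simp only [eqToHom_val, tensor_val, braid_val, id_apply]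
  simp only [card_tensorObj, dite_eq_ite]
  grind

theorem hexagon₂ (l m n : FreePerm.{u}) :
    eqToHom (tensorObj_assoc l m n).symm ≫ (braid (tensorObj l m) n).hom ≫
        eqToHom (tensorObj_assoc n l m).symm =
      (tensorMor (𝟙 l) (braid m n).hom :
        tensorObj l (tensorObj m n) ⟶ tensorObj l (tensorObj n m)) ≫
        eqToHom (tensorObj_assoc l n m).symm ≫ tensorMor (braid l n).hom (𝟙 m) := by
  refine hom_ext fun x => ?_
  have hx : x.val < l.card + (m.card + n.card) := x.isLt
  rw [comp_apply, comp_apply, comp_apply, comp_apply]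
  simp only [eqToHom_val, tensor_val, braid_val, id_apply]
  simp only [card_tensorObj, dite_eq_ite]
  grind

instance : SymmetricCategory FreePerm.{u} where
  braiding := braid
  braiding_naturality_right m _ _ σ := braid_natural (𝟙 m) σ
  braiding_naturality_left σ m := braid_natural σ (𝟙 m)
  hexagon_forward := hexagon₁
  hexagon_reverse := hexagon₂
  symmetry m n := (braid m n).hom_inv_id

instance : IsPermutative FreePerm.{u} where
  tensor_assoc := tensorObj_assoc
  unit_tensor := unit_tensorObj
  tensor_unit := tensorObj_unit
  associator_eq _ _ _ := rfl
  leftUnitor_eq _ := rfl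
  rightUnitor_eq _ := rfl

end FreePerm


section Strict

variable (C D E : Type u) [Category.{u} C] [MonoidalCategory C] [SymmetricCategory C]
  [Category.{u} D] [MonoidalCategory D] [SymmetricCategory D]
  [Category.{u} E] [MonoidalCategory E] [SymmetricCategory E]

/-- Strict symmetric monoidal functors: they preserve the unit, the tensor product of objects and of
morphisms, and the symmetry strictly. (The associators and unitors of permutative categories are
identities and are preserved by any functor that preserves unit and tensor product.) -/
structure StrictFunctor extends C ⥤ D where
  obj_unit : obj (𝟙_ C) = 𝟙_ D
  obj_tensor (X Y : C) : obj (X ⊗ Y) = obj X ⊗ obj Y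
  map_tensor {X Y X' Y' : C} (f : X ⟶ Y) (g : X' ⟶ Y') :
    map (f ⊗ₘ g) = eqToHom (obj_tensor X X') ≫ (map f ⊗ₘ map g) ≫ eqToHom (obj_tensor Y Y').symm
  map_braiding (X Y : C) :
    map (β_ X Y).hom =
      eqToHom (obj_tensor X Y) ≫ (β_ (obj X) (obj Y)).hom ≫ eqToHom (obj_tensor Y X).symm

variable {C D E}

namespace StrictFunctor

/-- Monoidal natural transformations between strict symmetric monoidal functors. -/
@[ext]
structure Hom (F G : StrictFunctor C D) where
  toNatTrans : F.toFunctor ⟶ G.toFunctor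
  app_unit : toNatTrans.app (𝟙_ C) = eqToHom (F.obj_unit.trans G.obj_unit.symm)
  app_tensor (X Y : C) :
    toNatTrans.app (X ⊗ Y) = eqToHom (F.obj_tensor X Y) ≫
      (toNatTrans.app X ⊗ₘ toNatTrans.app Y) ≫ eqToHom (G.obj_tensor X Y).symm

instance : Category.{u} (StrictFunctor C D) where
  Hom := Hom
  id F := ⟨𝟙 _, by simp, by simp⟩
  comp α β := ⟨α.toNatTrans ≫ β.toNatTrans,
    by simp [α.app_unit, β.app_unit], fun X Y => by
      simp [α.app_tensor, β.app_tensor]⟩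

variable (C) in
def id : StrictFunctor C C where
  toFunctor := 𝟭 C
  obj_unit := rfl
  obj_tensor _ _ := rfl
  map_tensor _ _ := by simp
  map_braiding _ _ := by simp

def comp (F : StrictFunctor C D) (G : StrictFunctor D E) : StrictFunctor C E where
  toFunctor := F.toFunctor ⋙ G.toFunctor
  obj_unit := (congrArg G.obj F.obj_unit).trans G.obj_unit
  obj_tensor X Y := (congrArg G.obj (F.obj_tensor X Y)).trans (G.obj_tensor _ _)
  map_tensor f g := by simp [F.map_tensor, G.map_tensor, eqToHom_map]
  map_braiding X Y := by simp [F.map_braiding, G.map_braiding, eqToHom_map]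

/-- Restriction along a strict symmetric monoidal functor. -/
def precomp (F : StrictFunctor C D) (E : Type u) [Category.{u} E] [MonoidalCategory E]
    [SymmetricCategory E] : StrictFunctor D E ⥤ StrictFunctor C E where
  obj G := F.comp G
  map α := ⟨Functor.whiskerLeft F.toFunctor α.toNatTrans, by
      rw [Functor.whiskerLeft_app, NatTrans.congr α.toNatTrans F.obj_unit, α.app_unit]
      simp [eqToHom_map]
      rfl, fun X Y => by
      rw [Functor.whiskerLeft_app, NatTrans.congr α.toNatTrans (F.obj_tensor X Y), α.app_tensor]
      simp [eqToHom_map]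
      rfl⟩
  map_id _ := rfl
  map_comp _ _ := rfl

end StrictFunctor

end Strict

/-- A (small) permutative category. -/
structure PermCat : Type (u + 1) where
  carrier : Type u
  [category : Category.{u} carrier]
  [monoidal : MonoidalCategory carrier]
  [symmetric : SymmetricCategory carrier]
  [permutative : IsPermutative carrier]

namespace PermCat

instance : CoeSort PermCat.{u} (Type u) := ⟨carrier⟩

attribute [instance] category monoidal symmetric permutative

/-- The category of permutative categories and strict symmetric monoidal functors. -/
instance : Category.{u} PermCat.{u} where
  Hom C D := StrictFunctor C D
  id C := StrictFunctor.id C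
  comp F G := F.comp G

/-- `C` is compact closed: each object `c` has a dual `d`, with `η : 𝟙_ C ⟶ d ⊗ c` and
`ε : c ⊗ d ⟶ 𝟙_ C` satisfying the triangle identities. -/
def IsCompactClosed (C : PermCat.{u}) : Prop :=
  ∀ c : C, ∃ d : C, Nonempty (ExactPairing d c)

/-- The weak equivalences of the natural model structure: strict symmetric monoidal functors
whose underlying functors are equivalences of categories. -/
def weakEquivalences : MorphismProperty PermCat.{u} :=
  fun _ _ F => (StrictFunctor.toFunctor F).IsEquivalence

/-- The fibrations of the natural model structure: strict symmetric monoidal functors whose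
underlying functors are isofibrations. Every permutative category is fibrant. -/
def fibrations : MorphismProperty PermCat.{u} :=
  fun C D F => ∀ (X : C) (Y : D) (e : (StrictFunctor.toFunctor F).obj X ≅ Y),
    ∃ (X' : C) (e' : X ≅ X') (h : (StrictFunctor.toFunctor F).obj X' = Y),
      (StrictFunctor.toFunctor F).map e'.hom ≫ eqToHom h = e.hom

/-- `X` is cofibrant in the natural model structure: the map from the initial object (the terminal
category) to `X` has the left lifting property with respect to the acyclic fibrations. -/
def IsCofibrant (X : PermCat.{u}) : Prop :=
  ∀ ⦃E B : PermCat.{u}⦄ (p : E ⟶ B), weakEquivalences p → fibrations p →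
    ∀ b : X ⟶ B, ∃ l : X ⟶ E, l ≫ p = b

end PermCat

/-- Simplicial homotopy classes of maps `K ⟶ Z`, used for Kan complexes `Z`. -/
def HomotopyClasses (K Z : SSet.{u}) : Type u :=
  Quot fun a b : K ⟶ Z => Nonempty (SSet.Homotopy a b)

/-- Composition with `f` on homotopy classes. -/
def HomotopyClasses.precomp {K L : SSet.{u}} (f : K ⟶ L) (Z : SSet.{u}) :
    HomotopyClasses L Z → HomotopyClasses K Z :=
  Quot.map (fun a => f ≫ a) fun a b ⟨H⟩ => ⟨
    { h := f ▷ _ ≫ H.h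
      h₀ := by
        rw [SSet.ι₀_comp_assoc, H.h₀]
        rfl
      h₁ := by
        rw [SSet.ι₁_comp_assoc, H.h₁]
        rfl
      rel := by ext _ ⟨⟨_, h⟩, _⟩; exact h.elim }⟩

/-- `f : K ⟶ L` is a weak homotopy equivalence of simplicial sets: for each Kan complex `Z` it
induces a bijection from the homotopy classes `[L, Z]` onto `[K, Z]`. -/
def IsWeakHomotopyEquivalence {K L : SSet.{u}} (f : K ⟶ L) : Prop :=
  ∀ (Z : SSet.{u}) [SSet.KanComplex Z], Function.Bijective (HomotopyClasses.precomp f Z)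

namespace PermCat

/-- For `X` cofibrant (and `C` fibrant, as every `C` is) this is a homotopy function complex of the
natural model structure: the nerve of the groupoid of strict symmetric monoidal functors `X ⟶ C` and
monoidal natural isomorphisms. Its `n`-simplices are the maps from `X` to the permutative category of
functors from the contractible groupoid with objects `0, …, n` to `C`, and these permutative
categories form a simplicial resolution of `C`. -/
def mapComplex (X C : PermCat.{u}) : SSet.{u} := nerve (Core (StrictFunctor X C))

/-- The map of function complexes induced by `g : X ⟶ Y`. -/
def mapComplexPrecomp {X Y : PermCat.{u}} (g : X ⟶ Y) (C : PermCat.{u}) :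
    mapComplex Y C ⟶ mapComplex X C :=
  nerveMap (StrictFunctor.precomp g C).core

/-- `g'` with `k`, `l` is a cofibrant approximation of `g`: a map of cofibrant objects with weak
equivalences to the ends of `g` making the square commute. -/
structure IsCofibrantApproximation {K L K' L' : PermCat.{u}} (g' : K' ⟶ L') (g : K ⟶ L)
    (k : K' ⟶ K) (l : L' ⟶ L) : Prop where
  cofibrant_left : IsCofibrant K'
  cofibrant_right : IsCofibrant L'
  weq_left : weakEquivalences k
  weq_right : weakEquivalences l
  comm : g' ≫ l = k ≫ g

/-- `C` is a `{g}`-local object of the natural model category: the map `Map^h(L, C) ⟶ Map^h(K, C)`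
of homotopy function complexes induced by `g : K ⟶ L` is a weak homotopy equivalence. The homotopy
function complexes are computed from cofibrant approximations of `g`. -/
def IsLocal {K L : PermCat.{u}} (g : K ⟶ L) (C : PermCat.{u}) : Prop :=
  ∀ ⦃K' L' : PermCat.{u}⦄ (g' : K' ⟶ L') (k : K' ⟶ K) (l : L' ⟶ L),
    IsCofibrantApproximation g' g k l → IsWeakHomotopyEquivalence (mapComplexPrecomp g' C)

/-- The free permutative category on one generator. -/
def freePerm : PermCat.{u} := ⟨FreePerm.{u}⟩
/-- The free compact closed permutative category on one generator. -/
def frCC : PermCat.{u} := ⟨FrCC.{u}⟩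

end PermCat

namespace FreePerm

/-- The number `n` goes to the word of `n` signs `+`. -/
def inclObj (n : FreePerm.{u}) : FrCC.{u} := ⟨List.replicate n.card .pos⟩

theorem count_pos (n : FreePerm.{u}) : (inclObj n).word.count .pos = n.card :=
  List.count_replicate_self

theorem count_neg (n : FreePerm.{u}) : (inclObj n).word.count .neg = 0 :=
  List.count_replicate.trans rfl

/-- A bijection goes to the morphism that joins `x` to `σ x`, without circles. -/
def inclMap {m n : FreePerm.{u}} (σ : m ⟶ n) : inclObj m ⟶ inclObj n :=
  FrCC.Hom.rel ((finCongr (count_pos m)).trans (σ.toEquiv.trans (finCongr (count_pos n).symm)))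
    (finCongr ((count_neg m).trans (count_neg n).symm))

theorem inclObj_tensor (m n : FreePerm.{u}) : inclObj (m ⊗ n) = inclObj m ⊗ inclObj n :=
  FrCC.ext (List.replicate_add _ _ _)

/-- The strict symmetric monoidal functor that sends the generator to `+`. -/
def incl : StrictFunctor FreePerm.{u} FrCC.{u} where
  obj := inclObj
  map := inclMap
  map_id n := by
    refine congrArg₂ FrCC.Hom.rel (Equiv.ext fun x => Fin.ext ?_) (Equiv.ext fun x => Fin.ext ?_)
    · rfl
    · rfl
  map_comp σ τ := by
    refine Eq.trans ?_ (FrCC.Hom.rel_comp_rel _ _ _ _).symm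
    refine congrArg₂ FrCC.Hom.rel (Equiv.ext fun x => Fin.ext ?_) (Equiv.ext fun x => Fin.ext ?_)
    · rfl
    · rfl
  obj_unit := rfl
  obj_tensor := inclObj_tensor
  map_tensor {m n m' n'} σ τ := by
    rw [FrCC.eqToHom_eq, FrCC.eqToHom_eq]
    refine Eq.trans ?_ (congrArg₂ FrCC.Hom.comp rfl
      (congrArg₂ FrCC.Hom.comp (FrCC.Hom.rel_tensor _ _ _ _) rfl)).symm
    rw [FrCC.Hom.rel_comp_rel, FrCC.Hom.rel_comp_rel]
    refine congrArg₂ FrCC.Hom.rel (Equiv.ext fun x => Fin.ext ?_) (Equiv.ext fun x => Fin.ext ?_)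
    · refine (tensor_val σ τ _).trans ?_
      refine Eq.trans ?_ (FrCC.val_map
        (FrCC.count_tensorObj (inclObj m) (inclObj m') .pos)
        (FrCC.count_tensorObj (inclObj n) (inclObj n') .pos) _ _ _).symm
      by_cases h : x.val < m.card
      · refine (dif_pos h).trans (Eq.trans ?_ (dif_pos (lt_of_lt_of_eq h (count_pos m).symm)).symm)
        rfl
      · refine (dif_neg h).trans (Eq.trans ?_ (dif_neg (fun h' => h (lt_of_lt_of_eq h' (count_pos m)))).symm)
        refine congrArg₂ (· + ·) (count_pos n).symm ?_
        refine congrArg (fun z => (τ.toEquiv z).val) (Fin.ext ?_)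
        exact congrArg (x.val - ·) (count_pos m).symm
    · exact (Fin.cast (count_neg _) x).elim0
  map_braiding m n := by
    rw [FrCC.eqToHom_eq, FrCC.eqToHom_eq]
    refine Eq.trans ?_ (congrArg₂ FrCC.Hom.comp rfl (FrCC.Hom.rel_comp_rel _ _ _ _)).symm
    rw [FrCC.Hom.rel_comp_rel]
    refine congrArg₂ FrCC.Hom.rel (Equiv.ext fun x => Fin.ext ?_) (Equiv.ext fun x => Fin.ext ?_)
    · refine (braid_val m n _).trans ?_
      refine Eq.trans ?_ (FrCC.val_flip
        (FrCC.count_tensorObj (inclObj m) (inclObj n) .pos)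
        (FrCC.count_tensorObj (inclObj n) (inclObj m) .pos) _).symm
      by_cases h : x.val < m.card
      · refine (if_pos h).trans (Eq.trans ?_ (if_pos (lt_of_lt_of_eq h (count_pos m).symm)).symm)
        exact congrArg (· + x.val) (count_pos n).symm
      · refine (if_neg h).trans (Eq.trans ?_ (if_neg (fun h' => h (lt_of_lt_of_eq h' (count_pos m)))).symm)
        exact congrArg (x.val - ·) (count_pos m).symm
    · exact (Fin.cast (count_neg _) x).elim0
end FreePerm

namespace PermCat

/-- The inclusion of the free permutative category on one generator into the free compact closed
permutative category on one generator. -/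
def inclusion : freePerm.{u} ⟶ frCC.{u} := FreePerm.incl

end PermCat

end PermCC

/-! Up to isomorphism, a strict symmetric monoidal functor from the free permutative category to `C`
is an object of `C`, and one from the free compact closed category is an object with a chosen dual.
An isomorphism of objects extends uniquely to an isomorphism of dualities. Hence restriction along
the inclusion is always fully faithful on groupoids of functors, and it is essentially surjective
when all objects have duals (`FreePerm.isEquivalence_core_precomp_incl`). An equivalence of
groupoids gives a weak equivalence of nerves. Conversely, a weak equivalence of nerves makes
restriction essentially surjective (`exists_iso_of_isWeakHomotopyEquivalence`); then each object is
isomorphic to the value of some functor at the positive point, and this value has a dual.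

The main work is the universal property of the free compact closed category, that is, coherence.
Composites of interchanges, cups and caps are treated as formal expressions (`Path`), which can be
evaluated in any category with suitable data (`Interp`). An expression starting at the unit is
brought to a normal form, which records the partner of the first letter and then a normal form of
the rest, with the circles innermost (`StateNF.exists_eval_eq`). The normal form does not depend on
the category of evaluation. In the free category every morphism from the unit is the value of
exactly one normal form (`FrCC.exists_stateOf_eq`, `FrCC.eval_injective`). This is proved by
counting two-colourings: composition becomes matrix multiplication and a circle becomes a factor
two. Arbitrary morphisms are reduced to such states by bending the source around. So the elementary
morphisms generate, and any relation between them in the free category holds for every object with a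
dual (`FrCC.eval_eq_of_eval_interp_eq`). Permutations are handled in the same way, with insertion
sort as normal form.

A `Presentation` records generation by letters and elementary morphisms. Functors out of a presented
category lift along fully faithful functors (`Presentation.exists_lift`). Consequently presented
categories are cofibrant, and restriction along a weak equivalence onto one is an equivalence. Every
cofibrant approximation of the inclusion is thereby compared with the inclusion itself. -/

namespace PermCC

/-! ### Nerves and weak homotopy equivalences -/

open Simplicial in
/-- A natural transformation induces a simplicial homotopy of the maps of nerves. -/
noncomputable def nerveHomotopy {A B : Type u} [Category.{u} A] [Category.{u} B] {F G : A ⥤ B}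
    (τ : F ⟶ G) : SSet.Homotopy (nerveMap F) (nerveMap G) where
  -- A simplex of `Δ[1]` is a monotone map to a chain of two elements. Followed by the arrow `τ` of
  -- the functor category it is a chain of functors, which is evaluated along the given chain in
  -- `A`.
  h := { app n := ↾fun p => Functor.prod'
            ((SSet.stdSimplex.asOrderHom p.2).monotone.functor ⋙ ComposableArrows.mk₁ τ) p.1 ⋙ Functor.uncurry.obj (𝟭 _)
         naturality := by
          intro n m f
          ext p
          rfl }
  h₀ := by
    ext n x
    refine CategoryTheory.Functor.ext (fun _ => rfl) ?_
    intro i j f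
    change (𝟙 F : F ⟶ F).app _ ≫ F.map (x.map f) = 𝟙 _ ≫ F.map (x.map f) ≫ 𝟙 _
    simp
  h₁ := by
    ext n x
    refine CategoryTheory.Functor.ext (fun _ => rfl) ?_
    intro i j f
    change (𝟙 G : G ⟶ G).app _ ≫ G.map (x.map f) = 𝟙 _ ≫ G.map (x.map f) ≫ 𝟙 _
    simp
  rel := by ext _ ⟨⟨_, h⟩, _⟩; exact h.elim

theorem isWeakHomotopyEquivalence_nerveMap {A B : Type u} [Category.{u} A] [Category.{u} B]
    (F : A ⥤ B) [F.IsEquivalence] : IsWeakHomotopyEquivalence (nerveMap F) := by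
  intro Z _
  -- A natural transformation in one direction is enough; the counit and the inverse of the unit
  -- supply the two halves.
  have key : ∀ {A B : Type u} [Category.{u} A] [Category.{u} B] (F : A ⥤ B) (G : B ⥤ A)
      (_ : F ⋙ G ⟶ 𝟭 A) (x : HomotopyClasses (nerve A) Z), HomotopyClasses.precomp (nerveMap F) Z
        (HomotopyClasses.precomp (nerveMap G) Z x) = x := by
    intro A B _ _ F G τ x
    obtain ⟨x, rfl⟩ := Quot.exists_rep x
    refine Quot.sound ⟨?_⟩
    exact
      { h := (nerveHomotopy τ).h ≫ x
        h₀ := by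
          rw [← Category.assoc, SSet.Homotopy.h₀]; rfl
        h₁ := by
          rw [← Category.assoc, SSet.Homotopy.h₁]; rfl
        rel := by ext _ ⟨⟨_, h⟩, _⟩; exact h.elim }
  refine Function.bijective_iff_has_inverse.2 ⟨HomotopyClasses.precomp (nerveMap F.inv) Z, ?_, ?_⟩
  · exact key F.inv F F.asEquivalence.counitIso.hom
  · exact key F F.inv F.asEquivalence.unitIso.inv

/-- The constant simplicial set. -/
def constSSet (T : Type u) : SSet.{u} := (Functor.const _).obj T

/-- The structure maps are identities, so two faces of a horn that agree along a common face have
the same value, and this value fills the horn. -/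
instance (T : Type u) : SSet.KanComplex (constSSet T) := by
  rw [SSet.KanComplex.iff]
  intro n i f hf
  have key : ∃ z : T, ∀ j hj, SSet.yonedaEquiv (f j hj) = z := by
    obtain ⟨j₀, hj₀⟩ : ∃ j, j ≠ i := exists_ne i
    refine ⟨SSet.yonedaEquiv (f j₀ hj₀), fun j hj => ?_⟩
    cases n with
    -- A one-dimensional horn has a single face.
    | zero => congr 2; omega
    | succ n =>
      have hlt : ∀ j k (hj : j ≠ i) (hk : k ≠ i), j < k →
          SSet.yonedaEquiv (f j hj) = SSet.yonedaEquiv (f k hk) := by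
        intro j k hj hk hjk
        have h1 := congrArg SSet.yonedaEquiv (hf j k hj hk hjk)
        exact (SSet.yonedaEquiv_naturality _ _).trans
          (h1.trans (SSet.yonedaEquiv_naturality _ _).symm)
      rcases lt_trichotomy j j₀ with h | h | h
      · exact hlt _ _ _ _ h
      · subst h; rfl
      · exact (hlt _ _ _ _ h).symm
  obtain ⟨z, hz⟩ := key
  refine ⟨SSet.yonedaEquiv.symm z, fun j hj => SSet.yonedaEquiv.injective ?_⟩
  rw [hz]
  rfl

open Simplicial in
/-- A functor between groupoids that induces a weak equivalence of nerves is essentially surjective. -/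
theorem exists_iso_of_isWeakHomotopyEquivalence {A B : Type u} [Groupoid.{u} A] [Groupoid.{u} B]
    (F : A ⥤ B) (h : IsWeakHomotopyEquivalence (nerveMap F)) (b : B) :
    ∃ a : A, Nonempty (F.obj a ≅ b) := by
  let Z : SSet.{u} := constSSet (ULift.{u} Prop)
  -- The characteristic function of the essential image of `F`. It is simplicial because the
  -- vertices of a simplex are isomorphic in the groupoid `B`.
  let χ : nerve B ⟶ Z :=
    { app n := ↾fun x => ULift.up (∃ a : A, Nonempty (F.obj a ≅ x.obj 0))
      naturality := by
        intro n m f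
        ext x
        refine congrArg ULift.up (propext (exists_congr fun a => ?_))
        let e := (Groupoid.isoEquivHom _ _).symm (x.map (homOfLE
      (Fin.zero_le (SimplexCategory.Hom.toOrderHom f.unop 0))))
        exact ⟨fun ⟨i⟩ => ⟨i ≪≫ e.symm⟩, fun ⟨i⟩ => ⟨i ≪≫ e⟩⟩ }
  let ω : nerve B ⟶ Z := { app n := ↾fun x => ULift.up True, naturality := fun _ _ _ => rfl }
  let ev : HomotopyClasses (nerve B) Z → ULift.{u} Prop :=
    Quot.lift (fun a => a.app (Opposite.op ⦋0⦌) (ComposableArrows.mk₀ b)) (by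
      rintro a a' ⟨H⟩
      let v : (nerve B).obj (Opposite.op ⦋0⦌) := ComposableArrows.mk₀ b
      -- Both ends of a homotopy are read off its value at this edge, degenerate in the nerve and
      -- nondegenerate in `Δ[1]`, since the face maps of `Z` are identities.
      let p : (nerve B ⊗ Δ[1] : SSet.{u}).obj (Opposite.op ⦋1⦌) :=
        ((nerve B).σ 0 v, SSet.stdSimplex.objEquiv.symm (𝟙 _))
      have e₀ : a.app (Opposite.op ⦋0⦌) v = H.h.app (Opposite.op ⦋1⦌) p := by
        refine (ConcreteCategory.congr_hom (congr_app (SSet.Homotopy.h₀ H).symm _) v).trans ?_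
        refine Eq.trans ?_ (ConcreteCategory.congr_hom
          (H.h.naturality (SimplexCategory.δ (1 : Fin 2)).op) p)
        refine congrArg (H.h.app _) (Prod.ext ?_ ?_)
        · exact ((nerve B).δ_comp_σ_succ_apply (0 : Fin 1) v).symm
        · ext k
          fin_cases k
          rfl
      have e₁ : a'.app (Opposite.op ⦋0⦌) v = H.h.app (Opposite.op ⦋1⦌) p := by
        refine (ConcreteCategory.congr_hom (congr_app (SSet.Homotopy.h₁ H).symm _) v).trans ?_
        refine Eq.trans ?_ (ConcreteCategory.congr_hom
          (H.h.naturality (SimplexCategory.δ (0 : Fin 2)).op) p)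
        refine congrArg (H.h.app _) (Prod.ext ?_ ?_)
        · exact ((nerve B).δ_comp_σ_self_apply (0 : Fin 1) v).symm
        · ext k
          fin_cases k
          rfl
      exact e₀.trans e₁.symm)
  -- Over the nerve of `A` the two maps coincide, so injectivity identifies their classes over the
  -- nerve of `B`.
  have h1 : HomotopyClasses.precomp (nerveMap F) Z (Quot.mk _ χ) =
      HomotopyClasses.precomp (nerveMap F) Z (Quot.mk _ ω) := by
    refine congrArg (Quot.mk _) ?_
    ext n x
    exact congrArg ULift.up (propext ⟨fun _ => trivial, fun _ => ⟨x.obj 0, ⟨Iso.refl _⟩⟩⟩)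
  have h2 := congrArg ev ((h Z).1 h1)
  exact (ULift.up_injective h2).mpr trivial
end PermCC

/-! ### Cups, caps and interchanges in front of an object -/

namespace PermCC

section Calculus

variable {C : Type u} [Category.{u} C] [MonoidalCategory C]

/-- Insertion of `η` in front. -/
def cupW {A B : C} (η : 𝟙_ C ⟶ A ⊗ B) (X : C) : X ⟶ A ⊗ B ⊗ X :=
  (λ_ X).inv ≫ η ▷ X ≫ (α_ A B X).hom

/-- Evaluation of the first two factors by `ε`. -/
def capW {A B : C} (ε : A ⊗ B ⟶ 𝟙_ C) (X : C) : A ⊗ B ⊗ X ⟶ X :=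
  (α_ A B X).inv ≫ ε ▷ X ≫ (λ_ X).hom

theorem cupW_natural {A B : C} (η : 𝟙_ C ⟶ A ⊗ B) {X Y : C} (f : X ⟶ Y) :
    f ≫ cupW η Y = cupW η X ≫ A ◁ B ◁ f := by
  simp only [cupW, Category.assoc, leftUnitor_inv_naturality_assoc, whisker_exchange_assoc,
    associator_naturality_right]

theorem capW_natural {A B : C} (ε : A ⊗ B ⟶ 𝟙_ C) {X Y : C} (f : X ⟶ Y) :
    A ◁ B ◁ f ≫ capW ε Y = capW ε X ≫ f := by
  simp only [capW, Category.assoc, associator_inv_naturality_right_assoc, whisker_exchange_assoc,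
    leftUnitor_naturality]

/-- A closed loop passes any morphism by naturality; this moves circles to the innermost place of a
normal form. -/
theorem loop_comm {A B X Y Z : C} (η : 𝟙_ C ⟶ A ⊗ B) (ε : A ⊗ B ⟶ 𝟙_ C) (n : Z ⟶ X) (f : X ⟶ Y) :
    (n ≫ f) ≫ cupW η Y ≫ capW ε Y = (n ≫ cupW η X ≫ capW ε X) ≫ f := by
  simp only [Category.assoc, ← capW_natural]
  rw [reassoc_of% cupW_natural η f]

/-- Connects the triangle composite with its form in terms of `cupW` and `capW`, in which the
associators are hidden. -/
theorem zigzag_left_eq {c d : C} (η : 𝟙_ C ⟶ d ⊗ c) (ε : c ⊗ d ⟶ 𝟙_ C) (X : C) :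
    c ◁ cupW η X ≫ capW ε (c ⊗ X) = c ◁ (λ_ X).inv ≫ (α_ _ _ _).inv ≫
      (c ◁ η ≫ (α_ c d c).inv ≫ ε ▷ c) ▷ X ≫ (α_ _ _ _).hom ≫ (λ_ _).hom := by
  simp [cupW, capW]

theorem zigzag_right_eq {c d : C} (η : 𝟙_ C ⟶ d ⊗ c) (ε : c ⊗ d ⟶ 𝟙_ C) (X : C) :
    cupW η (d ⊗ X) ≫ d ◁ capW ε X = (λ_ _).inv ≫ (α_ _ _ _).inv ≫
      (η ▷ d ≫ (α_ d c d).hom ≫ d ◁ ε) ▷ X ≫ (α_ _ _ _).hom ≫ d ◁ (λ_ _).hom := by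
  simp [cupW, capW]

theorem zigzag_left {c d : C} [ExactPairing d c] (X : C) :
    c ◁ cupW (η_ d c) X ≫ capW (ε_ d c) (c ⊗ X) = 𝟙 _ := by
  rw [zigzag_left_eq, ExactPairing.coevaluation_evaluation]
  simp

theorem zigzag_right {c d : C} [ExactPairing d c] (X : C) :
    cupW (η_ d c) (d ⊗ X) ≫ d ◁ capW (ε_ d c) X = 𝟙 _ := by
  rw [zigzag_right_eq, ExactPairing.evaluation_coevaluation]
  simp

/-- Whiskering with the unit is faithful, so the zigzag at the unit already contains the triangle
identity. -/
theorem triangle_of_zigzag {c d : C} {η : 𝟙_ C ⟶ d ⊗ c} {ε : c ⊗ d ⟶ 𝟙_ C}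
    (h : c ◁ cupW η (𝟙_ C) ≫ capW ε (c ⊗ 𝟙_ C) = 𝟙 _) :
    c ◁ η ≫ (α_ c d c).inv ≫ ε ▷ c = (ρ_ c).hom ≫ (λ_ c).inv := by
  rw [zigzag_left_eq] at h
  have h1 := congrArg (fun m => ((α_ _ _ _).hom ≫ c ◁ (λ_ (𝟙_ C)).hom) ≫ m ≫
    (λ_ _).inv ≫ (α_ _ _ _).inv) h
  refine (whiskerRight_iff _ _).1 (Eq.trans ?_ (h1.trans ?_))
  · simp
  · monoidal

theorem zigzag_of_zigzag_unit {c d : C} {η : 𝟙_ C ⟶ d ⊗ c} {ε : c ⊗ d ⟶ 𝟙_ C}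
    (h : c ◁ cupW η (𝟙_ C) ≫ capW ε (c ⊗ 𝟙_ C) = 𝟙 _) (X : C) :
    c ◁ cupW η X ≫ capW ε (c ⊗ X) = 𝟙 _ := by
  rw [zigzag_left_eq, triangle_of_zigzag h]
  simp

/-- A duality from the triangle identities for insertion and evaluation in front. -/
abbrev exactPairingOfZigzag {c d : C} (η : 𝟙_ C ⟶ d ⊗ c) (ε : c ⊗ d ⟶ 𝟙_ C)
    (h : c ◁ cupW η (𝟙_ C) ≫ capW ε (c ⊗ 𝟙_ C) = 𝟙 _)
    (h' : cupW η (d ⊗ 𝟙_ C) ≫ d ◁ capW ε (𝟙_ C) = 𝟙 _) : ExactPairing d c where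
  coevaluation' := η
  evaluation' := ε
  coevaluation_evaluation' := triangle_of_zigzag h
  evaluation_coevaluation' := by
    rw [zigzag_right_eq] at h'
    have h1 := congrArg (fun m => ((α_ _ _ _).hom ≫ (λ_ _).hom) ≫ m ≫
      d ◁ (λ_ (𝟙_ C)).inv ≫ (α_ _ _ _).inv) h'
    refine (whiskerRight_iff _ _).1 (Eq.trans ?_ (h1.trans ?_))
    · simp
    · monoidal

variable [SymmetricCategory C]

/-- Interchange of the first two factors. -/
def sw (A B X : C) : A ⊗ B ⊗ X ⟶ B ⊗ A ⊗ X :=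
  (α_ A B X).inv ≫ (β_ A B).hom ▷ X ≫ (α_ B A X).hom

theorem sw_natural (A B : C) {X Y : C} (f : X ⟶ Y) :
    A ◁ B ◁ f ≫ sw A B Y = sw A B X ≫ B ◁ A ◁ f := by
  simp only [sw, Category.assoc, associator_inv_naturality_right_assoc, whisker_exchange_assoc,
    associator_naturality_right]

theorem sw_natural_left {A A' : C} (f : A ⟶ A') (B X : C) :
    f ▷ (B ⊗ X) ≫ sw A' B X = sw A B X ≫ B ◁ f ▷ X := by
  simp only [sw, Category.assoc, associator_inv_naturality_left_assoc, ← comp_whiskerRight_assoc,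
    BraidedCategory.braiding_naturality_left]
  simp

theorem sw_natural_mid (A : C) {B B' : C} (f : B ⟶ B') (X : C) :
    A ◁ f ▷ X ≫ sw A B' X = sw A B X ≫ f ▷ (A ⊗ X) := by
  simp only [sw, Category.assoc, associator_inv_naturality_middle_assoc, ← comp_whiskerRight_assoc,
    BraidedCategory.braiding_naturality_right]
  simp

theorem sw_sw (A B X : C) : sw A B X ≫ sw B A X = 𝟙 _ := by
  simp [sw, ← comp_whiskerRight_assoc]

theorem sw_yang_baxter (A B D X : C) :
    sw A B (D ⊗ X) ≫ B ◁ sw A D X ≫ sw B D (A ⊗ X) =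
      A ◁ sw B D X ≫ sw A D (B ⊗ X) ≫ D ◁ sw A B X := by
  have h := BraidedCategory.yang_baxter A B D
  have h2 := congrArg (fun f => (α_ A B (D ⊗ X)).inv ≫ (α_ _ _ _).inv ≫ (α_ A B D).hom ▷ X ≫
    f ▷ X ≫ (α_ _ _ _).hom ≫ D ◁ (α_ _ _ _).hom) h
  simp only [sw]
  refine Eq.trans ?_ (h2.trans ?_) <;> · simp; try monoidal

theorem cupW_sw {A B : C} (η : 𝟙_ C ⟶ A ⊗ B) (X : C) :
    cupW η X ≫ sw A B X = cupW (η ≫ (β_ A B).hom) X := by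
  simp [cupW, sw]

theorem sw_capW {A B : C} (ε : A ⊗ B ⟶ 𝟙_ C) (X : C) :
    sw B A X ≫ capW ε X = capW ((β_ B A).hom ≫ ε) X := by
  simp [capW, sw]

/-- A letter slides through a cup. -/
theorem cupW_slide {A B : C} (η : 𝟙_ C ⟶ A ⊗ B) (D X : C) :
    cupW η (D ⊗ X) ≫ A ◁ sw B D X ≫ sw A D (B ⊗ X) = D ◁ cupW η X := by
  -- Naturality of the braiding in `η`, whose source is the unit, with which every braiding is
  -- trivial.
  have h := BraidedCategory.braiding_naturality_left η D
  have h2 := congrArg (fun f => (λ_ _).inv ≫ (α_ _ _ _).inv ≫ f ▷ X ≫ (α_ _ _ _).hom ≫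
     D ◁ (α_ _ _ _).hom) h
  refine Eq.trans ?_ (h2.trans ?_)
  · simp [cupW, sw, BraidedCategory.braiding_tensor_left_hom]
  · simp [cupW, braiding_tensorUnit_left]

theorem capW_slide {A B : C} (ε : A ⊗ B ⟶ 𝟙_ C) (D X : C) :
    sw D A (B ⊗ X) ≫ A ◁ sw D B X ≫ capW ε (D ⊗ X) = D ◁ capW ε X := by
  have h := BraidedCategory.braiding_naturality_right D ε
  have h2 := congrArg (fun f => D ◁ (α_ _ _ _).inv ≫ (α_ _ _ _).inv ≫ f ▷ X ≫ (α_ _ _ _).hom ≫ (λ_ _).hom) h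
  refine Eq.trans ?_ (h2.symm.trans ?_)
  · simp [capW, sw, BraidedCategory.braiding_tensor_right_hom]
  · simp [capW, braiding_tensorUnit_right]

/-- The outer letter slides through the cup, the Yang–Baxter equation for `d`, `d`, `c` brings two
opposite crossings together, they cancel, and the rest slides through the cap. So in a symmetric
category duality is a symmetric relation. -/
theorem zigzag_symm_eq {c d : C} (η : 𝟙_ C ⟶ d ⊗ c) (ε : c ⊗ d ⟶ 𝟙_ C) (X : C) :
    d ◁ cupW (η ≫ (β_ d c).hom) X ≫ capW ((β_ d c).hom ≫ ε) (d ⊗ X) =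
      cupW η (d ⊗ X) ≫ d ◁ capW ε X := by
  rw [← cupW_sw, ← sw_capW, whiskerLeft_comp, ← cupW_slide]
  simp only [Category.assoc]
  rw [reassoc_of% sw_yang_baxter d d c X, ← whiskerLeft_comp_assoc, sw_sw, capW_slide]
  simp

theorem zigzag_symm {c d : C} [ExactPairing d c] (X : C) :
    d ◁ cupW (η_ d c ≫ (β_ d c).hom) X ≫ capW ((β_ d c).hom ≫ ε_ d c) (d ⊗ X) = 𝟙 _ := by
  rw [zigzag_symm_eq, zigzag_right]

/-- This and the next three lemmas carry the inductions on insertions, with arbitrary objects in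
place of words; `i` and `j` stand for insertions. -/
theorem sw_whisker_comp (A B : C) {U W W' : C} (i : A ⊗ U ⟶ W) (x : W ⟶ W') :
    (sw A B U ≫ B ◁ i) ≫ B ◁ x = sw A B U ≫ B ◁ (i ≫ x) := by
  simp

theorem sw_whisker_exchange (A B D : C) {U W : C} (i : A ⊗ U ⟶ W) :
    (sw A B (D ⊗ U) ≫ B ◁ (sw A D U ≫ D ◁ i)) ≫ sw B D W =
      A ◁ sw B D U ≫ sw A D (B ⊗ U) ≫ D ◁ (sw A B U ≫ B ◁ i) := by
  have h := congrArg (· ≫ D ◁ B ◁ i) (sw_yang_baxter A B D U)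
  simp only [Category.assoc] at h
  simp only [whiskerLeft_comp, Category.assoc, sw_natural, h]

theorem sw_whisker_comm (A B : C) {U U' W W' : C} {i : A ⊗ U ⟶ W} {x : W ⟶ W'} {y : U ⟶ U'}
    {j : A ⊗ U' ⟶ W'} (h : i ≫ x = A ◁ y ≫ j) :
    (sw A B U ≫ B ◁ i) ≫ B ◁ x = A ◁ B ◁ y ≫ sw A B U' ≫ B ◁ j := by
  rw [sw_whisker_comp, h, whiskerLeft_comp, ← Category.assoc, ← sw_natural, Category.assoc]

theorem sw_whisker_double (P Q A : C) {U₁ U U₂ W : C} {j : P ⊗ U₁ ⟶ U} {i : Q ⊗ U ⟶ W}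
    {i' : Q ⊗ U₁ ⟶ U₂} {j' : P ⊗ U₂ ⟶ W} (h : Q ◁ j ≫ i = sw Q P U₁ ≫ P ◁ i' ≫ j') :
    Q ◁ (sw P A U₁ ≫ A ◁ j) ≫ sw Q A U ≫ A ◁ i =
      sw Q P (A ⊗ U₁) ≫ P ◁ (sw Q A U₁ ≫ A ◁ i') ≫ sw P A U₂ ≫ A ◁ j' := by
  have hy := congrArg (· ≫ A ◁ (P ◁ i' ≫ j')) (sw_yang_baxter Q P A U₁)
  simp only [Category.assoc, whiskerLeft_comp] at hy
  have h1 := reassoc_of% sw_natural Q A j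
  have h2 := reassoc_of% sw_natural P A i'
  rw [whiskerLeft_comp, Category.assoc, h1, ← whiskerLeft_comp, h]
  simp only [whiskerLeft_comp, Category.assoc]
  rw [h2, hy]

end Calculus
end PermCC

/-! ### Words, formal composites and insertion of letters -/

namespace PermCC

variable {S : Type} {Pair : S → S → Prop}

/-- Objects for the letters of an alphabet, with a cup and a cap for each pair of opposite letters. -/
structure Interp (S : Type) (Pair : S → S → Prop) (C : Type u) [Category.{u} C]
    [MonoidalCategory C] where
  v : S → C
  cup {a b : S} (h : Pair a b) : 𝟙_ C ⟶ v a ⊗ v b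
  cap {a b : S} (h : Pair a b) : v a ⊗ v b ⟶ 𝟙_ C

/-- The tensor product of the letters of a word. -/
def wordObj {C : Type u} [Category.{u} C] [MonoidalCategory C] (v : S → C) : List S → C
  | [] => 𝟙_ C
  | a :: w => v a ⊗ wordObj v w

/-- Interchange of two neighbouring letters of a word. -/
inductive Swap : List S → List S → Type
  | head (a b : S) (w : List S) : Swap (a :: b :: w) (b :: a :: w)
  | cons (a : S) {u w : List S} (x : Swap u w) : Swap (a :: u) (a :: w)

/-- The elementary morphisms. -/
inductive Move (Pair : S → S → Prop) : List S → List S → Type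
  | swap {u w : List S} (x : Swap u w) : Move Pair u w
  | cup {a b : S} (h : Pair a b) (w : List S) : Move Pair w (a :: b :: w)
  | cap {a b : S} (h : Pair a b) (w : List S) : Move Pair (a :: b :: w) w

/-- Formal composites of elementary morphisms. -/
inductive Path (Pair : S → S → Prop) : List S → List S → Type
  | nil (w : List S) : Path Pair w w
  | snoc {u w z : List S} (p : Path Pair u w) (x : Move Pair w z) : Path Pair u z

/-- `Ins s w w'` : the word `w'` arises from `w` by insertion of the letter `s`. -/
inductive Ins (s : S) : List S → List S → Type
  | here (w : List S) : Ins s w (s :: w)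
  | there (a : S) {u w : List S} (i : Ins s u w) : Ins s (a :: u) (a :: w)

namespace Path

def append {u w x : List S} (p : Path Pair u w) : Path Pair w x → Path Pair u x
  | nil _ => p
  | snoc q y => snoc (append p q) y

/-- Formal tensor product with a letter on the left. -/
def _root_.PermCC.Move.cons (a : S) {u w : List S} : Move Pair u w → Path Pair (a :: u) (a :: w)
  | .swap x => snoc (nil _) (.swap (.cons a x))
  -- Elementary cups occur only at the front, so a cup behind `a` is made in front of it, and two
  -- interchanges bring `a` back.
  | .cup (a := b) (b := c) h w =>
    snoc (snoc (snoc (nil _) (.cup h (a :: w))) (.swap (.cons b (.head c a w))))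
      (.swap (.head b a (c :: w)))
  | .cap (a := b) (b := c) h w =>
    snoc (snoc (snoc (nil _) (.swap (.head a b (c :: w)))) (.swap (.cons b (.head a c w))))
      (.cap h (a :: w))

/-- Formal tensor product with a letter on the left. -/
def cons (a : S) {u w : List S} : Path Pair u w → Path Pair (a :: u) (a :: w)
  | nil _ => nil _
  | snoc p x => (cons a p).append (x.cons a)

end Path

/-- An insertion is a chain of interchanges that carries the letter from the front to its place. -/
def Ins.toPath {s : S} : {w w' : List S} → Ins s w w' → Path Pair (s :: w) w'
  | _, _, .here w => .nil _
  | _, _, .there (u := u) a i => ((Path.nil _).snoc (.swap (.head s a u))).append (i.toPath.cons a)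

section Eval

variable {C : Type u} [Category.{u} C] [MonoidalCategory C] [SymmetricCategory C]

def Swap.eval (v : S → C) : {u w : List S} → Swap u w → (wordObj v u ⟶ wordObj v w)
  | _, _, .head a b w => sw (v a) (v b) (wordObj v w)
  | _, _, .cons a x => v a ◁ x.eval v

def Ins.eval (v : S → C) {s : S} : {u w : List S} → Ins s u w → (v s ⊗ wordObj v u ⟶ wordObj v w)
  | _, _, .here _ => 𝟙 _
  | _, _, .there (u := u) a i => sw (v s) (v a) (wordObj v u) ≫ v a ◁ i.eval v

variable (M : Interp S Pair C)

def Move.eval {u w : List S} : Move Pair u w → (wordObj M.v u ⟶ wordObj M.v w)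
  | .swap x => x.eval M.v
  | .cup h w => cupW (M.cup h) (wordObj M.v w)
  | .cap h w => capW (M.cap h) (wordObj M.v w)

def Path.eval {u w : List S} : Path Pair u w → (wordObj M.v u ⟶ wordObj M.v w)
  | .nil _ => 𝟙 _
  | .snoc p x => p.eval ≫ x.eval M

@[simp]
theorem Path.eval_append {u w x : List S} (p : Path Pair u w) (q : Path Pair w x) :
    (p.append q).eval M = p.eval M ≫ q.eval M := by
  induction q with
  | nil => simp [append, eval]
  | snoc q y ih => simp [append, eval, ih]

/-- For cups and caps this is the sliding of the letter through them. -/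
theorem Move.eval_cons (a : S) {u w : List S} (x : Move Pair u w) :
    (x.cons a).eval M = M.v a ◁ x.eval M := by
  cases x with
  | swap x => exact Category.id_comp _
  | cup h w =>
    refine Eq.trans ?_ (cupW_slide (M.cup h) (M.v a) (wordObj M.v _))
    exact (Category.assoc _ _ _).trans (congrArg (· ≫ _) (Category.id_comp _))
  | cap h w =>
    refine Eq.trans ?_ (capW_slide (M.cap h) (M.v a) (wordObj M.v _))
    exact (Category.assoc _ _ _).trans (congrArg (· ≫ _) (Category.id_comp _))

@[simp]
theorem Path.eval_cons (a : S) {u w : List S} (p : Path Pair u w) :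
    (p.cons a).eval M = M.v a ◁ p.eval M := by
  induction p with
  | nil => exact (whiskerLeft_id _ _).symm
  | snoc p x ih =>
    refine (eval_append M _ _).trans ?_
    rw [ih, Move.eval_cons]
    exact (whiskerLeft_comp _ _ _).symm

@[simp]
theorem Ins.eval_toPath {s : S} {w w' : List S} (i : Ins s w w') :
    (i.toPath : Path Pair _ _).eval M = i.eval M.v := by
  induction i with
  | here => rfl
  | there a i ih =>
    refine (Path.eval_append M _ _).trans ?_
    rw [Path.eval_cons, ih]
    exact (Category.assoc _ _ _).trans (Category.id_comp _)

end Eval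

/-- A letter is inserted and two neighbouring letters are interchanged. -/
theorem Ins.eval_swap {s : S} {u w w' : List S} (i : Ins s u w) (x : Swap w w') :
    (∃ j : Ins s u w', ∀ (C : Type u) [Category.{u} C] [MonoidalCategory C] [SymmetricCategory C]
      (v : S → C), i.eval v ≫ x.eval v = j.eval v) ∨
    ∃ (u' : List S) (y : Swap u u') (j : Ins s u' w'), ∀ (C : Type u) [Category.{u} C]
      [MonoidalCategory C] [SymmetricCategory C] (v : S → C),
      i.eval v ≫ x.eval v = v s ◁ y.eval v ≫ j.eval v := by
  induction i generalizing w' with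
  | here u =>
    cases x with
    | head a b w =>
      -- The inserted letter is one of the two interchanged, so it only moves by one place.
      refine Or.inl ⟨.there b (.here w), fun C _ _ _ v => (Category.id_comp _).trans ?_⟩
      exact ((congrArg (_ ≫ ·) (whiskerLeft_id _ _)).trans (Category.comp_id _)).symm
    | cons a x =>
      refine Or.inr ⟨_, x, .here _, fun C _ _ _ v => (Category.id_comp _).trans ?_⟩
      exact (Category.comp_id _).symm
  | there a i ih =>
    cases x with
    | head a b w =>
      cases i with
      | here =>
        refine Or.inl ⟨.here _, fun C _ _ _ v => Eq.trans ?_ (sw_sw _ _ _)⟩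
        exact congrArg (· ≫ _) ((congrArg (_ ≫ ·) (whiskerLeft_id _ _)).trans (Category.comp_id _))
      | there b i =>
        -- Neither interchanged letter is the inserted one, so the interchange can be done before
        -- the insertion.
        exact Or.inr ⟨_, .head a b _, .there b (.there a i), fun C _ _ _ v =>
          sw_whisker_exchange (v s) (v a) (v b) (i.eval v)⟩
    | cons a x =>
      obtain ⟨j, hj⟩ | ⟨u', y, j, hj⟩ := ih x
      · refine Or.inl ⟨.there a j, fun C _ _ _ v => ?_⟩
        exact (sw_whisker_comp (v s) (v a) (i.eval v) (x.eval v)).trans (by rw [hj]; rfl)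
      · exact Or.inr ⟨_, .cons a y, .there a j, fun C _ _ _ v =>
          sw_whisker_comm (v s) (v a) (hj C v)⟩

/-- Two letters are inserted in the two possible orders. -/
theorem Ins.eval_exchange {p q : S} {u₁ u w : List S} (j : Ins p u₁ u) (i : Ins q u w) :
    ∃ (u₂ : List S) (i' : Ins q u₁ u₂) (j' : Ins p u₂ w), ∀ (C : Type u) [Category.{u} C]
      [MonoidalCategory C] [SymmetricCategory C] (v : S → C),
      v q ◁ j.eval v ≫ i.eval v = sw (v q) (v p) _ ≫ v p ◁ i'.eval v ≫ j'.eval v := by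
  induction i generalizing u₁ with
  | here u =>
    -- Here `q` stands in front: it is put there first and `p` is inserted behind it; the two
    -- additional crossings cancel.
    refine ⟨_, .here _, .there q j, fun C _ _ _ v => ?_⟩
    refine (Category.comp_id _).trans (Eq.symm ?_)
    refine (congrArg (_ ≫ ·) ((congrArg (· ≫ _) (whiskerLeft_id _ _)).trans
      (Category.id_comp _))).trans ?_
    exact (reassoc_of% sw_sw (v q) (v p) (wordObj v _)) _
  | there a i ih =>
    cases j with
    | here =>
      refine ⟨_, i, .here _, fun C _ _ _ v => ?_⟩
      refine ((congrArg (· ≫ _) (whiskerLeft_id _ _)).trans (Category.id_comp _)).trans ?_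
      exact congrArg (_ ≫ ·) (Category.comp_id _).symm
    | there a j =>
      obtain ⟨u₂, i', j', h⟩ := ih j
      exact ⟨_, .there a i', .there a j', fun C _ _ _ v =>
        sw_whisker_double (v p) (v q) (v a) (h C v)⟩

end PermCC

/-! ### Normal forms of formal composites -/

namespace PermCC

variable {S : Type} {Pair : S → S → Prop}

/-- Normal forms of composites of interchanges of letters. -/
inductive PermNF : List S → List S → Type
  | nil : PermNF [] []
  | cons {s : S} {u w w' : List S} (N : PermNF u w) (i : Ins s w w') : PermNF (s :: u) w'

def PermNF.eval {C : Type u} [Category.{u} C] [MonoidalCategory C] [SymmetricCategory C]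
    (v : S → C) : {u w : List S} → PermNF u w → (wordObj v u ⟶ wordObj v w)
  | _, _, .nil => 𝟙 _
  | _, _, .cons (s := s) N i => v s ◁ N.eval v ≫ i.eval v

def PermNF.toPath : {u w : List S} → PermNF u w → Path Pair u w
  | _, _, .nil => .nil _
  | _, _, .cons (s := s) N i => (N.toPath.cons s).append i.toPath

theorem PermNF.eval_toPath {C : Type u} [Category.{u} C] [MonoidalCategory C] [SymmetricCategory C]
    (M : Interp S Pair C) {u w : List S} (N : PermNF u w) :
    (N.toPath : Path Pair _ _).eval M = N.eval M.v := by
  induction N with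
  | nil => rfl
  | cons N i ih =>
    refine (Path.eval_append M _ _).trans ?_
    rw [Path.eval_cons, ih, Ins.eval_toPath]
    rfl

theorem PermNF.exists_id (u : List S) : ∃ N : PermNF u u, ∀ (C : Type u) [Category.{u} C]
    [MonoidalCategory C] [SymmetricCategory C] (v : S → C), N.eval v = 𝟙 _ := by
  induction u with
  | nil => exact ⟨.nil, fun _ _ _ _ _ => rfl⟩
  | cons a u ih =>
    obtain ⟨N, h⟩ := ih
    refine ⟨.cons N (.here _), fun C _ _ _ v => ?_⟩
    refine (Category.comp_id _).trans ?_
    rw [h]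
    exact whiskerLeft_id _ _

/-- A step of insertion sort: the interchange is absorbed by the outermost insertion or passes it
and is absorbed further inside. The normal form is chosen before the category, so it can transport
equalities from one category to another. -/
theorem PermNF.exists_comp_swap {u w w' : List S} (N : PermNF u w) (x : Swap w w') :
    ∃ N' : PermNF u w', ∀ (C : Type u) [Category.{u} C]
      [MonoidalCategory C] [SymmetricCategory C] (v : S → C), N.eval v ≫ x.eval v = N'.eval v := by
  induction N generalizing w' with
  | nil => cases x
  | cons N i ih =>
    obtain ⟨j, hj⟩ | ⟨u', y, j, hj⟩ := i.eval_swap x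
    · refine ⟨.cons N j, fun C _ _ _ v => ?_⟩
      refine (Category.assoc _ _ _).trans ?_
      rw [hj]
      rfl
    · obtain ⟨N', hN⟩ := ih y
      refine ⟨.cons N' j, fun C _ _ _ v => ?_⟩
      refine (Category.assoc _ _ _).trans ?_
      rw [hj]
      refine (Category.assoc _ _ _).symm.trans (congrArg (· ≫ _) ?_)
      rw [← hN]
      exact (whiskerLeft_comp _ _ _).symm

/-- Every formal composite of interchanges has a normal form. -/
theorem PermNF.exists_eval_eq (hP : ∀ a b, ¬ Pair a b) {u w : List S} (p : Path Pair u w) :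
    ∃ N : PermNF u w, ∀ (C : Type u) [Category.{u} C] [MonoidalCategory C] [SymmetricCategory C]
      (M : Interp S Pair C), p.eval M = N.eval M.v := by
  induction p with
  | nil =>
    obtain ⟨N, hN⟩ := exists_id.{u} _
    exact ⟨N, fun C _ _ _ M => (hN C M.v).symm⟩
  | snoc p x ih =>
    obtain ⟨N, hN⟩ := ih
    cases x with
    | swap x =>
      obtain ⟨N', h⟩ := N.exists_comp_swap x
      refine ⟨N', fun C _ _ _ M => ?_⟩
      rw [← h, ← hN]
      rfl
    | cup h => exact (hP _ _ h).elim
    | cap h => exact (hP _ _ h).elim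

/-- The cups and caps of an interpretation are compatible with the symmetry and satisfy the
triangle identities. -/
structure Interp.IsDual {C : Type u} [Category.{u} C] [MonoidalCategory C] [SymmetricCategory C]
    (M : Interp PointSign (· ≠ ·) C) : Prop where
  cup_braiding {a b : PointSign} (h : a ≠ b) : M.cup h ≫ (β_ _ _).hom = M.cup h.symm
  braiding_cap {a b : PointSign} (h : a ≠ b) : (β_ _ _).hom ≫ M.cap h = M.cap h.symm
  zigzag {a b : PointSign} (h : a ≠ b) (X : C) :
    M.v a ◁ cupW (M.cup h.symm) X ≫ capW (M.cap h) (M.v a ⊗ X) = 𝟙 _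

namespace Interp.IsDual

variable {C : Type u} [Category.{u} C] [MonoidalCategory C] [SymmetricCategory C]
  {M : Interp PointSign (· ≠ ·) C}

theorem cupW_sw (hM : M.IsDual) {a b : PointSign} (h : a ≠ b) (X : C) :
    cupW (M.cup h) X ≫ sw _ _ X = cupW (M.cup h.symm) X := by
  rw [PermCC.cupW_sw, hM.cup_braiding]

theorem sw_capW (hM : M.IsDual) {a b : PointSign} (h : a ≠ b) (X : C) :
    sw _ _ X ≫ capW (M.cap h) X = capW (M.cap h.symm) X := by
  rw [PermCC.sw_capW, hM.braiding_cap]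

/-- The zigzag with the letter slid through the cup. This kinked strand arises when a cap meets one
end of a cup whose other end lies further to the right. -/
theorem cupW_sw_capW (hM : M.IsDual) {a b : PointSign} (h : a ≠ b) (X : C) :
    cupW (M.cup h) (M.v b ⊗ X) ≫ M.v a ◁ sw _ _ X ≫ capW (M.cap h) (M.v b ⊗ X) = 𝟙 _ := by
  rw [← hM.zigzag h.symm X, ← cupW_slide, ← hM.sw_capW h]
  simp only [Category.assoc]
  rw [reassoc_of% sw_sw (M.v a) (M.v b)]

/-- Two crossings cancel, so both orientations give the same circle and one constructor for circles
suffices. -/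
theorem loop_symm (hM : M.IsDual) {a b : PointSign} (h : a ≠ b) (X : C) :
    cupW (M.cup h) X ≫ capW (M.cap h) X = cupW (M.cup h.symm) X ≫ capW (M.cap h.symm) X := by
  rw [← hM.cupW_sw h, ← hM.sw_capW h, Category.assoc, reassoc_of% sw_sw (M.v a) (M.v b)]

end Interp.IsDual

/-- Normal forms of morphisms from the unit to a word. -/
inductive StateNF : List PointSign → Type
  | nil : StateNF []
  | circle (N : StateNF []) : StateNF []
  | cons {s t : PointSign} (h : s ≠ t) {w w' : List PointSign} (N : StateNF w) (i : Ins t w w') :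
    StateNF (s :: w')

theorem neg_ne_pos : PointSign.neg ≠ PointSign.pos := nofun

/-- Circles are added only over the empty word and letters are never removed again at the outer
steps, so all circles are innermost. -/
def StateNF.toPath : {w : List PointSign} → StateNF w → Path (· ≠ ·) [] w
  | _, .nil => .nil _
  | _, .circle N => (N.toPath.snoc (.cup neg_ne_pos [])).snoc (.cap neg_ne_pos [])
  | _, .cons (s := s) (w := w) h N i => (N.toPath.snoc (.cup h w)).append (i.toPath.cons s)

/-- The morphism given by a normal form. -/
abbrev StateNF.eval {C : Type u} [Category.{u} C] [MonoidalCategory C] [SymmetricCategory C]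
    (M : Interp PointSign (· ≠ ·) C) {w : List PointSign} (N : StateNF w) :
    wordObj M.v [] ⟶ wordObj M.v w := N.toPath.eval M

section
variable {C : Type u} [Category.{u} C] [MonoidalCategory C] [SymmetricCategory C]
    (M : Interp PointSign (· ≠ ·) C)

theorem StateNF.eval_circle (N : StateNF []) : N.circle.eval M = N.eval M ≫
    cupW (M.cup neg_ne_pos) (𝟙_ C) ≫ capW (M.cap neg_ne_pos) (𝟙_ C) := Category.assoc _ _ _

theorem StateNF.eval_cons {s t : PointSign} (h : s ≠ t) {w w' : List PointSign} (N : StateNF w)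
    (i : Ins t w w') : (StateNF.cons h N i).eval M =
      N.eval M ≫ cupW (M.cup h) (wordObj M.v w) ≫ M.v s ◁ i.eval M.v := by
  refine (Path.eval_append M _ _).trans ?_
  rw [Path.eval_cons, Ins.eval_toPath]
  exact Category.assoc _ _ _

/-- A first letter with its partner is inserted, and then the first two letters are interchanged. -/
theorem cupW_double_swap {A B D E U₁ U U₂ W Z : C} (η : 𝟙_ C ⟶ A ⊗ B) (θ : 𝟙_ C ⟶ D ⊗ E)
    (n : Z ⟶ U₁) {j : E ⊗ U₁ ⟶ U} {i : B ⊗ U ⟶ W}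
    {i' : B ⊗ U₁ ⟶ U₂} {j' : E ⊗ U₂ ⟶ W} (h : B ◁ j ≫ i = sw B E U₁ ≫ E ◁ i' ≫ j') :
    ((n ≫ cupW θ U₁ ≫ D ◁ j) ≫ cupW η (D ⊗ U) ≫ A ◁ (sw B D U ≫ D ◁ i)) ≫ sw A D W =
      (n ≫ cupW η U₁ ≫ A ◁ i') ≫ cupW θ (A ⊗ U₂) ≫ D ◁ (sw E A U₂ ≫ A ◁ j') := by
  -- The final interchange exposes the cup `η` as placed behind the letter `D`.
  have e1 : (cupW η (D ⊗ U) ≫ A ◁ (sw B D U ≫ D ◁ i)) ≫ sw A D W = D ◁ (cupW η U ≫ A ◁ i) := by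
    rw [whiskerLeft_comp, whiskerLeft_comp, ← cupW_slide]
    simp only [Category.assoc, sw_natural]
  have e2 : ∀ X : C, E ◁ cupW η X ≫ sw E A (B ⊗ X) = cupW η (E ⊗ X) ≫ A ◁ sw B E X := by
    intro X
    rw [← cupW_slide]
    simp [sw_sw]
  -- By `h` the letter `E` may be inserted after the pair made by `η` instead of before it.
  have e3 : E ◁ (cupW η U₁ ≫ A ◁ i') ≫ sw E A U₂ ≫ A ◁ j' = j ≫ cupW η U ≫ A ◁ i := by
    have := sw_natural E A i'
    rw [whiskerLeft_comp, Category.assoc, reassoc_of% this, reassoc_of% e2 U₁,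
      reassoc_of% cupW_natural η j, ← whiskerLeft_comp, ← whiskerLeft_comp, ← whiskerLeft_comp, h]
  calc _ = n ≫ cupW θ U₁ ≫ D ◁ j ≫ (cupW η (D ⊗ U) ≫ A ◁ (sw B D U ≫ D ◁ i)) ≫ sw A D W := by
        simp only [Category.assoc]
    _ = n ≫ cupW θ U₁ ≫ D ◁ (j ≫ cupW η U ≫ A ◁ i) := by rw [e1, ← whiskerLeft_comp]
    _ = n ≫ (cupW η U₁ ≫ A ◁ i') ≫ cupW θ (A ⊗ U₂) ≫ D ◁ (sw E A U₂ ≫ A ◁ j') := by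
      have := cupW_natural θ (cupW η U₁ ≫ A ◁ i')
      rw [← e3, whiskerLeft_comp, ← Category.assoc (cupW θ U₁), ← this]
      simp only [Category.assoc]
    _ = _ := by simp only [Category.assoc]

/-- The cap joins the first letter to a second letter that is not its partner. Once the strand is
straightened, the second letter has simply moved to the place of that partner. -/
theorem cup_sw_cap_ins {A B U W : C} {η : 𝟙_ C ⟶ A ⊗ B} {ε : A ⊗ B ⟶ 𝟙_ C}
    (h : cupW η (B ⊗ U) ≫ A ◁ sw B B U ≫ capW ε (B ⊗ U) = 𝟙 _) (i : B ⊗ U ⟶ W) :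
    (cupW η (B ⊗ U) ≫ A ◁ (sw B B U ≫ B ◁ i)) ≫ capW ε W = i := by
  simp only [whiskerLeft_comp, Category.assoc, capW_natural]
  rw [← Category.assoc, ← Category.assoc, Category.assoc _ _ (capW ε _), h, Category.id_comp]

end

namespace StateNF

/-- Normal forms are stable under the interchange of letters. -/
theorem exists_comp_swap {w w' : List PointSign} (N : StateNF w) (x : Swap w w') :
    ∃ N' : StateNF w', ∀ (C : Type u) [Category.{u} C] [MonoidalCategory C] [SymmetricCategory C]
      (M : Interp PointSign (· ≠ ·) C), M.IsDual → N.eval M ≫ x.eval M.v = N'.eval M := by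
  induction N generalizing w' with
  | nil => cases x
  | circle => cases x
  | cons h N i ih =>
    rename_i s t w₀ w₁
    cases x with
    -- The first letter is untouched: the interchange is absorbed by the insertion of its partner or
    -- reaches the inner state.
    | cons _ x =>
      obtain ⟨j, hj⟩ | ⟨u', y, j, hj⟩ := i.eval_swap x
      · refine ⟨.cons h N j, fun C _ _ _ M hM => ?_⟩
        rw [eval_cons, eval_cons, ← hj]
        refine (Category.assoc _ _ _).trans (congrArg (_ ≫ ·) ?_)
        refine (Category.assoc _ _ _).trans (congrArg (_ ≫ ·) ?_)
        exact (whiskerLeft_comp _ _ _).symm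
      · obtain ⟨N', hN⟩ := ih y
        refine ⟨.cons h N' j, fun C _ _ _ M hM => ?_⟩
        rw [eval_cons, eval_cons, ← hN C M hM, Category.assoc,
          reassoc_of% cupW_natural (M.cup h) (y.eval M.v), ← whiskerLeft_comp, ← hj]
        refine (Category.assoc _ _ _).trans (congrArg (_ ≫ ·) ?_)
        refine (Category.assoc _ _ _).trans (congrArg (_ ≫ ·) ?_)
        exact (whiskerLeft_comp _ _ _).symm
    | head _ b w =>
      cases i with
      | here =>
        -- The first two letters are partners, and the same cup is read in the other orientation.
        refine ⟨.cons h.symm N (.here _), fun C _ _ _ M hM => ?_⟩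
        rw [eval_cons, eval_cons]
        refine (Category.assoc _ _ _).trans (congrArg (_ ≫ ·) ?_)
        refine (congrArg (· ≫ _) ((congrArg (_ ≫ ·) (whiskerLeft_id _ _)).trans
          (Category.comp_id _))).trans ((hM.cupW_sw h _).trans ?_)
        exact ((congrArg (_ ≫ ·) (whiskerLeft_id _ _)).trans (Category.comp_id _)).symm
      | there _ i =>
        -- The first two letters have different partners, and the two pairs are created in the
        -- opposite order.
        cases N with
        | cons h' N j =>
          obtain ⟨u₂, i', j', e⟩ := j.eval_exchange i
          refine ⟨.cons h' (.cons h N i') (.there _ j'), fun C _ _ _ M hM => ?_⟩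
          rw [eval_cons, eval_cons, eval_cons, eval_cons]
          exact cupW_double_swap (M.cup h) (M.cup h') (N.eval M) (e C M.v)

/-- Normal forms are stable under the insertion of a circle. -/
theorem exists_comp_loop {w : List PointSign} (N : StateNF w) :
    ∃ N' : StateNF w, ∀ (C : Type u) [Category.{u} C] [MonoidalCategory C] [SymmetricCategory C]
      (M : Interp PointSign (· ≠ ·) C), N.eval M ≫ cupW (M.cup neg_ne_pos) _ ≫
        capW (M.cap neg_ne_pos) _ = N'.eval M := by
  induction N with
  | nil => exact ⟨.circle .nil, fun C _ _ _ M => (eval_circle M _).symm⟩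
  | circle N => exact ⟨.circle (.circle N), fun C _ _ _ M => (eval_circle M _).symm⟩
  | cons h N i ih =>
    obtain ⟨N', hN⟩ := ih
    refine ⟨.cons h N' i, fun C _ _ _ M => ?_⟩
    rw [eval_cons, eval_cons, ← hN C M]
    exact loop_comm _ _ _ _

/-- Used after a strand has been straightened, when one letter must be carried to the place of
another. -/
theorem exists_comp_perm {w w' : List PointSign} (N : StateNF w)
    (p : Path (fun _ _ : PointSign => False) w w') :
    ∃ N' : StateNF w', ∀ (C : Type u) [Category.{u} C] [MonoidalCategory C] [SymmetricCategory C]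
      (M : Interp PointSign (· ≠ ·) C), M.IsDual →
        N.eval M ≫ p.eval ⟨M.v, False.elim, False.elim⟩ = N'.eval M := by
  induction p with
  | nil => exact ⟨N, fun C _ _ _ M _ => Category.comp_id _⟩
  | snoc p x ih =>
    obtain ⟨N', h⟩ := ih
    cases x with
    | swap x =>
      obtain ⟨N'', h'⟩ := N'.exists_comp_swap x
      refine ⟨N'', fun C _ _ _ M hM => ?_⟩
      rw [← h' C M hM, ← h C M hM]
      exact (Category.assoc _ _ _).symm
    | cup hc => exact hc.elim
    | cap hc => exact hc.elim

/-- Normal forms are stable under elementary morphisms. -/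
theorem exists_comp_move {w w' : List PointSign} (N : StateNF w) (x : Move (· ≠ ·) w w') :
    ∃ N' : StateNF w', ∀ (C : Type u) [Category.{u} C] [MonoidalCategory C] [SymmetricCategory C]
      (M : Interp PointSign (· ≠ ·) C), M.IsDual → N.eval M ≫ x.eval M = N'.eval M := by
  cases x with
  | swap x => exact N.exists_comp_swap x
  | cup h w =>
    refine ⟨.cons h N (.here _), fun C _ _ _ M hM => ?_⟩
    rw [eval_cons]
    exact congrArg (_ ≫ ·)
      ((congrArg (_ ≫ ·) (whiskerLeft_id _ _)).trans (Category.comp_id _)).symm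
  | cap h w =>
    rename_i s t
    cases N with
    | cons h' N i =>
      cases i with
      | here =>
        -- The cap closes the outermost cup to a circle, which is pushed inwards.
        obtain ⟨N', hN⟩ := exists_comp_loop.{u} N
        refine ⟨N', fun C _ _ _ M hM => ?_⟩
        rw [← hN, eval_cons]
        refine (congrArg (· ≫ _) (congrArg (_ ≫ ·) ((congrArg (_ ≫ ·) (whiskerLeft_id _ _)).trans
          (Category.comp_id _)))).trans ?_
        refine (Category.assoc _ _ _).trans (congrArg (_ ≫ ·) ?_)
        cases s <;> cases t
        · exact (h rfl).elim
        · exact hM.loop_symm h _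
        · rfl
        · exact (h rfl).elim
      | there _ i =>
        rename_i t' u
        -- Both signs are opposite to `s`, so the letter that is carried over has the sign of the
        -- one it replaces.
        obtain rfl : t' = t := by cases s <;> cases t <;> cases t' <;> first | rfl | contradiction
        obtain ⟨N', hN⟩ := N.exists_comp_perm i.toPath
        refine ⟨N', fun C _ _ _ M hM => ?_⟩
        rw [← hN C M hM, eval_cons, Ins.eval_toPath]
        refine (Category.assoc _ _ _).trans (congrArg (_ ≫ ·) ?_)
        exact cup_sw_cap_ins (hM.cupW_sw_capW h _) _

/-- Every formal composite of elementary morphisms that begins at the unit has a normal form. -/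
theorem exists_eval_eq {w : List PointSign} (p : Path (· ≠ ·) [] w) :
    ∃ N : StateNF w, ∀ (C : Type u) [Category.{u} C] [MonoidalCategory C] [SymmetricCategory C]
      (M : Interp PointSign (· ≠ ·) C), M.IsDual → p.eval M = N.eval M := by
  induction p with
  | nil => exact ⟨.nil, fun C _ _ _ M _ => rfl⟩
  | snoc p x ih =>
    obtain ⟨N, h⟩ := ih
    obtain ⟨N', h'⟩ := N.exists_comp_move x
    refine ⟨N', fun C _ _ _ M hM => ?_⟩
    rw [← h' C M hM, ← h C M hM]
    rfl

end StateNF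

end PermCC

/-! ### Colouring matrices of the elementary morphisms -/

namespace PermCC

namespace FrCC

/-- The object given by a single point. -/
def pt (a : PointSign) : FrCC.{u} := ⟨[a]⟩

theorem count_pair {a b : PointSign} (h : a ≠ b) (s : PointSign) : [a, b].count s = 1 := by
  cases a <;> cases b <;> cases s <;> first | rfl | exact (h rfl).elim

/-- The arc that joins two opposite points. -/
def arcUp {a b : PointSign} (h : a ≠ b) : 𝟙_ FrCC.{u} ⟶ pt a ⊗ pt b :=
  Hom.mk (Equiv.sumCongr (Equiv.refl _)
    (finCongr ((count_pair h .neg).trans (count_pair h .pos).symm))) 0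

def arcDown {a b : PointSign} (h : a ≠ b) : pt a ⊗ pt b ⟶ 𝟙_ FrCC.{u} :=
  Hom.mk (Equiv.sumCongr (finCongr ((count_pair h .pos).trans (count_pair h .neg).symm))
    (Equiv.refl _)) 0

/-- The tautological interpretation. -/
def interp : Interp PointSign (· ≠ ·) FrCC.{u} where
  v := pt
  cup h := arcUp h
  cap h := arcDown h

/-- The colouring of a single point. -/
def single (a : PointSign) (x : Bool) : Col (pt.{u} a) := (fun _ => x, fun _ => x)

/-- Only one of the two components of such a colouring has a nonempty domain. -/
theorem exists_single {a : PointSign} (c : Col (pt.{u} a)) : ∃ x, c = single a x := by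
  cases a
  · refine ⟨c.1 ⟨0, Nat.one_pos⟩, Prod.ext (funext fun i => congrArg c.1 (Fin.ext ?_)) (funext fun i => Fin.elim0 i)⟩
    exact Nat.lt_one_iff.1 i.isLt
  · refine ⟨c.2 ⟨0, Nat.one_pos⟩, Prod.ext (funext fun i => Fin.elim0 i) (funext fun i => congrArg c.2 (Fin.ext ?_))⟩
    exact Nat.lt_one_iff.1 i.isLt

theorem single_injective (a : PointSign) : Function.Injective (single.{u} a) := by
  intro x y h
  cases a
  · exact congrFun (congrArg Prod.fst h) ⟨0, Nat.one_pos⟩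
  · exact congrFun (congrArg Prod.snd h) ⟨0, Nat.one_pos⟩

abbrev pairCol {f g : FrCC.{u}} (a : Col f) (b : Col g) : Col (f ⊗ g) := (colEquiv f g).symm (a, b)

@[simp] theorem fst_pairCol {f g : FrCC.{u}} (a : Col f) (b : Col g) : (pairCol a b).fst = a :=
  congrArg Prod.fst ((colEquiv f g).apply_symm_apply (a, b))

@[simp] theorem snd_pairCol {f g : FrCC.{u}} (a : Col f) (b : Col g) : (pairCol a b).snd = b :=
  congrArg Prod.snd ((colEquiv f g).apply_symm_apply (a, b))

theorem exists_pairCol {f g : FrCC.{u}} (c : Col (f ⊗ g)) : ∃ a b, c = pairCol a b :=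
  ⟨c.fst, c.snd, ((colEquiv f g).symm_apply_apply c).symm⟩

theorem pairCol_inj {f g : FrCC.{u}} {a a' : Col f} {b b' : Col g} :
    pairCol a b = pairCol a' b' ↔ a = a' ∧ b = b' := by
  rw [(colEquiv f g).symm.injective.eq_iff, Prod.ext_iff]

instance : Unique (Col (𝟙_ FrCC.{u})) where
  default := (fun _ => false, fun _ => false)
  uniq _ := Prod.ext (funext fun i => Fin.elim0 i) (funext fun i => Fin.elim0 i)

theorem wt_tensorHom {f g f' g' : FrCC.{u}} (σ : f ⟶ g) (σ' : f' ⟶ g') (a a' b b') :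
    Hom.wt (σ ⊗ₘ σ') (pairCol a a') (pairCol b b') = Hom.wt σ a b * Hom.wt σ' a' b' := by
  refine (Hom.wt_tensor σ σ' _ _).trans ?_
  simp

theorem wt_id' {f : FrCC.{u}} (a b : Col f) : Hom.wt (𝟙 f) a b = if a = b then 1 else 0 :=
  Hom.wt_id a b

theorem wt_comp' {f g h : FrCC.{u}} (σ : f ⟶ g) (τ : g ⟶ h) (a : Col f) (c : Col h) :
    Hom.wt (σ ≫ τ) a c = ∑ b : Col g, Hom.wt σ a b * Hom.wt τ b c := Hom.wt_comp σ τ a c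

theorem col_ext {f g : FrCC.{u}} {c d : Col (f ⊗ g)} (h : c.fst = d.fst) (h' : c.snd = d.snd) :
    c = d := (colEquiv f g).injective (Prod.ext h h')

/-- Points of each sign are numbered from left to right, so reassociation keeps their numbers. -/
theorem pairCol_assoc {f g h : FrCC.{u}} (a : Col f) (b : Col g) (c : Col h) (hc hc') :
    ((pairCol a (pairCol b c)).1 ∘ Fin.cast hc, (pairCol a (pairCol b c)).2 ∘ Fin.cast hc') =
      pairCol (pairCol a b) c := by
  refine col_ext (col_ext ?_ ?_) ?_
  · rw [fst_pairCol, fst_pairCol]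
    conv_rhs => rw [← fst_pairCol a (pairCol b c)]
    rfl
  · rw [fst_pairCol, snd_pairCol]
    conv_rhs => rw [← fst_pairCol b c, ← snd_pairCol a (pairCol b c)]
    rfl
  · rw [snd_pairCol]
    conv_rhs => rw [← snd_pairCol b c, ← snd_pairCol a (pairCol b c)]
    refine Prod.ext (funext fun x => congrArg (pairCol a (pairCol b c)).1 (Fin.ext ?_))
        (funext fun x => congrArg (pairCol a (pairCol b c)).2 (Fin.ext ?_))
    · simp only [Function.comp_apply, Fin.val_cast, val_splitP_inr]
      exact (congrArg (· + x.val) (count_tensorObj f g _)).trans (add_assoc _ _ _)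
    · simp only [Function.comp_apply, Fin.val_cast, val_splitN_inr]
      exact (congrArg (· + x.val) (count_tensorObj f g _)).trans (add_assoc _ _ _)

theorem unit_pairCol {f : FrCC.{u}} (x : Col (𝟙_ FrCC.{u})) (a : Col f) (hc hc') :
    ((a.1 ∘ Fin.cast hc, a.2 ∘ Fin.cast hc') : Col (𝟙_ _ ⊗ f)) = pairCol x a := by
  refine col_ext (Subsingleton.elim _ _) ?_
  rw [snd_pairCol]
  refine Prod.ext (funext fun x => congrArg a.1 (Fin.ext ?_))
        (funext fun x => congrArg a.2 (Fin.ext ?_))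
  · exact (val_splitP_inr (f := unit) x).trans (Nat.zero_add _)
  · exact (val_splitN_inr (f := unit) x).trans (Nat.zero_add _)

theorem wt_associator_inv {f g h k : FrCC.{u}} (σ : (f ⊗ g) ⊗ h ⟶ k) (a b c d) :
    Hom.wt ((α_ f g h).inv ≫ σ) (pairCol a (pairCol b c)) d =
      Hom.wt σ (pairCol (pairCol a b) c) d := by
  refine (Hom.wt_eqToHom_comp (tensorObj_assoc f g h).symm σ _ _).trans ?_
  exact congrArg (Hom.wt σ · d) (pairCol_assoc a b c _ _)

theorem wt_associator_hom {f g h k : FrCC.{u}} (σ : k ⟶ (f ⊗ g) ⊗ h) (a b c d) :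
    Hom.wt (σ ≫ (α_ f g h).hom) d (pairCol a (pairCol b c)) =
      Hom.wt σ d (pairCol (pairCol a b) c) := by
  refine (Hom.wt_comp_eqToHom σ (tensorObj_assoc f g h) _ _).trans ?_
  exact congrArg (Hom.wt σ d ·) (pairCol_assoc a b c _ _)

theorem wt_leftUnitor_inv {f k : FrCC.{u}} (σ : 𝟙_ _ ⊗ f ⟶ k) (x a d) :
    Hom.wt ((λ_ f).inv ≫ σ) a d = Hom.wt σ (pairCol x a) d := by
  refine (Hom.wt_eqToHom_comp (unit_tensorObj f).symm σ _ _).trans ?_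
  exact congrArg (Hom.wt σ · d) (unit_pairCol x a _ _)

theorem wt_leftUnitor_hom {f k : FrCC.{u}} (σ : k ⟶ 𝟙_ _ ⊗ f) (x a d) :
    Hom.wt (σ ≫ (λ_ f).hom) d a = Hom.wt σ d (pairCol x a) := by
  refine (Hom.wt_comp_eqToHom σ (unit_tensorObj f) _ _).trans ?_
  exact congrArg (Hom.wt σ d ·) (unit_pairCol x a _ _)

theorem wt_braiding {f g : FrCC.{u}} (a b c d) :
    Hom.wt (β_ f g).hom (pairCol a b) (pairCol c d) = if a = d ∧ b = c then 1 else 0 := by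
  refine (Hom.wt_rel _ _ _ _).trans (if_congr ?_ rfl rfl)
  rw [← pairCol_inj]
  refine Eq.congr rfl (col_ext ?_ ?_)
  · rw [fst_pairCol]
    conv_rhs => rw [← snd_pairCol c d]
    refine Prod.ext (funext fun x => ?_) (funext fun x => ?_) <;> simp [Col.fst, Col.snd]
  · rw [snd_pairCol]
    conv_rhs => rw [← fst_pairCol c d]
    refine Prod.ext (funext fun x => ?_) (funext fun x => ?_) <;> simp [Col.fst, Col.snd]

theorem wt_sw (A B X : FrCC.{u}) (a b x b' a' x') :
    Hom.wt (sw A B X) (pairCol a (pairCol b x)) (pairCol b' (pairCol a' x')) =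
      if a = a' ∧ b = b' ∧ x = x' then 1 else 0 := by
  rw [sw, wt_associator_inv, wt_associator_hom, ← tensorHom_id, wt_tensorHom, wt_braiding, wt_id']
  split_ifs <;> simp_all

theorem ind_eq {p q : Prop} [Decidable q] (h : p ↔ q) : ind p = if q then 1 else 0 := by
  by_cases hq : q <;> simp [ind, h, hq]

theorem wt_arcUp {a b : PointSign} (h : a ≠ b) (u x y) :
    Hom.wt (arcUp.{u} h) u (pairCol (single a x) (single b y)) = if x = y then 1 else 0 := by
  refine (one_mul _).trans (ind_eq ?_)
  cases a <;> cases b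
  · exact (h rfl).elim
  · refine ⟨fun e => (e (Sum.inr ⟨0, Nat.one_pos⟩)).symm, ?_⟩
    rintro e (i | ⟨_ | i, hi⟩)
    · exact i.elim0
    · exact e.symm
    · exact absurd (Nat.lt_one_iff.1 hi) (Nat.succ_ne_zero i)
  · refine ⟨fun e => e (Sum.inr ⟨0, Nat.one_pos⟩), ?_⟩
    rintro e (i | ⟨_ | i, hi⟩)
    · exact i.elim0
    · exact e
    · exact absurd (Nat.lt_one_iff.1 hi) (Nat.succ_ne_zero i)
  · exact (h rfl).elim

theorem wt_arcDown {a b : PointSign} (h : a ≠ b) (u x y) :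
    Hom.wt (arcDown.{u} h) (pairCol (single a x) (single b y)) u = if x = y then 1 else 0 := by
  refine (one_mul _).trans (ind_eq ?_)
  cases a <;> cases b
  · exact (h rfl).elim
  · refine ⟨fun e => e (Sum.inl ⟨0, Nat.one_pos⟩), ?_⟩
    rintro e (⟨_ | i, hi⟩ | i)
    · exact e
    · exact absurd (Nat.lt_one_iff.1 hi) (Nat.succ_ne_zero i)
    · exact i.elim0
  · refine ⟨fun e => (e (Sum.inl ⟨0, Nat.one_pos⟩)).symm, ?_⟩
    rintro e (⟨_ | i, hi⟩ | i)
    · exact e.symm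
    · exact absurd (Nat.lt_one_iff.1 hi) (Nat.succ_ne_zero i)
    · exact i.elim0
  · exact (h rfl).elim

theorem wt_cupW {a b : PointSign} (h : a ≠ b) (X : FrCC.{u}) (c x y d) :
    Hom.wt (cupW (arcUp h) X) c (pairCol (single a x) (pairCol (single b y) d)) =
      if x = y ∧ c = d then 1 else 0 := by
  rw [cupW, wt_leftUnitor_inv _ default, wt_associator_hom, ← tensorHom_id, wt_tensorHom, wt_arcUp,
    wt_id']
  split_ifs <;> simp_all

theorem wt_capW {a b : PointSign} (h : a ≠ b) (X : FrCC.{u}) (c x y d) :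
    Hom.wt (capW (arcDown h) X) (pairCol (single a x) (pairCol (single b y) d)) c =
      if x = y ∧ d = c then 1 else 0 := by
  rw [capW, wt_associator_inv, wt_leftUnitor_hom _ default, ← tensorHom_id, wt_tensorHom,
    wt_arcDown, wt_id']
  split_ifs <;> simp_all

end FrCC
end PermCC

/-! ### Places of letters and colourings by sequences -/

namespace PermCC

section
variable {C : Type u} [Category.{u} C] [MonoidalCategory C] [SymmetricCategory C] {S : Type}

/-- Extraction of an inserted letter. -/
def Ins.revEval (v : S → C) {s : S} : {u w : List S} → Ins s u w → (wordObj v w ⟶ v s ⊗ wordObj v u)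
  | _, _, .here _ => 𝟙 _
  | _, _, .there (u := u) a i => v a ◁ i.revEval v ≫ sw (v a) (v s) (wordObj v u)

/-- The position of an inserted letter. -/
def Ins.pos {s : S} : {u w : List S} → Ins s u w → ℕ
  | _, _, .here _ => 0
  | _, _, .there _ i => i.pos + 1

/-- The target word and the place determine the source word, so the insertions are compared over an
equality of words. -/
theorem Ins.eq_of_pos_eq {s : S} {u u' w : List S} (i : Ins s u w) (j : Ins s u' w)
    (h : i.pos = j.pos) : ∃ e : u = u', e ▸ i = j := by
  induction i generalizing u' with
  | here =>
    cases j with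
    | here => exact ⟨rfl, rfl⟩
    | there => exact absurd h (Nat.succ_ne_zero _).symm
  | there a i ih =>
    cases j with
    | here => exact absurd h (Nat.succ_ne_zero _)
    | there _ j =>
      obtain ⟨rfl, rfl⟩ := ih j (Nat.succ_injective h)
      exact ⟨rfl, rfl⟩

theorem Ins.exists_pos {s : S} {w : List S} {k : ℕ} (h : w[k]? = some s) :
    ∃ (u : List S) (i : Ins s u w), i.pos = k := by
  induction w generalizing k with
  | nil => simp at h
  | cons a w ih =>
    cases k with
    | zero =>
      obtain rfl : a = s := by simpa using h
      exact ⟨_, .here _, rfl⟩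
    | succ k =>
      obtain ⟨u, i, rfl⟩ := ih (by simpa using h)
      exact ⟨_, .there a i, rfl⟩

/-- The values of `l` except the one at `k`. -/
def skipAt {α : Type} (k : ℕ) (l : ℕ → α) (n : ℕ) : α := if n < k then l n else l (n + 1)

/-- Insertion of the value `x` at `k`. -/
def insertAt {α : Type} (k : ℕ) (x : α) (l : ℕ → α) (n : ℕ) : α :=
  if n < k then l n else if n = k then x else l (n - 1)

theorem insertAt_self {α : Type} (k : ℕ) (x : α) (l : ℕ → α) : insertAt k x l k = x := by
  simp [insertAt]

theorem skipAt_insertAt {α : Type} (k : ℕ) (x : α) (l : ℕ → α) :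
    skipAt k (insertAt k x l) = l := by
  funext n
  simp only [skipAt, insertAt]
  split_ifs <;> first | rfl | omega

theorem insertAt_skipAt_of_ne {α : Type} {k n : ℕ} (x : α) (l : ℕ → α) (h : n ≠ k) :
    insertAt k x (skipAt k l) n = l n := by
  simp only [skipAt, insertAt]
  split_ifs <;> first | rfl | omega | exact congrArg l (by omega)

/-- A value put in front. -/
def consFun {α : Type} (x : α) (l : ℕ → α) : ℕ → α
  | 0 => x
  | n + 1 => l n

end

namespace FrCC

theorem sum_pairCol {f g : FrCC.{u}} (F : Col (f ⊗ g) → ℕ) :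
    ∑ c, F c = ∑ a, ∑ b, F (pairCol a b) := by
  rw [← Fintype.sum_prod_type' (f := fun a b => F (pairCol a b))]
  exact (Equiv.sum_comp (colEquiv f g).symm F).symm

theorem sum_single {a : PointSign} (F : Col (pt.{u} a) → ℕ) :
    ∑ c, F c = ∑ x, F (single a x) :=
  (Function.Bijective.sum_comp ⟨single_injective a, fun c =>
    (exists_single c).imp fun _ => Eq.symm⟩ F).symm

/-- `b` is the only colouring of the source that is compatible with `c`. -/
def IsRel {f g : FrCC.{u}} (τ : f ⟶ g) (b : Col f) (c : Col g) : Prop :=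
  ∀ a, Hom.wt τ a c = if a = b then 1 else 0

namespace IsRel

variable {f g h : FrCC.{u}}

/-- The sum over the intermediate colourings has one possibly nonzero term, so composition with `τ`
is a substitution. -/
theorem wt_comp {τ : f ⟶ g} {b c} (H : IsRel τ b c) (σ : h ⟶ f) (a) :
    Hom.wt (σ ≫ τ) a c = Hom.wt σ a b := by
  rw [wt_comp']
  simp [H _]

theorem congr {τ : f ⟶ g} {b b' c c'} (H : IsRel τ b c) (hb : b = b') (hc : c = c') :
    IsRel τ b' c' := by rwa [← hb, ← hc]

theorem id (a : Col f) : IsRel (𝟙 f) a a := fun b => wt_id' b a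

theorem comp {σ : h ⟶ f} {τ : f ⟶ g} {a b c} (H : IsRel σ a b) (H' : IsRel τ b c) :
    IsRel (σ ≫ τ) a c := fun x => (H'.wt_comp σ x).trans (H x)

theorem whiskerLeft {τ : f ⟶ g} {b c} (H : IsRel τ b c) (x : Col h) :
    IsRel (h ◁ τ) (pairCol x b) (pairCol x c) := by
  intro a
  obtain ⟨y, a, rfl⟩ := exists_pairCol a
  rw [← id_tensorHom, wt_tensorHom, wt_id', H]
  refine Eq.trans ?_ (if_congr pairCol_inj rfl rfl).symm
  split_ifs <;> simp_all

theorem sw {A B X : FrCC.{u}} (a b x) :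
    IsRel (sw A B X) (pairCol a (pairCol b x)) (pairCol b (pairCol a x)) := by
  intro c
  obtain ⟨a', c, rfl⟩ := exists_pairCol c
  obtain ⟨b', c, rfl⟩ := exists_pairCol c
  rw [wt_sw]
  exact (if_congr (pairCol_inj.trans (and_congr Iff.rfl pairCol_inj)) rfl rfl).symm

theorem braiding (a : Col f) (b : Col g) : IsRel (β_ f g).hom (pairCol a b) (pairCol b a) := by
  intro c
  obtain ⟨a', b', rfl⟩ := exists_pairCol c
  rw [wt_braiding]
  exact (if_congr pairCol_inj rfl rfl).symm

theorem cupW {a b : PointSign} (H : a ≠ b) (x) (d : Col f) :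
    IsRel (cupW (arcUp H) f) d (pairCol (single a x) (pairCol (single b x) d)) := by
  intro c
  rw [wt_cupW]
  simp

end IsRel

theorem wt_comp_cupW {a b : PointSign} (H : a ≠ b) {f g : FrCC.{u}} (σ : f ⟶ g) (c x y d) :
    Hom.wt (σ ≫ cupW (arcUp H) g) c (pairCol (single a x) (pairCol (single b y) d)) =
      if x = y then Hom.wt σ c d else 0 := by
  by_cases h : x = y
  · subst h
    simp [(IsRel.cupW H x d).wt_comp]
  · rw [wt_comp']
    simp [wt_cupW, h]

theorem wt_comp_capW {a b : PointSign} (H : a ≠ b) {f X : FrCC.{u}} (σ : f ⟶ pt a ⊗ pt b ⊗ X)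
    (c d) : Hom.wt (σ ≫ capW (arcDown H) X) c d =
      ∑ x, Hom.wt σ c (pairCol (single a x) (pairCol (single b x) d)) := by
  rw [wt_comp', sum_pairCol, sum_single]
  refine Finset.sum_congr rfl fun x _ => ?_
  rw [sum_pairCol, sum_single]
  simp [wt_capW, ite_and]

theorem wt_braiding_comp {f g h : FrCC.{u}} (σ : g ⊗ f ⟶ h) (a b c) :
    Hom.wt ((β_ f g).hom ≫ σ) (pairCol a b) c = Hom.wt σ (pairCol b a) c := by
  rw [wt_comp', sum_pairCol]
  simp only [wt_braiding, ite_and, ite_mul, one_mul, zero_mul]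
  simp

/-- Each identity is checked entry by entry on colouring matrices, so that no gluing of arcs has to
be followed. -/
theorem interp_isDual : interp.{u}.IsDual where
  cup_braiding {a b} h := by
    refine Hom.wt_ext fun x c => ?_
    obtain ⟨p, q, rfl⟩ := exists_pairCol c
    obtain ⟨y, rfl⟩ := exists_single p
    obtain ⟨z, rfl⟩ := exists_single q
    refine ((IsRel.braiding _ _).wt_comp _ _).trans ?_
    refine (wt_arcUp h _ _ _).trans (Eq.trans ?_ (wt_arcUp h.symm _ _ _).symm)
    simp [eq_comm]
  braiding_cap {a b} h := by
    refine Hom.wt_ext fun c x => ?_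
    obtain ⟨p, q, rfl⟩ := exists_pairCol c
    obtain ⟨y, rfl⟩ := exists_single p
    obtain ⟨z, rfl⟩ := exists_single q
    refine (wt_braiding_comp _ _ _ _).trans ((wt_arcDown h _ _ _).trans
      (Eq.trans ?_ (wt_arcDown h.symm _ _ _).symm))
    simp [eq_comm]
  zigzag {a b} h X := by
    refine Hom.wt_ext fun c d => ?_
    obtain ⟨p, c, rfl⟩ := exists_pairCol c
    obtain ⟨y, rfl⟩ := exists_single p
    obtain ⟨q, d, rfl⟩ := exists_pairCol d
    obtain ⟨z, rfl⟩ := exists_single q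
    refine (wt_comp_capW h _ _ _).trans ?_
    refine Eq.trans ?_ (wt_id' _ _).symm
    refine Eq.trans (Finset.sum_congr rfl fun x _ => ?_) (b := ∑ x : Bool, (if y = x then 1 else 0) *
      (if x = z ∧ c = d then 1 else 0)) ?_
    · refine (congrArg (fun m => Hom.wt m _ _) (id_tensorHom _ _).symm).trans ?_
      refine (wt_tensorHom _ _ _ _ _ _).trans (congrArg₂ (· * ·) ?_ (wt_cupW h.symm _ _ _ _ _))
      exact (wt_id' (single a y) (single a x)).trans (if_congr (single_injective a).eq_iff rfl rfl)
    · have : pairCol (single a y) c = pairCol (single a z) d ↔ y = z ∧ c = d :=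
        pairCol_inj.trans (and_congr (single_injective a).eq_iff Iff.rfl)
      refine Eq.trans ?_ (if_congr this rfl rfl).symm
      by_cases hc : c = d <;> cases y <;> cases z <;> simp [hc]

/-- The colouring of a word by a sequence of colours. -/
def colour : (w : List PointSign) → (ℕ → Bool) → Col (wordObj pt.{u} w)
  | [], _ => (fun _ => false, fun _ => false)
  | a :: w, l => pairCol (single a (l 0)) (colour w fun n => l (n + 1))

/-- Colours are taken from an infinite sequence of which only an initial segment matters; this keeps
the shift of places under insertion free of dependent indices. -/
theorem exists_colour (w : List PointSign) (c : Col (wordObj pt.{u} w)) :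
    ∃ l, c = colour w l := by
  induction w with
  | nil => exact ⟨fun _ => false, Subsingleton.elim (α := Col (𝟙_ FrCC.{u})) _ _⟩
  | cons a w ih =>
    obtain ⟨x, d, rfl⟩ := exists_pairCol (f := pt a) (g := wordObj pt w) c
    obtain ⟨x, rfl⟩ := exists_single x
    obtain ⟨l, rfl⟩ := ih d
    exact ⟨consFun x l, rfl⟩

/-- An insertion only moves points, so the colouring of the target dictates that of the source, with
the colour at the place of insertion in front. -/
theorem isRel_ins {t : PointSign} {w w' : List PointSign} (i : Ins t w w') (l : ℕ → Bool) :
    IsRel (i.eval pt.{u}) (pairCol (single t (l i.pos)) (colour w (skipAt i.pos l)))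
      (colour w' l) := by
  induction i generalizing l with
  | here => exact IsRel.id _
  | there a i ih =>
    have h := (IsRel.sw _ _ _).comp ((ih fun n => l (n + 1)).whiskerLeft (single a (l 0)))
    refine h.congr (congrArg (pairCol _) (congrArg (pairCol _) (congrArg _ (funext fun n => ?_)))) rfl
    simp [skipAt, Ins.pos]

theorem isRel_ins_rev {t : PointSign} {w w' : List PointSign} (i : Ins t w w') (x : Bool)
    (l : ℕ → Bool) :
    IsRel (i.revEval pt.{u}) (colour w' (insertAt i.pos x l)) (pairCol (single t x) (colour w l)) := by
  induction i generalizing l with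
  | here => exact IsRel.id _
  | there a i ih =>
    have h := ((ih fun n => l (n + 1)).whiskerLeft (single a (l 0))).comp (IsRel.sw _ _ _)
    refine h.congr (congrArg₂ pairCol ?_ (congrArg _ (funext fun n => ?_))) rfl
    · simp [insertAt, Ins.pos]
    · obtain h | rfl | h := lt_trichotomy n i.pos
      · simp [insertAt, Ins.pos, h]
      · simp [insertAt, Ins.pos]
      · simp [insertAt, Ins.pos, h.not_gt, h.ne', Nat.sub_add_cancel (Nat.one_le_of_lt h)]

end FrCC
end PermCC

/-! ### Coherence for the free compact closed category -/

namespace PermCC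
namespace FrCC

/-- The number of colourings of a state that restrict to a given colouring of its ends. -/
noncomputable def weight {w : List PointSign} (σ : 𝟙_ FrCC.{u} ⟶ wordObj pt w) (l : ℕ → Bool) : ℕ :=
  Hom.wt σ default (colour w l)

theorem weight_ext {w : List PointSign} {σ τ : 𝟙_ FrCC.{u} ⟶ wordObj pt w}
    (h : ∀ l, weight σ l = weight τ l) : σ = τ := by
  refine Hom.wt_ext fun a b => ?_
  obtain ⟨l, rfl⟩ := exists_colour w b
  obtain rfl : a = default := Subsingleton.elim _ _
  exact h l

/-- The state given by a normal form. -/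
def stateOf {w : List PointSign} (N : StateNF w) : 𝟙_ FrCC.{u} ⟶ wordObj pt w := N.eval interp

theorem weight_eval_nil (l : ℕ → Bool) : weight (stateOf.{u} .nil) l = 1 :=
  (wt_id' (f := 𝟙_ FrCC.{u}) _ _).trans (if_pos (Subsingleton.elim _ _))

/-- By `isRel_ins` the insertion relabels the colouring; the cup then requires its two ends to have
one colour. -/
theorem weight_cup {w w' : List PointSign} {s t : PointSign} (h : s ≠ t)
    (σ : 𝟙_ FrCC.{u} ⟶ wordObj pt w) (i : Ins t w w') (l : ℕ → Bool) :
    weight (w := s :: w') (σ ≫ cupW (arcUp h) (wordObj pt w) ≫ pt s ◁ i.eval pt) l =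
      if l 0 = l (i.pos + 1) then weight σ (skipAt i.pos fun n => l (n + 1)) else 0 := by
  refine (congrArg (fun m => Hom.wt m _ _) (Category.assoc _ _ _).symm).trans ?_
  refine (((isRel_ins i _).whiskerLeft (single s (l 0))).wt_comp _ _).trans ?_
  exact wt_comp_cupW _ _ _ _ _ _

theorem weight_eval_cons {w w' : List PointSign} {s t : PointSign} (h : s ≠ t) (N : StateNF w)
    (i : Ins t w w') (l : ℕ → Bool) :
    weight (stateOf.{u} (.cons h N i)) l =
      if l 0 = l (i.pos + 1) then weight (stateOf.{u} N) (skipAt i.pos fun n => l (n + 1)) else 0 :=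
  (congrArg (fun m => Hom.wt m _ _) (StateNF.eval_cons interp.{u} h N i)).trans
    (weight_cup h (stateOf N) i l)

/-- The factor counts the two colours of the circle. -/
theorem weight_eval_circle (N : StateNF []) (l : ℕ → Bool) :
    weight (stateOf.{u} N.circle) l = 2 * weight (stateOf.{u} N) l := by
  refine (congrArg (fun m => Hom.wt m _ _) ((StateNF.eval_circle interp N).trans
    (Category.assoc _ _ _).symm)).trans ?_
  refine (wt_comp_capW neg_ne_pos _ _ _).trans ?_
  refine (Finset.sum_congr rfl fun x _ => (wt_comp_cupW neg_ne_pos _ _ _ _ _).trans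
    (if_pos rfl)).trans ?_
  exact (Finset.sum_const (s := (Finset.univ : Finset Bool)) _)

/-- A constant colouring satisfies the condition of every arc. -/
theorem weight_eval_const {w : List PointSign} (N : StateNF w) (x : Bool) :
    weight (stateOf.{u} N) (fun _ => x) ≠ 0 := by
  induction N with
  | nil => rw [weight_eval_nil]; exact one_ne_zero
  | circle N ih => rw [weight_eval_circle]; exact mul_ne_zero two_ne_zero ih
  | cons h N i ih =>
    rw [weight_eval_cons, if_pos rfl]
    have : (skipAt i.pos fun _ => x) = fun _ => x := funext fun n => by simp [skipAt]
    rwa [this]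

theorem eq_of_ne {s t t' : PointSign} (h : s ≠ t) (h' : s ≠ t') : t = t' := by
  cases s <;> cases t <;> cases t' <;> first | rfl | contradiction

theorem pos_eq_of_weight {w w₁ w₂ : List PointSign} {s t : PointSign} {h : s ≠ t} {h' : s ≠ t}
    {N₁ : StateNF w₁} {N₂ : StateNF w₂} {i : Ins t w₁ w} {j : Ins t w₂ w}
    (H : stateOf.{u} (.cons h N₁ i) = stateOf (.cons h' N₂ j)) :
    i.pos = j.pos := by
  by_contra hne
  -- Only the first point and its partner in the first state are coloured `true`. The first weight
  -- is then nonzero, while the second vanishes because the place of `j` is coloured `false`.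
  have := congrArg (fun σ => weight σ (consFun true (insertAt i.pos true fun _ => false))) H
  have hj : insertAt i.pos true (fun _ => false) j.pos = false := by
    simp [insertAt, Ne.symm hne]
  simp only [weight_eval_cons, consFun, insertAt_self, skipAt_insertAt, if_true, hj] at this
  exact weight_eval_const N₁ false this

/-- A normal form is determined by the morphism it represents. -/
theorem eval_injective {w : List PointSign} {N N' : StateNF w}
    (H : stateOf.{u} N = stateOf N') : N = N' := by
  induction N with
  | nil =>
    cases N' with
    | nil => rfl
    | circle N' =>
      -- The empty state has weight one, whereas a circle makes the weight even.
      have := congrArg (fun σ => weight σ fun _ => true) H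
      simp only [weight_eval_nil, weight_eval_circle] at this
      omega
  | circle N ih =>
    cases N' with
    | nil =>
      have := congrArg (fun σ => weight σ fun _ => true) H
      simp only [weight_eval_nil, weight_eval_circle] at this
      omega
    | circle N' =>
      refine congrArg _ (ih (weight_ext fun l => ?_))
      have := congrArg (fun σ => weight σ l) H
      simp only [weight_eval_circle] at this
      omega
  | cons h N i ih =>
    cases N' with
    | cons h' N' j =>
      obtain rfl := eq_of_ne h h'
      obtain ⟨rfl, rfl⟩ := i.eq_of_pos_eq j (pos_eq_of_weight H)
      refine congrArg (fun N => StateNF.cons h N _) (ih (weight_ext fun l => ?_))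
      -- The first point and its partner have one colour, so what remains compares the inner states
      -- at `l`.
      have := congrArg (fun σ => weight σ (consFun true (insertAt i.pos true l))) H
      simpa only [weight_eval_cons, consFun, insertAt_self, skipAt_insertAt, if_true] using this

/-- Passes from the numbering by sign to places in the word; the place is characterised by the
colour found there for every sequence. -/
theorem exists_loc_pos (w : List PointSign) (x : (wordObj pt.{u} w).P) :
    ∃ k, w[k]? = some .pos ∧ ∀ l, (colour w l).1 x = l k := by
  induction w with
  | nil => exact x.elim0
  | cons a w ih =>
    obtain ⟨y, rfl⟩ := (splitP (pt a) (wordObj pt w)).symm.surjective x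
    rcases y with y | y
    · cases a
      · exact ⟨0, rfl, fun l => congrFun (congrArg Prod.fst (fst_pairCol
          (single .pos (l 0)) (colour w fun n => l (n + 1)))) y⟩
      · exact y.elim0
    · obtain ⟨k, hk, h⟩ := ih y
      exact ⟨k + 1, hk, fun l => (congrFun (congrArg Prod.fst (snd_pairCol
          (single a (l 0)) (colour w fun n => l (n + 1)))) y).trans (h _)⟩

theorem exists_loc_neg (w : List PointSign) (x : (wordObj pt.{u} w).N) :
    ∃ k, w[k]? = some .neg ∧ ∀ l, (colour w l).2 x = l k := by
  induction w with
  | nil => exact x.elim0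
  | cons a w ih =>
    obtain ⟨y, rfl⟩ := (splitN (pt a) (wordObj pt w)).symm.surjective x
    rcases y with y | y
    · cases a
      · exact y.elim0
      · exact ⟨0, rfl, fun l => congrFun (congrArg Prod.snd (fst_pairCol
          (single .neg (l 0)) (colour w fun n => l (n + 1)))) y⟩
    · obtain ⟨k, hk, h⟩ := ih y
      exact ⟨k + 1, hk, fun l => (congrFun (congrArg Prod.snd (snd_pairCol
          (single a (l 0)) (colour w fun n => l (n + 1)))) y).trans (h _)⟩

theorem exists_head_pos (w : List PointSign) : ∃ x : (wordObj pt.{u} (.pos :: w)).P,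
    ∀ l, (colour (.pos :: w) l).1 x = l 0 :=
  ⟨(splitP (pt.{u} .pos) (wordObj pt w)).symm (.inl ⟨0, Nat.one_pos⟩), fun l => congrFun (congrArg
    Prod.fst (fst_pairCol (single.{u} .pos (l 0)) (colour w fun n => l (n + 1)))) ⟨0, Nat.one_pos⟩⟩

theorem exists_head_neg (w : List PointSign) : ∃ x : (wordObj pt.{u} (.neg :: w)).N,
    ∀ l, (colour (.neg :: w) l).2 x = l 0 :=
  ⟨(splitN (pt.{u} .neg) (wordObj pt w)).symm (.inl ⟨0, Nat.one_pos⟩), fun l => congrFun (congrArg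
    Prod.snd (fst_pairCol (single.{u} .neg (l 0)) (colour w fun n => l (n + 1)))) ⟨0, Nat.one_pos⟩⟩

/-- The condition that a colouring extends over the arcs of a state. -/
def Compat {w : List PointSign} (σ : Hom (𝟙_ FrCC.{u}) (wordObj pt w)) (l : ℕ → Bool) : Prop :=
  ∀ y x, σ.arcs (.inr y) = .inr x → (colour w l).2 y = (colour w l).1 x

theorem weight_eq {w : List PointSign} (σ : Hom (𝟙_ FrCC.{u}) (wordObj pt w)) (l : ℕ → Bool) :
    weight σ l = 2 ^ σ.circles * ind (Compat σ l) := by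
  refine congrArg (fun p => 2 ^ σ.circles * ind p) (propext ⟨fun h y x e => ?_, fun h z => ?_⟩)
  · have := h (.inr y)
    rw [e] at this
    exact this
  · rcases z with z | y
    · exact z.elim0
    · rcases e : σ.arcs (.inr y) with z | x
      · exact z.elim0
      · exact h y x e

/-- The two ends of one arc may be recoloured together, since every other arc has both its ends
elsewhere. -/
theorem Compat.of_agree {w : List PointSign} {σ : Hom (𝟙_ FrCC.{u}) (wordObj pt w)} {y x} {k m : ℕ}
    (e : σ.arcs (.inr y) = .inr x) (hk : w[k]? = some .neg) (hm : w[m]? = some .pos)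
    (hy : ∀ l, (colour w l).2 y = l k) (hx : ∀ l, (colour w l).1 x = l m) {l l' : ℕ → Bool}
    (h : ∀ n, n ≠ k → n ≠ m → l n = l' n) (hl' : l' k = l' m) (H : Compat σ l) : Compat σ l' := by
  classical
  intro y' x' e'
  by_cases hyy : y' = y
  · subst hyy
    obtain rfl : x = x' := Sum.inr_injective (e.symm.trans e')
    rw [hy, hx, hl']
  · have hxx : x' ≠ x := by
      rintro rfl
      exact hyy (Sum.inr_injective (σ.arcs.injective (e'.trans e.symm)))
    obtain ⟨k', hk', hy'⟩ := exists_loc_neg w y'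
    obtain ⟨m', hm', hx'⟩ := exists_loc_pos w x'
    have h1 := H y' x' e'
    rw [hy', hx'] at h1 ⊢
    have hkk : k' ≠ k := by
      rintro rfl
      -- Distinct negative points lie at distinct places, since this colouring separates `y'` from
      -- `y`.
      obtain ⟨l₀, hl⟩ := exists_colour w (fun _ => true, fun z => decide (z = y))
      have a1 := hy l₀
      have a2 := hy' l₀
      rw [← hl] at a1 a2
      rw [← a1] at a2
      simp [hyy] at a2
    have hmm : m' ≠ m := by
      rintro rfl
      obtain ⟨l₀, hl⟩ := exists_colour w (fun z => decide (z = x), fun _ => true)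
      have a1 := hx l₀
      have a2 := hx' l₀
      rw [← hl] at a1 a2
      rw [← a1] at a2
      simp [hxx] at a2
    rw [← h k' hkk, ← h m' _ hmm, h1]
    · rintro rfl
      rw [hm'] at hk
      simp at hk
    · rintro rfl
      rw [hk'] at hm
      simp at hm

/-- The properties of the partner of the first point of a state. -/
theorem exists_partner {w : List PointSign} {s : PointSign}
    (σ : Hom (𝟙_ FrCC.{u}) (wordObj pt (s :: w))) : ∃ (j : ℕ) (t : PointSign), s ≠ t ∧
      w[j]? = some t ∧ (∀ l, Compat σ l → l 0 = l (j + 1)) ∧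
      ∀ l l', (∀ n, n ≠ 0 → n ≠ j + 1 → l n = l' n) → l' 0 = l' (j + 1) →
        Compat σ l → Compat σ l' := by
  cases s
  · obtain ⟨x, hx⟩ := exists_head_pos.{u} w
    obtain ⟨y, hy⟩ := σ.arcs.surjective (.inr x)
    rcases y with y | y
    · exact y.elim0
    obtain ⟨k, hk, hk'⟩ := exists_loc_neg (.pos :: w) y
    cases k with
    -- The partner has the opposite sign, so it is not the first letter itself.
    | zero => simp at hk
    | succ j =>
      refine ⟨j, .neg, nofun, hk, fun l h => ?_, fun l l' h h' H => ?_⟩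
      · exact (hx l).symm.trans ((h y x hy).symm.trans (hk' l))
      · exact H.of_agree hy hk rfl hk' hx (fun n a b => h n b a) h'.symm
  · obtain ⟨y, hy⟩ := exists_head_neg.{u} w
    rcases e : σ.arcs (.inr y) with x | x
    · exact x.elim0
    obtain ⟨k, hk, hk'⟩ := exists_loc_pos (.neg :: w) x
    cases k with
    | zero => simp at hk
    | succ j =>
      refine ⟨j, .pos, nofun, hk, fun l h => ?_, fun l l' h h' H => ?_⟩
      · exact (hy l).symm.trans ((h y x e).trans (hk' l))
      · exact H.of_agree e rfl hk hy hk' h h'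

theorem compat_const {w : List PointSign} (σ : Hom (𝟙_ FrCC.{u}) (wordObj pt w)) (x : Bool) :
    Compat σ fun _ => x := by
  intro y z _
  obtain ⟨k, -, hk⟩ := exists_loc_neg w y
  obtain ⟨m, -, hm⟩ := exists_loc_pos w z
  rw [hk, hm]

/-- The extracted letter comes to stand next to the first one, and the cap sums over their common
colour. -/
theorem weight_comp_rev_cap {w w' : List PointSign} {s t : PointSign} (h : s ≠ t)
    (σ : 𝟙_ FrCC.{u} ⟶ wordObj pt (s :: w')) (i : Ins t w w') (l : ℕ → Bool) :
    weight ((σ ≫ pt s ◁ i.revEval pt) ≫ capW (arcDown h) (wordObj pt w)) l =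
      ∑ x, weight σ (consFun x (insertAt i.pos x l)) :=
  (wt_comp_capW h _ _ _).trans (Finset.sum_congr rfl fun x _ =>
    ((isRel_ins_rev i x l).whiskerLeft (single s x)).wt_comp _ _)

theorem _root_.PermCC.Ins.length_eq {S : Type} {s : S} {w w' : List S} (i : Ins s w w') :
    w'.length = w.length + 1 := by
  induction i with
  | here => rfl
  | there a i ih => exact congrArg (· + 1) ih

/-- The first point of a state and its partner can be split off. -/
theorem exists_split {w : List PointSign} {s : PointSign}
    (σ : 𝟙_ FrCC.{u} ⟶ wordObj pt (s :: w)) : ∃ (t : PointSign) (h : s ≠ t) (w₀ : List PointSign)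
      (i : Ins t w₀ w) (τ : 𝟙_ FrCC.{u} ⟶ wordObj pt w₀),
      (σ : 𝟙_ FrCC.{u} ⟶ wordObj pt (s :: w)) =
        τ ≫ cupW (arcUp h) (wordObj pt w₀) ≫ pt s ◁ i.eval pt := by
  obtain ⟨j, t, h, hj, hl, hag⟩ := exists_partner σ
  obtain ⟨w₀, i, rfl⟩ := Ins.exists_pos hj
  -- The cap joins the first point to its partner, so their arc becomes a circle and the other arcs
  -- remain.
  let ρ : Hom (𝟙_ FrCC.{u}) (wordObj pt w₀) :=
    (σ ≫ pt s ◁ i.revEval pt) ≫ capW (arcDown h) (wordObj pt w₀)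
  -- The common colour of the two ends of the arc does not affect the weight.
  have hσ : ∀ l x x', weight σ (consFun x (insertAt i.pos x l)) =
      weight σ (consFun x' (insertAt i.pos x' l)) := by
    have key : ∀ l x x', Compat σ (consFun x (insertAt i.pos x l)) →
        Compat σ (consFun x' (insertAt i.pos x' l)) := by
      intro l x x'
      refine hag _ _ (fun n h0 h1 => ?_) (insertAt_self _ _ _).symm
      cases n with
      | zero => exact (h0 rfl).elim
      | succ n =>
        have : n ≠ i.pos := fun e => h1 (congrArg (· + 1) e)
        simp [consFun, insertAt, this]
    intro l x x'
    rw [weight_eq, weight_eq]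
    exact congrArg (fun p => _ * ind p) (propext ⟨key l x x', key l x' x⟩)
  have hρ : ∀ l x, weight ρ l = 2 * weight σ (consFun x (insertAt i.pos x l)) := by
    intro l x
    refine (weight_comp_rev_cap h σ i l).trans ?_
    exact (Finset.sum_congr rfl fun x' _ => hσ l x' x).trans (Finset.sum_const _)
  -- At a constant colouring the weight is two to the number of circles.
  have hc : ρ.circles = Hom.circles σ + 1 := by
    have := hρ (fun _ => true) true
    have e : consFun true (insertAt i.pos true fun _ => true) = fun _ => true := by
      funext n
      cases n with
      | zero => rfl
      | succ n => simp [consFun, insertAt]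
    rw [e, weight_eq, weight_eq] at this
    simp only [ind, compat_const, if_true, mul_one] at this
    rw [← pow_succ'] at this
    exact Nat.pow_right_injective le_rfl this
  -- The additional circle is dropped.
  let τ : Hom (𝟙_ FrCC.{u}) (wordObj pt w₀) := ⟨ρ.arcs, Hom.circles σ⟩
  have hτ : ∀ l x, weight τ l = weight σ (consFun x (insertAt i.pos x l)) := by
    intro l x
    have h1 := hρ l x
    rw [weight_eq, hc, pow_succ', mul_assoc] at h1
    rw [weight_eq]
    exact Nat.eq_of_mul_eq_mul_left two_pos h1
  refine ⟨t, h, w₀, i, τ, weight_ext fun l => ?_⟩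
  refine Eq.trans ?_ (weight_cup h τ i l).symm
  split_ifs with e
  · rw [hτ _ (l 0)]
    congr 1
    funext n
    cases n with
    | zero => rfl
    | succ n =>
      by_cases hn : n = i.pos
      · subst hn
        exact e.symm.trans (insertAt_self _ _ _).symm
      · exact (insertAt_skipAt_of_ne _ (fun n => l (n + 1)) hn).symm
  · rw [weight_eq]
    have : ¬ Compat σ l := fun H => e (hl l H)
    simp [ind, this]

/-- Every state is represented by a normal form. -/
theorem exists_stateOf_eq : ∀ (w : List PointSign) (σ : 𝟙_ FrCC.{u} ⟶ wordObj pt w),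
    ∃ N : StateNF w, stateOf N = σ
  | [], σ => by
    -- Over the empty word there are no arcs, and the number of circles is the only datum.
    have key : ∀ k : ℕ, ∃ N : StateNF [], ∀ l, weight (stateOf.{u} N) l = 2 ^ k := by
      intro k
      induction k with
      | zero => exact ⟨.nil, weight_eval_nil⟩
      | succ k ih =>
        obtain ⟨N, h⟩ := ih
        exact ⟨.circle N, fun l => by rw [weight_eval_circle, h, pow_succ']⟩
    obtain ⟨N, h⟩ := key (Hom.circles σ)
    refine ⟨N, weight_ext fun l => (h l).trans ?_⟩
    have : Compat σ l := fun y => y.elim0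
    rw [weight_eq]
    simp [ind, this]
  | s :: w, σ => by
    obtain ⟨t, h, w₀, i, τ, e⟩ := exists_split σ
    obtain ⟨N, rfl⟩ := exists_stateOf_eq w₀ τ
    exact ⟨.cons h N i, (StateNF.eval_cons interp.{u} h N i).trans e.symm⟩
termination_by w => w.length
decreasing_by simp [i.length_eq]

end FrCC

/-- The opposite sign. -/
def PointSign.flip : PointSign → PointSign
  | pos => neg
  | neg => pos

theorem PointSign.ne_flip (s : PointSign) : s ≠ s.flip := by cases s <;> exact nofun

/-- The first letter of the source is bent over to the target and back, which the zigzag identity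
undoes. This reduces arbitrary morphisms to states. -/
theorem unbend {C : Type u} [Category.{u} C] [MonoidalCategory C] [SymmetricCategory C]
    {M : Interp PointSign (· ≠ ·) C} (hM : M.IsDual) {s t : PointSign} (h : s ≠ t) {X Y : C}
    (σ : M.v s ⊗ X ⟶ Y) :
    M.v s ◁ (cupW (M.cup h.symm) X ≫ M.v t ◁ σ) ≫ capW (M.cap h) Y = σ := by
  rw [whiskerLeft_comp, Category.assoc, capW_natural, reassoc_of% hM.zigzag h X]

namespace FrCC

/-- The elementary morphisms generate. -/
theorem exists_path {u w : List PointSign} (σ : wordObj pt.{u} u ⟶ wordObj pt w) :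
    ∃ p : Path (· ≠ ·) u w, p.eval interp = σ := by
  induction u generalizing w with
  | nil =>
    obtain ⟨N, h⟩ := exists_stateOf_eq w σ
    exact ⟨N.toPath, h⟩
  | cons s u ih =>
    -- Bent over to the target, the letter `s` reappears with the opposite sign.
    obtain ⟨p, hp⟩ := ih (w := s.flip :: w)
      (cupW (arcUp s.ne_flip.symm) (wordObj pt u) ≫ pt s.flip ◁ σ)
    refine ⟨(p.cons s).snoc (.cap s.ne_flip w), ?_⟩
    refine (congrArg (· ≫ _) (Path.eval_cons interp s p)).trans ?_
    rw [hp]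
    exact unbend interp_isDual s.ne_flip σ

/-- Formal composites that agree in the free compact closed category agree in every
compact closed category. -/
theorem eval_eq_of_eval_interp_eq {C : Type u} [Category.{u} C] [MonoidalCategory C]
    [SymmetricCategory C] {M : Interp PointSign (· ≠ ·) C} (hM : M.IsDual) {u w : List PointSign}
    {p q : Path (· ≠ ·) u w} (h : p.eval interp.{u} = q.eval interp.{u}) : p.eval M = q.eval M := by
  induction u generalizing w with
  | nil =>
    obtain ⟨N, hN⟩ := StateNF.exists_eval_eq.{u} p
    obtain ⟨N', hN'⟩ := StateNF.exists_eval_eq.{u} q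
    -- In the free category the value determines the normal form, which in turn determines the value
    -- for `M`.
    have : N = N' := eval_injective (((hN _ interp.{u} interp_isDual).symm.trans h).trans
      (hN' _ interp.{u} interp_isDual))
    rw [hN C M hM, hN' C M hM, this]
  | cons s u ih =>
    -- The bending is itself a formal composite, so the induction hypothesis applies to the bent
    -- expressions.
    have e : ∀ (D : Type u) [Category.{u} D] [MonoidalCategory D] [SymmetricCategory D]
        (L : Interp PointSign (· ≠ ·) D) (r : Path (· ≠ ·) (s :: u) w),
        (((Path.nil u).snoc (.cup s.ne_flip.symm u)).append (r.cons s.flip)).eval L =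
          cupW (L.cup s.ne_flip.symm) (wordObj L.v u) ≫ L.v s.flip ◁ r.eval L := by
      intro D _ _ _ L r
      rw [Path.eval_append, Path.eval_cons]
      exact congrArg (· ≫ _) (Category.id_comp _)
    have h2 := ih (p := ((Path.nil u).snoc (.cup s.ne_flip.symm u)).append (p.cons s.flip))
      (q := ((Path.nil u).snoc (.cup s.ne_flip.symm u)).append (q.cons s.flip)) (by
        rw [e, e, h])
    rw [e, e] at h2
    have h3 := congrArg (fun m => M.v s ◁ m ≫ capW (M.cap s.ne_flip) (wordObj M.v w)) h2
    exact (unbend hM s.ne_flip (p.eval M)).symm.trans (h3.trans (unbend hM s.ne_flip (q.eval M)))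

end FrCC
end PermCC

/-! ### Coherence for the free permutative category -/

namespace PermCC

theorem Ins.revEval_eval {C : Type u} [Category.{u} C] [MonoidalCategory C] [SymmetricCategory C]
    {S : Type} (v : S → C) {s : S} {u w : List S} (i : Ins s u w) : i.revEval v ≫ i.eval v = 𝟙 _ := by
  induction i with
  | here => exact Category.id_comp _
  | there a i ih =>
    have key : ∀ {A B U W : C} (r : W ⟶ B ⊗ U) (e : B ⊗ U ⟶ W), r ≫ e = 𝟙 _ →
        (A ◁ r ≫ sw A B U) ≫ sw B A U ≫ A ◁ e = 𝟙 _ := by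
      intro A B U W r e h
      rw [Category.assoc, reassoc_of% sw_sw A B U, ← whiskerLeft_comp, h, whiskerLeft_id]
    exact key _ _ ih

namespace FreePerm

/-- The generator. -/
def gen : FreePerm.{u} := ⟨1⟩

/-- The tautological interpretation. -/
def interp : Interp Unit (fun _ _ => False) FreePerm.{u} where
  v _ := gen
  cup h := h.elim
  cap h := h.elim

/-- The first point of a tensor product with the generator. -/
def zeroPt (X : FreePerm.{u}) : Fin (gen ⊗ X).card :=
  ⟨0, Nat.lt_of_lt_of_le Nat.one_pos (Nat.le_add_right _ _)⟩

/-- The other points of a tensor product with the generator. -/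
def succPt (X : FreePerm.{u}) (x : Fin X.card) : Fin (gen ⊗ X).card :=
  ⟨1 + x.val, Nat.add_lt_add_left x.isLt 1⟩

theorem eq_zeroPt_or {X : FreePerm.{u}} (y : Fin (gen ⊗ X).card) :
    y = zeroPt X ∨ ∃ x, y = succPt X x := by
  have hy : y.val < 1 + X.card := y.isLt
  rcases Nat.eq_zero_or_pos y.val with h | h
  · exact Or.inl (Fin.ext h)
  · exact Or.inr ⟨⟨y.val - 1, by omega⟩, Fin.ext (by simp only [succPt]; omega)⟩

theorem whiskerLeft_zeroPt {X Y : FreePerm.{u}} (σ : X ⟶ Y) :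
    Hom.toEquiv (gen ◁ σ) (zeroPt X) = zeroPt Y :=
  Fin.ext ((tensor_val (𝟙 gen) σ (zeroPt X)).trans (dif_pos Nat.one_pos))

theorem whiskerLeft_succPt {X Y : FreePerm.{u}} (σ : X ⟶ Y) (x : Fin X.card) :
    Hom.toEquiv (gen ◁ σ) (succPt X x) = succPt Y (Hom.toEquiv σ x) := by
  refine Fin.ext ((tensor_val (𝟙 gen) σ (succPt X x)).trans ?_)
  refine (dif_neg (Nat.not_lt.2 (Nat.le_add_right 1 x.val))).trans ?_
  refine congrArg (fun z => 1 + (Hom.toEquiv σ z).val) (Fin.ext ?_)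
  exact Nat.add_sub_cancel_left 1 x.val

theorem sw_zeroPt (X : FreePerm.{u}) :
    Hom.toEquiv (sw gen gen X) (zeroPt (gen ⊗ X)) = succPt (gen ⊗ X) (zeroPt X) := by
  refine Fin.ext ?_
  refine (eqToHom_val (tensorObj_assoc gen gen X) _).trans ?_
  refine (tensor_val (braid gen gen).hom (𝟙 X) _).trans ?_
  have h0 : (Hom.toEquiv (α_ gen gen X).inv (zeroPt (gen ⊗ X))).val = 0 :=
    eqToHom_val (tensorObj_assoc gen gen X).symm _
  refine (dif_pos (lt_of_eq_of_lt h0 Nat.two_pos)).trans ?_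
  refine (braid_val gen gen _).trans ?_
  refine (if_pos (lt_of_eq_of_lt h0 Nat.one_pos)).trans ?_
  exact congrArg (1 + ·) h0

/-- Recovers the place of insertion from the bijection that represents it. -/
theorem ins_zeroPt {u w : List Unit} (i : Ins () u w) :
    (Hom.toEquiv (i.eval fun _ => gen.{u}) (zeroPt _)).val = i.pos := by
  induction i with
  | here => rfl
  | there a i ih =>
    refine (congrArg (fun z => (Hom.toEquiv (gen ◁ i.eval fun _ => gen.{u}) z).val)
      (sw_zeroPt _)).trans ?_
    refine (congrArg Fin.val (whiskerLeft_succPt _ _)).trans ?_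
    exact (congrArg (1 + ·) ih).trans (Nat.add_comm _ _)

theorem comp_right_cancel {X Y Z : FreePerm.{u}} {σ σ' : X ⟶ Y} {τ : Y ⟶ Z}
    (h : σ ≫ τ = σ' ≫ τ) : σ = σ' :=
  Hom.ext (Equiv.ext fun x => τ.toEquiv.injective
    (congrFun (congrArg (fun m => (Hom.toEquiv m : _ → _)) h) x))

theorem whiskerLeft_cancel {X Y : FreePerm.{u}} {σ τ : X ⟶ Y} (h : gen ◁ σ = gen ◁ τ) : σ = τ := by
  refine hom_ext fun x => ?_
  have h1 := congrArg (fun m => Hom.toEquiv m (succPt X x)) h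
  have h2 := congrArg Fin.val ((whiskerLeft_succPt σ x).symm.trans (h1.trans (whiskerLeft_succPt τ x)))
  exact Nat.add_left_cancel h2

/-- A bijection that matches the first points restricts to an injection of the remaining ones, which
is bijective by counting. -/
theorem exists_whiskerLeft_eq {X Y : FreePerm.{u}} (σ : gen ⊗ X ⟶ gen ⊗ Y)
    (h : Hom.toEquiv σ (zeroPt X) = zeroPt Y) : ∃ τ : X ⟶ Y, gen ◁ τ = σ := by
  have key : ∀ x : Fin X.card, ∃ y : Fin Y.card, Hom.toEquiv σ (succPt X x) = succPt Y y := by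
    intro x
    refine (eq_zeroPt_or _).resolve_left fun e => ?_
    have := σ.toEquiv.injective (e.trans h.symm)
    have := congrArg Fin.val this
    simp only [succPt, zeroPt] at this
    omega
  choose f hf using key
  have hinj : Function.Injective f := by
    intro x x' e
    have := σ.toEquiv.injective ((hf x).trans ((congrArg (succPt Y) e).trans (hf x').symm))
    have := congrArg Fin.val this
    simp only [succPt] at this
    exact Fin.ext (by omega)
  have hcard : 1 + X.card = 1 + Y.card := by
    simpa using Fintype.card_congr (Hom.toEquiv σ : Fin (1 + X.card) ≃ Fin (1 + Y.card))
  have hbij : Function.Bijective f := (Fintype.bijective_iff_injective_and_card f).2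
    ⟨hinj, by simpa using hcard⟩
  refine ⟨Hom.mk (Equiv.ofBijective f hbij), Hom.ext (Equiv.ext fun y => ?_)⟩
  obtain rfl | ⟨x, rfl⟩ := eq_zeroPt_or y
  · exact (whiskerLeft_zeroPt _).trans h.symm
  · exact (whiskerLeft_succPt _ _).trans (hf x).symm

theorem eval_zeroPt {u w w' : List Unit} (N : PermNF u w) (i : Ins () w w') :
    (Hom.toEquiv ((PermNF.cons N i).eval fun _ => gen.{u}) (zeroPt _)).val = i.pos :=
  (congrArg (fun z => (Hom.toEquiv (i.eval fun _ => gen.{u}) z).val)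
    (whiskerLeft_zeroPt _)).trans (ins_zeroPt i)

/-- The image of the first point is the place of the outermost insertion; once this insertion is
cancelled, the inner normal forms can be compared. -/
theorem eval_injective {u w : List Unit} {N N' : PermNF u w}
    (h : N.eval (fun _ => gen.{u}) = N'.eval fun _ => gen) : N = N' := by
  induction N with
  | nil => cases N'; rfl
  | cons N i ih =>
    cases N' with
    | cons N' j =>
      obtain ⟨rfl, rfl⟩ := i.eq_of_pos_eq j ((eval_zeroPt N i).symm.trans
        ((congrArg (fun m => (Hom.toEquiv m (zeroPt _)).val) h).trans (eval_zeroPt N' j)))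
      exact congrArg (PermNF.cons · i) (ih (whiskerLeft_cancel (comp_right_cancel h)))

theorem card_wordObj (w : List Unit) : (wordObj (fun _ => gen.{u}) w).card = w.length := by
  induction w with
  | nil => rfl
  | cons a w ih => exact (congrArg (1 + ·) ih).trans (Nat.add_comm _ _)

theorem exists_eval_eq {u w : List Unit}
    (σ : wordObj (fun _ => gen.{u}) u ⟶ wordObj (fun _ => gen.{u}) w) :
    ∃ N : PermNF u w, N.eval (fun _ => gen) = σ := by
  induction u generalizing w with
  | nil =>
    cases w with
    | nil => exact ⟨.nil, Hom.ext (Equiv.ext fun x => Fin.elim0 x)⟩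
    | cons a w => exact (Fin.elim0 (σ.toEquiv.symm (zeroPt _)))
  | cons a u ih =>
    have hj : w[(Hom.toEquiv σ (zeroPt _)).val]? = some a := by
      have := (Hom.toEquiv σ (zeroPt _)).isLt
      exact List.getElem?_eq_getElem (lt_of_lt_of_eq this (card_wordObj w))
    obtain ⟨w₀, i, hi⟩ := Ins.exists_pos hj
    have hr := i.revEval_eval fun _ => gen.{u}
    -- Extracting the letter hit by the first point turns `σ` into a bijection that matches the
    -- first points.
    obtain ⟨τ, hτ⟩ := exists_whiskerLeft_eq (σ ≫ i.revEval fun _ => gen.{u}) (by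
      refine (i.eval fun _ => gen.{u}).toEquiv.injective (Fin.ext ?_)
      refine Eq.trans ?_ (hi.symm.trans (ins_zeroPt i).symm)
      exact congrArg (fun m => (Hom.toEquiv m _).val) hr)
    obtain ⟨N, rfl⟩ := ih τ
    refine ⟨.cons N i, (congrArg (· ≫ _) hτ).trans ?_⟩
    exact (Category.assoc _ _ _).trans ((congrArg (σ ≫ ·) hr).trans (Category.comp_id _))

theorem exists_path {u w : List Unit}
    (σ : wordObj (fun _ => gen.{u}) u ⟶ wordObj (fun _ => gen.{u}) w) :
    ∃ p : Path (fun _ _ => False) u w, p.eval interp = σ := by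
  obtain ⟨N, h⟩ := exists_eval_eq σ
  exact ⟨N.toPath, (N.eval_toPath interp).trans h⟩

theorem eval_eq_of_eval_interp_eq {C : Type u} [Category.{u} C] [MonoidalCategory C]
    [SymmetricCategory C] (M : Interp Unit (fun _ _ => False) C) {u w : List Unit}
    {p q : Path (fun _ _ => False) u w} (h : p.eval interp.{u} = q.eval interp.{u}) :
    p.eval M = q.eval M := by
  obtain ⟨N, hN⟩ := PermNF.exists_eval_eq.{u} (fun _ _ => id) p
  obtain ⟨N', hN'⟩ := PermNF.exists_eval_eq.{u} (fun _ _ => id) q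
  have : N = N' := eval_injective.{u} (((hN _ interp.{u}).symm.trans h).trans (hN' _ interp.{u}))
  rw [hN C M, hN' C M, this]

end FreePerm
end PermCC

/-! ### Formal tensor products and symmetries -/

namespace PermCC

variable {S : Type} {Pair : S → S → Prop}

def Swap.append {u w : List S} : Swap u w → (x : List S) → Swap (u ++ x) (w ++ x)
  | .head a b w, x => .head a b (w ++ x)
  | .cons a y, x => .cons a (y.append x)

def Move.append {u w : List S} : Move Pair u w → (x : List S) → Move Pair (u ++ x) (w ++ x)
  | .swap y, x => .swap (y.append x)
  | .cup h w, x => .cup h (w ++ x)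
  | .cap h w, x => .cap h (w ++ x)

/-- Formal tensor product with a word on the right. -/
def Path.whiskerRight {u w : List S} : Path Pair u w → (x : List S) → Path Pair (u ++ x) (w ++ x)
  | .nil _, x => .nil _
  | .snoc p y, x => (p.whiskerRight x).snoc (y.append x)

/-- Formal tensor product with a word on the left. -/
def Path.whiskerLeft : (x : List S) → {u w : List S} → Path Pair u w → Path Pair (x ++ u) (x ++ w)
  | [], _, _, p => p
  | a :: x, _, _, p => (p.whiskerLeft x).cons a

/-- Formal tensor product. -/
def Path.tensor {u w u' w' : List S} (p : Path Pair u w) (q : Path Pair u' w') :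
    Path Pair (u ++ u') (w ++ w') :=
  (p.whiskerRight u').append (q.whiskerLeft w)

/-- Insertion of a letter after a given word. -/
def insAfter (a : S) : (w u : List S) → Ins a (w ++ u) (w ++ a :: u)
  | [], u => .here u
  | b :: w, u => .there b (insAfter a w u)

/-- The words `w ++ []` and `w` are not definitionally equal, so the passage between them is itself
a formal composite. -/
def Path.unitRight : (w : List S) → Path Pair w (w ++ [])
  | [] => .nil _
  | a :: w => (unitRight w).cons a

/-- Formal symmetry. -/
def Path.braiding : (u w : List S) → Path Pair (u ++ w) (w ++ u)
  | [], w => unitRight w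
  | a :: u, w => ((braiding u w).cons a).append (insAfter a w u).toPath

section Eval

variable {C : Type u} [Category.{u} C] [MonoidalCategory C]

/-- Concatenation of words gives tensor products. -/
def wordAppend (v : S → C) : (u w : List S) → wordObj v (u ++ w) ≅ wordObj v u ⊗ wordObj v w
  | [], w => (λ_ (wordObj v w)).symm
  | a :: u, w => whiskerLeftIso (v a) (wordAppend v u w) ≪≫ (α_ _ _ _).symm

/-- The object of a concatenated word is only isomorphic to the tensor product; `φ` stands for this
isomorphism and passes the cup by naturality. -/
theorem cupW_append {A B X W Z : C} (η : 𝟙_ C ⟶ A ⊗ B) (φ : Z ≅ X ⊗ W) :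
    cupW η Z = φ.hom ≫ cupW η X ▷ W ≫ (α_ A (B ⊗ X) W).hom ≫
      A ◁ ((α_ B X W).hom ≫ B ◁ φ.inv) := by
  have h : φ.hom ≫ cupW η (X ⊗ W) ≫ A ◁ B ◁ φ.inv = cupW η Z := by
    rw [reassoc_of% cupW_natural η φ.hom, ← whiskerLeft_comp, ← whiskerLeft_comp]
    simp
  rw [← h]
  simp [cupW]

theorem capW_append {A B X W Z : C} (ε : A ⊗ B ⟶ 𝟙_ C) (φ : Z ≅ X ⊗ W) :
    capW ε Z = (A ◁ (B ◁ φ.hom ≫ (α_ B X W).inv) ≫ (α_ A (B ⊗ X) W).inv) ≫ capW ε X ▷ W ≫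
      φ.inv := by
  have h : A ◁ B ◁ φ.hom ≫ capW ε (X ⊗ W) ≫ φ.inv = capW ε Z := by
    rw [reassoc_of% capW_natural ε φ.hom]
    simp
  rw [← h]
  simp [capW]

theorem whiskerLeft_append {A X Y W Z Z' : C} {m : Z ⟶ Z'} {n : X ⟶ Y} (φ : Z ≅ X ⊗ W)
    (ψ : Z' ≅ Y ⊗ W) (h : m = φ.hom ≫ n ▷ W ≫ ψ.inv) :
    A ◁ m = (A ◁ φ.hom ≫ (α_ A X W).inv) ≫ (A ◁ n) ▷ W ≫ (α_ A Y W).hom ≫ A ◁ ψ.inv := by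
  rw [h]
  simp

variable [SymmetricCategory C]

theorem sw_append {A B X W Z : C} (φ : Z ≅ X ⊗ W) :
    sw A B Z = (A ◁ (B ◁ φ.hom ≫ (α_ B X W).inv) ≫ (α_ A (B ⊗ X) W).inv) ≫ sw A B X ▷ W ≫
      (α_ B (A ⊗ X) W).hom ≫ B ◁ ((α_ A X W).hom ≫ A ◁ φ.inv) := by
  have h : A ◁ B ◁ φ.hom ≫ sw A B (X ⊗ W) ≫ B ◁ A ◁ φ.inv = sw A B Z := by
    rw [reassoc_of% sw_natural A B φ.hom, ← whiskerLeft_comp, ← whiskerLeft_comp]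
    simp
  rw [← h]
  simp [sw]

theorem Swap.eval_append (v : S → C) {u w : List S} (y : Swap u w) (x : List S) :
    (y.append x).eval v =
      (wordAppend v u x).hom ≫ y.eval v ▷ wordObj v x ≫ (wordAppend v w x).inv := by
  induction y with
  | head a b w => exact sw_append (wordAppend v w x)
  | cons a y ih => exact whiskerLeft_append _ _ ih

variable (M : Interp S Pair C)

theorem Move.eval_append {u w : List S} (y : Move Pair u w) (x : List S) :
    (y.append x).eval M =
      (wordAppend M.v u x).hom ≫ y.eval M ▷ wordObj M.v x ≫ (wordAppend M.v w x).inv := by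
  cases y with
  | swap y => exact y.eval_append M.v x
  | cup h w => exact cupW_append (M.cup h) (wordAppend M.v u x)
  | cap h w => exact capW_append (M.cap h) (wordAppend M.v w x)

theorem Path.eval_whiskerRight {u w : List S} (p : Path Pair u w) (x : List S) :
    (p.whiskerRight x).eval M =
      (wordAppend M.v u x).hom ≫ p.eval M ▷ wordObj M.v x ≫ (wordAppend M.v w x).inv := by
  induction p with
  | nil => exact (by simp : 𝟙 _ = (wordAppend M.v u x).hom ≫ 𝟙 _ ▷ _ ≫ (wordAppend M.v u x).inv)
  | snoc p y ih =>
    refine (congrArg₂ (· ≫ ·) ih (y.eval_append M x)).trans ?_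
    simp [eval]

theorem Path.eval_whiskerLeft (x : List S) {u w : List S} (p : Path Pair u w) :
    (p.whiskerLeft x).eval M =
      (wordAppend M.v x u).hom ≫ wordObj M.v x ◁ p.eval M ≫ (wordAppend M.v x w).inv := by
  induction x with
  | nil =>
    refine Eq.trans ?_ (by simp : p.eval M = (λ_ _).inv ≫ 𝟙_ C ◁ p.eval M ≫ (λ_ _).hom)
    rfl
  | cons a x ih =>
    refine (Path.eval_cons M a (p.whiskerLeft x)).trans ?_
    have key : ∀ {A X U W Z Z' : C} {m : Z ⟶ Z'} {n : U ⟶ W} (φ : Z ≅ X ⊗ U) (ψ : Z' ≅ X ⊗ W),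
        m = φ.hom ≫ X ◁ n ≫ ψ.inv → A ◁ m = (A ◁ φ.hom ≫ (α_ A X U).inv) ≫ (A ⊗ X) ◁ n ≫
          (α_ A X W).hom ≫ A ◁ ψ.inv := by
      intro A X U W Z Z' m n φ ψ h
      rw [h]
      simp
    exact key (wordAppend M.v x u) (wordAppend M.v x w) ih

theorem Path.eval_tensor {u w u' w' : List S} (p : Path Pair u w) (q : Path Pair u' w') :
    (p.tensor q).eval M =
      (wordAppend M.v u u').hom ≫ (p.eval M ⊗ₘ q.eval M) ≫ (wordAppend M.v w w').inv := by
  rw [tensor, eval_append, eval_whiskerLeft, eval_whiskerRight, MonoidalCategory.tensorHom_def]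
  simp

/-- By the hexagon identity, carrying a letter past a word one letter at a time is the symmetry with
the whole word. -/
theorem insAfter_eval (v : S → C) (a : S) (w u : List S) :
    (insAfter a w u).eval v = v a ◁ (wordAppend v w u).hom ≫ sw _ _ _ ≫
      (wordAppend v w (a :: u)).inv := by
  induction w with
  | nil =>
    have key : ∀ A U : C, 𝟙 (A ⊗ U) = A ◁ (λ_ U).inv ≫ sw A (𝟙_ C) U ≫ (λ_ (A ⊗ U)).hom := by
      intro A U
      simp [sw, braiding_tensorUnit_right]
    exact key _ _
  | cons b w ih =>
    have key : ∀ {A B W U Z Z' : C} {m : A ⊗ Z ⟶ Z'} (φ : Z ≅ W ⊗ U) (ψ : Z' ≅ W ⊗ (A ⊗ U)),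
        m = A ◁ φ.hom ≫ sw A W U ≫ ψ.inv → sw A B Z ≫ B ◁ m =
          A ◁ (B ◁ φ.hom ≫ (α_ B W U).inv) ≫ sw A (B ⊗ W) U ≫ (α_ B W (A ⊗ U)).hom ≫
            B ◁ ψ.inv := by
      intro A B W U Z Z' m φ ψ h
      rw [h]
      have := sw_natural A B φ.hom
      rw [whiskerLeft_comp, ← reassoc_of% this]
      simp [sw, BraidedCategory.braiding_tensor_right_hom]
    exact key (wordAppend v w u) (wordAppend v w (a :: u)) ih

theorem Path.eval_unitRight (w : List S) :
    (unitRight w : Path Pair _ _).eval M = (ρ_ _).inv ≫ (wordAppend M.v w []).inv := by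
  induction w with
  | nil => exact (by simp [unitors_equal] : 𝟙 (𝟙_ C) = (ρ_ (𝟙_ C)).inv ≫ (λ_ (𝟙_ C)).hom)
  | cons a w ih =>
    refine (Path.eval_cons M a (unitRight w)).trans ?_
    rw [ih]
    have key : ∀ {A W Z : C} (φ : Z ≅ W ⊗ 𝟙_ C), A ◁ ((ρ_ W).inv ≫ φ.inv) =
        (ρ_ (A ⊗ W)).inv ≫ (α_ A W (𝟙_ C)).hom ≫ A ◁ φ.inv := by
      intro A W Z φ
      simp
    exact key (wordAppend M.v w [])

/-- Induction on the first word, with the hexagon identity in the first variable. -/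
theorem Path.eval_braiding (u w : List S) :
    (braiding u w : Path Pair _ _).eval M =
      (wordAppend M.v u w).hom ≫ (β_ _ _).hom ≫ (wordAppend M.v w u).inv := by
  induction u with
  | nil =>
    refine (eval_unitRight M w).trans ?_
    have key : ∀ {W Z : C} (φ : Z ≅ W ⊗ 𝟙_ C), (ρ_ W).inv ≫ φ.inv =
        (λ_ W).inv ≫ (β_ (𝟙_ C) W).hom ≫ φ.inv := by
      intro W Z φ
      simp [braiding_tensorUnit_left]
    exact key _
  | cons a u ih =>
    refine (eval_append M _ _).trans ?_
    rw [Path.eval_cons, ih, Ins.eval_toPath, insAfter_eval]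
    have key : ∀ {A U W Z Z' Z'' : C} (φ : Z ≅ U ⊗ W) (φ' : Z' ≅ W ⊗ U) (ψ : Z'' ≅ W ⊗ (A ⊗ U)),
        A ◁ (φ.hom ≫ (β_ U W).hom ≫ φ'.inv) ≫ A ◁ φ'.hom ≫ sw A W U ≫ ψ.inv =
          (A ◁ φ.hom ≫ (α_ A U W).inv) ≫ (β_ (A ⊗ U) W).hom ≫ ψ.inv := by
      intro A U W Z Z' Z'' φ φ' ψ
      simp [sw, BraidedCategory.braiding_tensor_left_hom]
    exact key (wordAppend M.v u w) (wordAppend M.v w u) (wordAppend M.v w (a :: u))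

end Eval
end PermCC

/-! ### Evaluation under strict functors and morphisms of interpretations -/

namespace PermCC

theorem conj_comp_conj {C : Type u} [Category.{u} C] {X X' Y Y' Z Z' : C}
    (h₁ : X = X') (h₂ : Y = Y') (h₃ : Z' = Z)
    (f : X' ⟶ Y') (g : Y' ⟶ Z') :
    (eqToHom h₁ ≫ f ≫ eqToHom h₂.symm) ≫ eqToHom h₂ ≫ g ≫ eqToHom h₃ =
      eqToHom h₁ ≫ (f ≫ g) ≫ eqToHom h₃ := by
  simp

section Basics

variable {C : Type u} [Category.{u} C] [MonoidalCategory C]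

theorem conj_tensor_conj {X X' Y Y' Z Z' W W' : C} (h₁ : X = X') (h₂ : Y' = Y) (h₃ : Z = Z')
    (h₄ : W' = W) (f : X' ⟶ Y') (g : Z' ⟶ W') :
    (eqToHom h₁ ≫ f ≫ eqToHom h₂) ⊗ₘ (eqToHom h₃ ≫ g ≫ eqToHom h₄) =
      eqToHom (by rw [h₁, h₃]) ≫ (f ⊗ₘ g) ≫ eqToHom (by rw [h₂, h₄]) := by
  subst h₁ h₂ h₃ h₄
  simp

theorem eqToHom_tensor_eqToHom {X X' Z Z' : C} (h₁ : X = X') (h₃ : Z = Z') :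
    eqToHom h₁ ⊗ₘ eqToHom h₃ = eqToHom (by rw [h₁, h₃]) := by
  subst h₁ h₃
  simp

/-- The tensor product of morphisms between letters. -/
def wordMap {S : Type} {v v' : S → C} (t : ∀ s, v s ⟶ v' s) :
    (u : List S) → (wordObj v u ⟶ wordObj v' u)
  | [] => 𝟙 _
  | a :: u => t a ⊗ₘ wordMap t u

theorem wordMap_congr {S : Type} {v v' : S → C} (t : ∀ s, v s ⟶ v' s) {u w : List S} (h : u = w) :
    wordMap t u = eqToHom (by rw [h]) ≫ wordMap t w ≫ eqToHom (by rw [h]) := by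
  subst h
  simp

variable [IsPermutative C]

theorem tensorHom_unit {X Y : C} (f : X ⟶ Y) : f ⊗ₘ 𝟙 (𝟙_ C) =
    eqToHom (IsPermutative.tensor_unit X) ≫ f ≫ eqToHom (IsPermutative.tensor_unit Y).symm := by
  have := rightUnitor_naturality f
  rw [IsPermutative.rightUnitor_eq, IsPermutative.rightUnitor_eq] at this
  simp only [eqToIso.hom] at this
  rw [← reassoc_of% this]
  simp

theorem cupW_unit {A B : C} (η : 𝟙_ C ⟶ A ⊗ B) : cupW η (𝟙_ C) = η ≫ eqToHom (by
    rw [IsPermutative.tensor_unit]) := by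
  rw [cupW, ← tensorHom_id, tensorHom_unit]
  simp [IsPermutative.associator_eq, IsPermutative.leftUnitor_eq]

theorem capW_unit {A B : C} (ε : A ⊗ B ⟶ 𝟙_ C) : capW ε (𝟙_ C) = eqToHom (by
    rw [IsPermutative.tensor_unit]) ≫ ε := by
  rw [capW, ← tensorHom_id, tensorHom_unit]
  simp [IsPermutative.associator_eq, IsPermutative.leftUnitor_eq]

theorem wordObj_append {S : Type} (v : S → C) (u w : List S) :
    wordObj v (u ++ w) = wordObj v u ⊗ wordObj v w := by
  induction u with
  | nil => exact (IsPermutative.unit_tensor _).symm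
  | cons a u ih => exact (congrArg (v a ⊗ ·) ih).trans (IsPermutative.tensor_assoc _ _ _).symm

theorem wordAppend_eq {S : Type} (v : S → C) (u w : List S) :
    wordAppend v u w = eqToIso (wordObj_append v u w) := by
  induction u with
  | nil =>
    refine (congrArg Iso.symm (IsPermutative.leftUnitor_eq _)).trans ?_
    exact Iso.ext rfl
  | cons a u ih =>
    refine (congrArg (fun φ => whiskerLeftIso (v a) φ ≪≫ (α_ _ _ _).symm) ih).trans ?_
    ext
    simp only [Iso.trans_hom, whiskerLeftIso_hom, eqToIso.hom, IsPermutative.associator_eq,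
      whiskerLeft_eqToHom]
    exact eqToHom_trans (congrArg (v a ⊗ ·) (wordObj_append v u w))
      (IsPermutative.tensor_assoc _ _ _).symm

theorem wordMap_append {S : Type} {v v' : S → C} (t : ∀ s, v s ⟶ v' s) (u w : List S) :
    wordMap t (u ++ w) = eqToHom (wordObj_append v u w) ≫ (wordMap t u ⊗ₘ wordMap t w) ≫
      eqToHom (wordObj_append v' u w).symm := by
  induction u with
  | nil =>
    have := leftUnitor_naturality (wordMap t w)
    simp only [IsPermutative.leftUnitor_eq, eqToIso.hom] at this
    refine (?_ : _ = eqToHom (IsPermutative.unit_tensor _).symm ≫ (𝟙 (𝟙_ C) ⊗ₘ wordMap t w) ≫ _)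
    rw [id_tensorHom]
    refine Eq.trans ?_ (congrArg (eqToHom _ ≫ ·) this).symm
    simp
  | cons a u ih =>
    have key : ∀ {A A' U U' W W' Z Z' : C} (h : Z = U ⊗ W) (h' : U' ⊗ W' = Z') (f : A ⟶ A')
      (g : U ⟶ U') (k : W ⟶ W') (m : Z ⟶ Z') (hm : m = eqToHom h ≫ (g ⊗ₘ k) ≫ eqToHom h') (e e'),
      f ⊗ₘ m = eqToHom e ≫ ((f ⊗ₘ g) ⊗ₘ k) ≫ eqToHom e' := by
      intro A A' U U' W W' Z Z' h h' f g k m hm e e'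
      subst h h'
      have := associator_naturality f g k
      simp only [IsPermutative.associator_eq, eqToIso.hom] at this
      rw [hm, this]
      simp
    exact key (wordObj_append v u w) (wordObj_append v' u w).symm (t a) _ _ _ ih _ _

end Basics

namespace StrictFunctor

variable {C D : Type u} [Category.{u} C] [MonoidalCategory C] [SymmetricCategory C]
  [Category.{u} D] [MonoidalCategory D] [SymmetricCategory D]
  (H : StrictFunctor C D)

theorem map_whiskerLeft (X : C) {Y Z : C} (f : Y ⟶ Z) : H.map (X ◁ f) =
    eqToHom (H.obj_tensor X Y) ≫ H.obj X ◁ H.map f ≫ eqToHom (H.obj_tensor X Z).symm := by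
  rw [← id_tensorHom, H.map_tensor, H.map_id, id_tensorHom]

theorem map_whiskerRight (X : C) {Y Z : C} (f : Y ⟶ Z) : H.map (f ▷ X) =
    eqToHom (H.obj_tensor Y X) ≫ H.map f ▷ H.obj X ≫ eqToHom (H.obj_tensor Z X).symm := by
  rw [← tensorHom_id, H.map_tensor, H.map_id, tensorHom_id]

/-- Here and below the image of an object may be replaced by an equal object, because strict
functors preserve words only up to propositional equality. -/
theorem map_conj_whiskerLeft (A : C) {X Y : C} {X' Y' : D} (f : X ⟶ Y) (f' : X' ⟶ Y')
    (hX : H.obj X = X') (hY : Y' = H.obj Y) (h : H.map f = eqToHom hX ≫ f' ≫ eqToHom hY) :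
    H.map (A ◁ f) = eqToHom ((H.obj_tensor A X).trans (by rw [hX])) ≫ H.obj A ◁ f' ≫
      eqToHom (Eq.trans (by rw [hY]) (H.obj_tensor A Y).symm) := by
  subst hX hY
  rw [H.map_whiskerLeft, h]
  simp

/-- The image of a morphism from the unit to a tensor product. -/
def mapCup {A B : C} (η : 𝟙_ C ⟶ A ⊗ B) : 𝟙_ D ⟶ H.obj A ⊗ H.obj B :=
  eqToHom H.obj_unit.symm ≫ H.map η ≫ eqToHom (H.obj_tensor A B)

/-- The image of a morphism from a tensor product to the unit. -/
def mapCap {A B : C} (ε : A ⊗ B ⟶ 𝟙_ C) : H.obj A ⊗ H.obj B ⟶ 𝟙_ D :=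
  eqToHom (H.obj_tensor A B).symm ≫ H.map ε ≫ eqToHom H.obj_unit

theorem obj_tensor₃ (A B : C) {X : C} {X' : D} (h : H.obj X = X') :
    H.obj (A ⊗ B ⊗ X) = H.obj A ⊗ H.obj B ⊗ X' := by
  rw [H.obj_tensor, H.obj_tensor, h]

variable [IsPermutative C] [IsPermutative D]

theorem map_sw (A B : C) {X : C} {X' : D} (h : H.obj X = X') : H.map (sw A B X) =
    eqToHom (H.obj_tensor₃ A B h) ≫ sw (H.obj A) (H.obj B) X' ≫
      eqToHom (H.obj_tensor₃ B A h).symm := by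
  subst h
  simp [sw, IsPermutative.associator_eq, eqToHom_map, map_whiskerRight, H.map_braiding]

theorem map_cupW {A B : C} (η : 𝟙_ C ⟶ A ⊗ B) {X : C} {X' : D} (h : H.obj X = X') :
    H.map (cupW η X) = eqToHom h ≫ cupW (H.mapCup η) X' ≫ eqToHom (H.obj_tensor₃ A B h).symm := by
  subst h
  simp [cupW, mapCup, IsPermutative.associator_eq, IsPermutative.leftUnitor_eq, eqToHom_map,
    map_whiskerRight]

theorem map_capW {A B : C} (ε : A ⊗ B ⟶ 𝟙_ C) {X : C} {X' : D} (h : H.obj X = X') :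
    H.map (capW ε X) = eqToHom (H.obj_tensor₃ A B h) ≫ capW (H.mapCap ε) X' ≫ eqToHom h.symm := by
  subst h
  simp [capW, mapCap, IsPermutative.associator_eq, IsPermutative.leftUnitor_eq, eqToHom_map,
    map_whiskerRight]

end StrictFunctor

section Interp

variable {S : Type} {Pair : S → S → Prop}
  {C D : Type u} [Category.{u} C] [MonoidalCategory C] [SymmetricCategory C]
  [Category.{u} D] [MonoidalCategory D] [SymmetricCategory D]

/-- The image of an interpretation. -/
abbrev Interp.map (M : Interp S Pair C) (H : StrictFunctor C D) : Interp S Pair D where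
  v s := H.obj (M.v s)
  cup h := H.mapCup (M.cup h)
  cap h := H.mapCap (M.cap h)

theorem StrictFunctor.obj_wordObj (H : StrictFunctor C D) (v : S → C) (u : List S) :
    H.obj (wordObj v u) = wordObj (fun s => H.obj (v s)) u := by
  induction u with
  | nil => exact H.obj_unit
  | cons a u ih => exact (H.obj_tensor _ _).trans (congrArg (_ ⊗ ·) ih)

section
variable [IsPermutative C] [IsPermutative D] (H : StrictFunctor C D)

theorem StrictFunctor.map_swap_eval (v : S → C) {u w : List S} (x : Swap u w) :
    H.map (x.eval v) = eqToHom (H.obj_wordObj v u) ≫ x.eval (fun s => H.obj (v s)) ≫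
      eqToHom (H.obj_wordObj v w).symm := by
  induction x with
  | head a b w => exact H.map_sw _ _ (H.obj_wordObj v w)
  | cons a x ih => exact H.map_conj_whiskerLeft (v a) _ _ (H.obj_wordObj v _) _ ih

theorem StrictFunctor.map_move_eval (M : Interp S Pair C) {u w : List S} (x : Move Pair u w) :
    H.map (x.eval M) = eqToHom (H.obj_wordObj M.v u) ≫ x.eval (M.map H) ≫
      eqToHom (H.obj_wordObj M.v w).symm := by
  cases x with
  | swap x => exact H.map_swap_eval M.v x
  | cup h w => exact H.map_cupW _ (H.obj_wordObj M.v _)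
  | cap h w => exact H.map_capW _ (H.obj_wordObj M.v _)

/-- Interchanges are preserved strictly, and the cups and caps of the target are by definition the
images. Relations between formal composites therefore pass to images. -/
theorem StrictFunctor.map_eval (M : Interp S Pair C) {u w : List S} (p : Path Pair u w) :
    H.map (p.eval M) = eqToHom (H.obj_wordObj M.v u) ≫ p.eval (M.map H) ≫
      eqToHom (H.obj_wordObj M.v w).symm := by
  induction p with
  | nil =>
    refine (H.map_id _).trans ?_
    exact (by simp : 𝟙 _ = eqToHom (H.obj_wordObj M.v u) ≫ 𝟙 _ ≫ eqToHom (H.obj_wordObj M.v u).symm)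
  | snoc p x ih =>
    refine (H.map_comp _ _).trans ?_
    rw [ih, H.map_move_eval]
    exact conj_comp_conj _ _ _ _ _

end

/-- Morphisms of interpretations. -/
structure Interp.IsHom (M M' : Interp S Pair C) (t : ∀ s, M.v s ⟶ M'.v s) : Prop where
  cup {a b : S} (h : Pair a b) : M.cup h ≫ (t a ⊗ₘ t b) = M'.cup h
  cap {a b : S} (h : Pair a b) : (t a ⊗ₘ t b) ≫ M'.cap h = M.cap h

theorem sw_tensor {A A' B B' X X' : C} (f : A ⟶ A') (g : B ⟶ B') (k : X ⟶ X') :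
    sw A B X ≫ (g ⊗ₘ f ⊗ₘ k) = (f ⊗ₘ g ⊗ₘ k) ≫ sw A' B' X' := by
  have : (f ⊗ₘ g ⊗ₘ k) = A ◁ B ◁ k ≫ A ◁ g ▷ X' ≫ f ▷ (B' ⊗ X') := by
    simp [MonoidalCategory.tensorHom_def']
  rw [this]
  simp only [Category.assoc, sw_natural_left]
  rw [reassoc_of% sw_natural_mid A g X', reassoc_of% sw_natural A B k]
  congr 1
  rw [MonoidalCategory.tensorHom_def' g, MonoidalCategory.tensorHom_def' f k, whiskerLeft_comp,
    Category.assoc, whisker_exchange]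

theorem Swap.eval_wordMap {v v' : S → C} (t : ∀ s, v s ⟶ v' s) {u w : List S} (x : Swap u w) :
    x.eval v ≫ wordMap t w = wordMap t u ≫ x.eval v' := by
  induction x with
  | head a b w => exact sw_tensor _ _ _
  | cons a x ih =>
    have key : ∀ {A A' X X' Y Y' : C} (f : A ⟶ A') {x : X ⟶ Y} {x' : X' ⟶ Y'} {p : X ⟶ X'}
        {q : Y ⟶ Y'}, x ≫ q = p ≫ x' → A ◁ x ≫ (f ⊗ₘ q) = (f ⊗ₘ p) ≫ A' ◁ x' := by
      intro A A' X X' Y Y' f x x' p q h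
      simp only [← id_tensorHom, tensorHom_comp_tensorHom, h, Category.id_comp, Category.comp_id]
    exact key _ ih

theorem Interp.IsHom.move_wordMap {M M' : Interp S Pair C} {t} (ht : M.IsHom M' t)
    {u w : List S} (x : Move Pair u w) :
    x.eval M ≫ wordMap t w = wordMap t u ≫ x.eval M' := by
  cases x with
  | swap x => exact x.eval_wordMap t
  | cup h w =>
    have key : ∀ {A A' B B' X X' : C} {η : 𝟙_ C ⟶ A ⊗ B} {η' : 𝟙_ C ⟶ A' ⊗ B'} {f : A ⟶ A'}
        {g : B ⟶ B'} (k : X ⟶ X'), η ≫ (f ⊗ₘ g) = η' →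
        cupW η X ≫ (f ⊗ₘ g ⊗ₘ k) = k ≫ cupW η' X' := by
      intro A A' B B' X X' η η' f g k h
      simp only [cupW, Category.assoc, ← h, leftUnitor_inv_naturality_assoc, ← associator_naturality,
        ← tensorHom_id, ← id_tensorHom, tensorHom_comp_tensorHom_assoc, Category.id_comp,
        Category.comp_id]
    exact key _ (ht.cup h)
  | cap h w =>
    have key : ∀ {A A' B B' X X' : C} {ε : A ⊗ B ⟶ 𝟙_ C} {ε' : A' ⊗ B' ⟶ 𝟙_ C} {f : A ⟶ A'}
        {g : B ⟶ B'} (k : X ⟶ X'), (f ⊗ₘ g) ≫ ε' = ε →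
        capW ε X ≫ k = (f ⊗ₘ g ⊗ₘ k) ≫ capW ε' X' := by
      intro A A' B B' X X' η η' f g k h
      simp only [capW, Category.assoc, ← h, ← leftUnitor_naturality,
        ← tensorHom_id, ← id_tensorHom, associator_inv_naturality_assoc,
        tensorHom_comp_tensorHom_assoc, Category.id_comp, Category.comp_id]
    exact key _ (ht.cap h)

/-- Interchanges are natural, and cups and caps are preserved by hypothesis. This is the source of
naturality for transformations given on generators. -/
theorem Interp.IsHom.eval_wordMap {M M' : Interp S Pair C} {t} (ht : M.IsHom M' t)
    {u w : List S} (p : Path Pair u w) :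
    p.eval M ≫ wordMap t w = wordMap t u ≫ p.eval M' := by
  induction p with
  | nil => exact (Category.id_comp _).trans (Category.comp_id _).symm
  | snoc p x ih =>
    simp only [Path.eval, Category.assoc, ht.move_wordMap]
    rw [reassoc_of% ih]

end Interp
end PermCC

/-! ### Presented permutative categories and functors out of them -/

namespace PermCC

variable {S : Type} {Pair : S → S → Prop}

theorem conj_collapse_right {C : Type u} [Category.{u} C] {X V A B D E : C} (η : X ⟶ V) (h₀ : X = A)
    (h₁ : A = X) (h₂ : V = B) (h₃ : B = D) (h₄ : D = E) (h₅ : E = V) :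
    (eqToHom h₀ ≫ (eqToHom h₁ ≫ (η ≫ eqToHom h₂) ≫ eqToHom h₃) ≫ eqToHom h₄) ≫ eqToHom h₅ = η := by
  simp

theorem conj_collapse_left {C : Type u} [Category.{u} C] {X V A B D E : C} (ε : X ⟶ V) (h₀ : E = X)
    (h₁ : E = A) (h₂ : A = B) (h₃ : B = X) (h₄ : V = D) (h₅ : D = V) :
    eqToHom h₀ ≫ ε = eqToHom h₁ ≫ (eqToHom h₂ ≫ (eqToHom h₃ ≫ ε) ≫ eqToHom h₄) ≫ eqToHom h₅ := by
  simp

/-- A presentation of a permutative category: its objects are the words in an alphabet, and the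
elementary morphisms generate. -/
structure Presentation (S : Type) (Pair : S → S → Prop) (Y : Type u) [Category.{u} Y]
    [MonoidalCategory Y] [SymmetricCategory Y] where
  I : Interp S Pair Y
  word : Y → List S
  word_unit : word (𝟙_ Y) = []
  word_tensor (X Z : Y) : word (X ⊗ Z) = word X ++ word Z
  word_v (s : S) : word (I.v s) = [s]
  wordObj_word (X : Y) : wordObj I.v (word X) = X
  exists_path {u w : List S} (σ : wordObj I.v u ⟶ wordObj I.v w) : ∃ p : Path Pair u w, p.eval I = σ

namespace Presentation

variable {Y : Type u} [Category.{u} Y] [MonoidalCategory Y] [SymmetricCategory Y]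
  (P : Presentation S Pair Y) {C : Type u} [Category.{u} C] [MonoidalCategory C]
  [SymmetricCategory C]

/-- All relations between formal composites hold for `M`. -/
def Respects (M : Interp S Pair C) : Prop :=
  ∀ ⦃u w : List S⦄ ⦃p q : Path Pair u w⦄, p.eval P.I = q.eval P.I → p.eval M = q.eval M

theorem exists_path' {X Z : Y} (σ : X ⟶ Z) : ∃ p : Path Pair (P.word X) (P.word Z),
    p.eval P.I = eqToHom (P.wordObj_word X) ≫ σ ≫ eqToHom (P.wordObj_word Z).symm :=
  P.exists_path _

/-- A formal composite that represents a given morphism. -/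
noncomputable def path {X Z : Y} (σ : X ⟶ Z) : Path Pair (P.word X) (P.word Z) :=
  (P.exists_path' σ).choose

theorem eval_path {X Z : Y} (σ : X ⟶ Z) : (P.path σ).eval P.I =
    eqToHom (P.wordObj_word X) ≫ σ ≫ eqToHom (P.wordObj_word Z).symm :=
  (P.exists_path' σ).choose_spec

theorem eq_conj_eval_path {X Z : Y} (σ : X ⟶ Z) : σ =
    eqToHom (P.wordObj_word X).symm ≫ (P.path σ).eval P.I ≫ eqToHom (P.wordObj_word Z) := by
  rw [eval_path]
  simp

variable {P}

/-- The arbitrarily chosen expression for `σ` may be replaced by any convenient one; functoriality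
and strictness of `lift` rest on this. -/
theorem Respects.eval_path {M : Interp S Pair C} (hM : P.Respects M) {X Z : Y} {σ : X ⟶ Z}
    {u w : List S} (hu : u = P.word X) (hw : w = P.word Z) (p : Path Pair u w)
    (h : p.eval P.I = eqToHom (by rw [hu, P.wordObj_word]) ≫ σ ≫
      eqToHom (by rw [hw, P.wordObj_word])) :
    (P.path σ).eval M = eqToHom (by rw [hu]) ≫ p.eval M ≫ eqToHom (by rw [hw]) := by
  subst hu hw
  have := hM ((P.eval_path σ).trans h.symm)
  simp [this]

variable [IsPermutative Y] [IsPermutative C]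

theorem Respects.path_tensor {M : Interp S Pair C} (hM : P.Respects M) {X X' Z Z' : Y} (f : X ⟶ Z)
    (g : X' ⟶ Z') : (P.path (f ⊗ₘ g)).eval M =
      eqToHom ((congrArg (wordObj M.v) (P.word_tensor _ _)).trans (wordObj_append _ _ _)) ≫
      ((P.path f).eval M ⊗ₘ (P.path g).eval M) ≫
      eqToHom ((congrArg (wordObj M.v) (P.word_tensor _ _)).trans (wordObj_append _ _ _)).symm := by
  rw [hM.eval_path (P.word_tensor _ _).symm (P.word_tensor _ _).symm ((P.path f).tensor (P.path g))]
  · rw [Path.eval_tensor]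
    simp [wordAppend_eq]
  · rw [Path.eval_tensor, P.eval_path f, P.eval_path g, conj_tensor_conj]
    simp [wordAppend_eq]

theorem Respects.path_braiding {M : Interp S Pair C} (hM : P.Respects M) (X Z : Y) :
    (P.path (β_ X Z).hom).eval M =
      eqToHom ((congrArg (wordObj M.v) (P.word_tensor _ _)).trans (wordObj_append _ _ _)) ≫
      (β_ _ _).hom ≫
      eqToHom ((congrArg (wordObj M.v) (P.word_tensor _ _)).trans (wordObj_append _ _ _)).symm := by
  have hβ : ∀ {X X' Z Z' : Y} (h : X = X') (h' : Z = Z'), (β_ X Z).hom = eqToHom (by rw [h, h']) ≫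
      (β_ X' Z').hom ≫ eqToHom (by rw [h, h']) := by
    rintro _ _ _ _ rfl rfl
    simp
  rw [hM.eval_path (P.word_tensor _ _).symm (P.word_tensor _ _).symm (Path.braiding _ _)]
  · rw [Path.eval_braiding]
    simp [wordAppend_eq]
  · rw [Path.eval_braiding, hβ (P.wordObj_word X) (P.wordObj_word Z)]
    simp [wordAppend_eq]

/-- The strict symmetric monoidal functor given by an interpretation. -/
noncomputable def lift {M : Interp S Pair C} (hM : P.Respects M) : StrictFunctor Y C where
  obj X := wordObj M.v (P.word X)
  map σ := (P.path σ).eval M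
  map_id X := by
    rw [hM.eval_path rfl rfl (.nil _)]
    · simp [Path.eval]
    · simp [Path.eval]
  map_comp σ τ := by
    rw [hM.eval_path rfl rfl ((P.path σ).append (P.path τ))]
    · simp
    · simp [P.eval_path]
  obj_unit := congrArg (wordObj M.v) P.word_unit
  obj_tensor X Z := (congrArg (wordObj M.v) (P.word_tensor X Z)).trans (wordObj_append _ _ _)
  map_tensor f g := hM.path_tensor f g
  map_braiding X Z := hM.path_braiding X Z

theorem lift_v {M : Interp S Pair C} (hM : P.Respects M) (s : S) :
    (lift hM).obj (P.I.v s) = M.v s :=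
  (congrArg (wordObj M.v) (P.word_v s)).trans (IsPermutative.tensor_unit _)

/-- A one-letter word has the object `M.v s ⊗ 𝟙_ C`, which equals `M.v s` only propositionally; the
generators are thus compared by `eqToHom`. -/
theorem lift_isHom {M : Interp S Pair C} (hM : P.Respects M) :
    (P.I.map (lift hM)).IsHom M fun s => eqToHom (lift_v hM s) where
  cup {a b} h := by
    have h1 : (lift hM).map (P.I.cup h) = _ := hM.eval_path P.word_unit.symm
      (by rw [P.word_tensor, P.word_v, P.word_v]; rfl) ((Path.nil []).snoc (.cup h [])) (by
        refine (Category.id_comp _).trans ((cupW_unit (P.I.cup h)).trans ?_)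
        exact (Category.id_comp _).symm)
    refine (congrArg (_ ≫ ·) (eqToHom_tensor_eqToHom (lift_v hM a) (lift_v hM b))).trans ?_
    refine (congrArg (· ≫ _) (congrArg (fun m => eqToHom _ ≫ m ≫ eqToHom _) h1)).trans ?_
    have h2 : ((Path.nil []).snoc (Move.cup h [])).eval M = _ :=
      (Category.id_comp _).trans (cupW_unit (M.cup h))
    rw [h2]
    exact conj_collapse_right _ _ _ _ _ _ _
  cap {a b} h := by
    have h1 : (lift hM).map (P.I.cap h) = _ := hM.eval_path
      (by rw [P.word_tensor, P.word_v, P.word_v]; rfl) P.word_unit.symm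
      ((Path.nil [a, b]).snoc (.cap h [])) (by
        refine (Category.id_comp _).trans ((capW_unit (P.I.cap h)).trans ?_)
        exact congrArg (_ ≫ ·) (Category.comp_id _).symm)
    refine (congrArg (· ≫ _) (eqToHom_tensor_eqToHom (lift_v hM a) (lift_v hM b))).trans ?_
    refine Eq.trans ?_ (congrArg (fun m => eqToHom _ ≫ m ≫ eqToHom _) h1).symm
    have h2 : ((Path.nil [a, b]).snoc (Move.cap h [])).eval M = _ :=
      (Category.id_comp _).trans (capW_unit (M.cap h))
    rw [h2]
    exact conj_collapse_left _ _ _ _ _ _ _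

end Presentation
end PermCC

/-! ### Monoidal transformations and their values at generators -/

namespace PermCC

variable {S : Type} {Pair : S → S → Prop}
  {C D E : Type u} [Category.{u} C] [MonoidalCategory C] [SymmetricCategory C]
  [Category.{u} D] [MonoidalCategory D] [SymmetricCategory D]
  [Category.{u} E] [MonoidalCategory E] [SymmetricCategory E]

section Conj

variable {A : Type u} [Category.{u} A]

theorem conj_conj {X Y X' Y' X'' Y'' : A} (m : X ⟶ Y) (h₁ : X' = X) (h₂ : Y = Y') (h₃ : X'' = X')
    (h₄ : Y' = Y'') : eqToHom h₃ ≫ (eqToHom h₁ ≫ m ≫ eqToHom h₂) ≫ eqToHom h₄ =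
      eqToHom (h₃.trans h₁) ≫ m ≫ eqToHom (h₂.trans h₄) := by
  simp

theorem conj_self {X Y : A} (m : X ⟶ Y) (h₁ : X = X) (h₂ : Y = Y) :
    eqToHom h₁ ≫ m ≫ eqToHom h₂ = m := by
  simp

theorem conj_id {X Y Z : A} (h₁ : X = Y) (h₂ : Y = Z) :
    eqToHom h₁ ≫ 𝟙 Y ≫ eqToHom h₂ = eqToHom (h₁.trans h₂) := by
  simp

theorem map_conj {B : Type u} [Category.{u} B] (K : A ⥤ B) {X Y X' Y' : A} (m : X ⟶ Y) (h₁ : X' = X)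
    (h₂ : Y = Y') : K.map (eqToHom h₁ ≫ m ≫ eqToHom h₂) =
      eqToHom (congrArg K.obj h₁) ≫ K.map m ≫ eqToHom (congrArg K.obj h₂) := by
  simp [eqToHom_map]

end Conj

namespace StrictFunctor

/-- The components of a monoidal natural transformation. -/
abbrev app {F G : StrictFunctor C D} (α : F ⟶ G) (X : C) : F.obj X ⟶ G.obj X :=
  (Hom.toNatTrans α).app X

variable {F G H : StrictFunctor C D}

theorem app_ext {α β : F ⟶ G} (h : ∀ X, app α X = app β X) : α = β :=
  Hom.ext (NatTrans.ext (funext h))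

theorem app_id (F : StrictFunctor C D) (X : C) : app (𝟙 F) X = 𝟙 _ := rfl

theorem app_comp (α : F ⟶ G) (β : G ⟶ H) (X : C) : app (α ≫ β) X = app α X ≫ app β X := rfl

theorem app_naturality (α : F ⟶ G) {X Y : C} (f : X ⟶ Y) :
    F.map f ≫ app α Y = app α X ≫ G.map f := (Hom.toNatTrans α).naturality f

theorem app_hom_inv (α : F ≅ G) (X : C) : app α.hom X ≫ app α.inv X = 𝟙 _ := by
  rw [← app_comp, α.hom_inv_id, app_id]

theorem app_inv_hom (α : F ≅ G) (X : C) : app α.inv X ≫ app α.hom X = 𝟙 _ := by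
  rw [← app_comp, α.inv_hom_id, app_id]

theorem toFunctor_injective {F G : StrictFunctor C D} (h : F.toFunctor = G.toFunctor) : F = G := by
  cases F
  cases G
  cases h
  rfl

/-- Composition with a functor on the right. -/
def whiskerRight (α : F ⟶ G) (K : StrictFunctor D E) : F.comp K ⟶ G.comp K where
  toNatTrans := Functor.whiskerRight (Hom.toNatTrans α) K.toFunctor
  app_unit := by
    simp only [Functor.whiskerRight_app, (α : Hom F G).app_unit, eqToHom_map]
    rfl
  app_tensor X Y := by
    simp [(α : Hom F G).app_tensor, eqToHom_map, K.map_tensor, comp]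

/-- Isomorphic functors have isomorphic restriction functors. -/
def precompIso (α : F ≅ G) (E : Type u) [Category.{u} E] [MonoidalCategory E]
    [SymmetricCategory E] : F.precomp E ≅ G.precomp E :=
  NatIso.ofComponents (fun K =>
    { hom := whiskerRight α.hom K
      inv := whiskerRight α.inv K
      hom_inv_id := app_ext fun X => by
        change K.map (app α.hom X) ≫ K.map (app α.inv X) = 𝟙 _
        rw [← K.map_comp, app_hom_inv, K.map_id]
      inv_hom_id := app_ext fun X => by
        change K.map (app α.inv X) ≫ K.map (app α.hom X) = 𝟙 _
        rw [← K.map_comp, app_inv_hom, K.map_id] })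
    fun {K L} κ => app_ext fun X => (app_naturality κ (app α.hom X)).symm

/-- A fully faithful functor reflects monoidal natural transformations. -/
noncomputable def homOfFullyFaithful (K : StrictFunctor D E) [K.toFunctor.Full]
    [K.toFunctor.Faithful] (γ : F.comp K ⟶ G.comp K) : F ⟶ G where
  toNatTrans :=
    { app X := K.toFunctor.preimage (app γ X)
      naturality X Y f := K.toFunctor.map_injective (by
        refine (K.map_comp _ _).trans (Eq.trans ?_ (K.map_comp _ _).symm)
        exact (congrArg (K.map _ ≫ ·) (K.toFunctor.map_preimage _)).trans ((app_naturality γ f).trans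
          (congrArg (· ≫ K.map _) (K.toFunctor.map_preimage _)).symm)) }
  app_unit := K.toFunctor.map_injective
    ((K.toFunctor.map_preimage _).trans ((Hom.app_unit γ).trans (eqToHom_map K.toFunctor _).symm))
  app_tensor X Y := K.toFunctor.map_injective (by
    refine (K.toFunctor.map_preimage _).trans ((Hom.app_tensor γ X Y).trans ?_)
    refine Eq.trans ?_ ((map_conj _ _ _ _).trans (congrArg (fun m => eqToHom _ ≫ m ≫ eqToHom _)
      (K.map_tensor _ _))).symm
    refine Eq.trans ?_ (conj_conj _ _ _ _ _).symm
    exact congrArg₂ (fun m n => eqToHom _ ≫ (m ⊗ₘ n) ≫ eqToHom _) (K.toFunctor.map_preimage _).symm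
      (K.toFunctor.map_preimage _).symm)

theorem map_homOfFullyFaithful (K : StrictFunctor D E) [K.toFunctor.Full]
    [K.toFunctor.Faithful] (γ : F.comp K ⟶ G.comp K) (X : C) :
    K.map (app (homOfFullyFaithful K γ) X) = app γ X := K.toFunctor.map_preimage _

noncomputable def isoOfFullyFaithful (K : StrictFunctor D E) [K.toFunctor.Full]
    [K.toFunctor.Faithful] (γ : F.comp K ≅ G.comp K) : F ≅ G where
  hom := homOfFullyFaithful K γ.hom
  inv := homOfFullyFaithful K γ.inv
  hom_inv_id := app_ext fun X => K.toFunctor.map_injective (by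
    rw [app_comp, K.map_comp, map_homOfFullyFaithful, map_homOfFullyFaithful]
    exact (app_hom_inv γ X).trans (K.map_id _).symm)
  inv_hom_id := app_ext fun X => K.toFunctor.map_injective (by
    rw [app_comp, K.map_comp, map_homOfFullyFaithful, map_homOfFullyFaithful]
    exact (app_inv_hom γ X).trans (K.map_id _).symm)

/-- Restriction along a functor with a quasi-inverse is an equivalence. -/
theorem isEquivalence_precomp {K : StrictFunctor C D} {R : StrictFunctor D C}
    (φ : R.comp K ≅ StrictFunctor.id D) (ψ : K.comp R ≅ StrictFunctor.id C) (E : Type u)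
    [Category.{u} E] [MonoidalCategory E] [SymmetricCategory E] :
    (K.precomp E).IsEquivalence :=
  (CategoryTheory.Equivalence.mk (K.precomp E) (R.precomp E)
    (precompIso φ E).symm (precompIso ψ E)).isEquivalence_functor

end StrictFunctor

section

variable {C : Type u} [Category.{u} C] [MonoidalCategory C]

theorem wordMap_comp {v v' v'' : S → C} (t : ∀ s, v s ⟶ v' s) (t' : ∀ s, v' s ⟶ v'' s)
    (u : List S) : wordMap t u ≫ wordMap t' u = wordMap (fun s => t s ≫ t' s) u := by
  induction u with
  | nil => exact Category.id_comp _
  | cons a u ih =>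
    refine (tensorHom_comp_tensorHom _ _ _ _).trans ?_
    rw [ih]
    rfl

theorem wordMap_id (v : S → C) (u : List S) : wordMap (fun s => 𝟙 (v s)) u = 𝟙 _ := by
  induction u with
  | nil => rfl
  | cons a u ih =>
    refine (congrArg (𝟙 _ ⊗ₘ ·) ih).trans ?_
    exact id_tensorHom_id _ _

theorem wordMap_hom_inv {v v' : S → C} (t : ∀ s, v s ≅ v' s) (u : List S) :
    wordMap (fun s => (t s).hom) u ≫ wordMap (fun s => (t s).inv) u = 𝟙 _ := by
  rw [wordMap_comp]
  simp [wordMap_id]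

end

namespace Interp

section

variable {C : Type u} [Category.{u} C] [MonoidalCategory C]

theorem IsHom.symm {M M' : Interp S Pair C} {t : ∀ s, M.v s ≅ M'.v s}
    (h : M.IsHom M' fun s => (t s).hom) : M'.IsHom M fun s => (t s).inv where
  cup hp := by
    rw [← h.cup hp, Category.assoc, tensorHom_comp_tensorHom]
    simp
  cap hp := by
    rw [← h.cap hp, tensorHom_comp_tensorHom_assoc]
    simp

theorem IsHom.comp {M M' M'' : Interp S Pair C} {t t'} (h : M.IsHom M' t) (h' : M'.IsHom M'' t') :
    M.IsHom M'' fun s => t s ≫ t' s where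
  cup hp := by
    rw [← h'.cup hp, ← h.cup hp, Category.assoc, tensorHom_comp_tensorHom]
  cap hp := by
    rw [← h.cap hp, ← h'.cap hp, tensorHom_comp_tensorHom_assoc]

end

theorem IsHom.map {M M' : Interp S Pair C} {t} (h : M.IsHom M' t) (H : StrictFunctor C D) :
    (M.map H).IsHom (M'.map H) fun s => H.map (t s) where
  cup {a b} hp := by
    change (eqToHom _ ≫ H.map (M.cup hp) ≫ eqToHom _) ≫ (H.map (t a) ⊗ₘ H.map (t b)) =
      eqToHom _ ≫ H.map (M'.cup hp) ≫ eqToHom _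
    rw [← h.cup hp, H.map_comp, H.map_tensor]
    simp
  cap {a b} hp := by
    change (H.map (t a) ⊗ₘ H.map (t b)) ≫ eqToHom _ ≫ H.map (M'.cap hp) ≫ eqToHom _ =
      eqToHom _ ≫ H.map (M.cap hp) ≫ eqToHom _
    rw [← h.cap hp, H.map_comp, H.map_tensor]
    simp

theorem isHom_map_comp (M : Interp S Pair C) (H : StrictFunctor C D) (K : StrictFunctor D E) :
    (M.map (H.comp K)).IsHom ((M.map H).map K) fun _ => 𝟙 _ where
  cup {a b} h := by
    refine (congrArg (_ ≫ ·) (id_tensorHom_id _ _)).trans ((Category.comp_id _).trans ?_)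
    exact (conj_conj _ _ _ _ _).symm.trans
      (congrArg (fun m => eqToHom _ ≫ m ≫ eqToHom _) (map_conj K.toFunctor _ _ _)).symm
  cap {a b} h := by
    refine (congrArg (· ≫ _) (id_tensorHom_id _ _)).trans ((Category.id_comp _).trans ?_)
    exact ((conj_conj _ _ _ _ _).symm.trans
      (congrArg (fun m => eqToHom _ ≫ m ≫ eqToHom _) (map_conj K.toFunctor _ _ _)).symm).symm

/-- Naturality at the cups and caps, combined with the monoidal axioms for the components at the
unit and at tensor products. -/
theorem isHom_app (M : Interp S Pair C) {F G : StrictFunctor C D} (α : F ⟶ G) :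
    (M.map F).IsHom (M.map G) fun s => StrictFunctor.app α (M.v s) where
  cup {a b} h := by
    have h1 := StrictFunctor.app_naturality α (M.cup h)
    have h2 : StrictFunctor.app α (𝟙_ C) = _ := StrictFunctor.Hom.app_unit α
    have h3 : StrictFunctor.app α (M.v a ⊗ M.v b) = _ := StrictFunctor.Hom.app_tensor α _ _
    rw [h2, h3] at h1
    have h4 := congrArg (fun m => eqToHom F.obj_unit.symm ≫ m ≫ eqToHom (G.obj_tensor _ _)) h1
    simpa [StrictFunctor.mapCup] using h4
  cap {a b} h := by
    have h1 := StrictFunctor.app_naturality α (M.cap h)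
    have h2 : StrictFunctor.app α (𝟙_ C) = _ := StrictFunctor.Hom.app_unit α
    have h3 : StrictFunctor.app α (M.v a ⊗ M.v b) = _ := StrictFunctor.Hom.app_tensor α _ _
    rw [h2, h3] at h1
    have h4 := congrArg (fun m => eqToHom (F.obj_tensor _ _).symm ≫ m ≫ eqToHom G.obj_unit) h1
    simpa [StrictFunctor.mapCap] using h4.symm

end Interp

namespace Presentation

variable {Y : Type u} [Category.{u} Y] [MonoidalCategory Y] [SymmetricCategory Y]
  (P : Presentation S Pair Y)

theorem obj_eq (H : StrictFunctor Y C) (X : Y) :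
    H.obj X = wordObj (fun s => H.obj (P.I.v s)) (P.word X) :=
  (congrArg H.obj (P.wordObj_word X).symm).trans (H.obj_wordObj _ _)

/-- Evaluation is natural along the isomorphism `t`, which can then be cancelled. -/
theorem Respects.of_isHom {P : Presentation S Pair Y} {M M' : Interp S Pair C}
    {t : ∀ s, M.v s ≅ M'.v s} (h : M.IsHom M' fun s => (t s).hom) (hM : P.Respects M') :
    P.Respects M := by
  intro u w p q e
  have h1 := (h.eval_wordMap p).trans ((congrArg (_ ≫ ·) (hM e)).trans (h.eval_wordMap q).symm)
  have h2 := congrArg (· ≫ wordMap (fun s => (t s).inv) w) h1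
  simpa only [Category.assoc, wordMap_hom_inv, Category.comp_id] using h2

section
variable [IsPermutative Y] [IsPermutative C]

theorem map_eq (H : StrictFunctor Y C) {X Z : Y} (σ : X ⟶ Z) :
    H.map σ = eqToHom (P.obj_eq H X) ≫ (P.path σ).eval (P.I.map H) ≫
      eqToHom (P.obj_eq H Z).symm := by
  have h := congrArg H.map (P.eq_conj_eval_path σ)
  rw [H.map_comp, H.map_comp, H.map_eval, eqToHom_map, eqToHom_map] at h
  refine h.trans ?_
  simp only [Category.assoc, eqToHom_trans, eqToHom_trans_assoc]

theorem respects_map (H : StrictFunctor Y C) : P.Respects (P.I.map H) := by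
  intro u w p q h
  have h1 := (H.map_eval P.I p).symm.trans ((congrArg H.map h).trans (H.map_eval P.I q))
  have h2 := congrArg (fun m => eqToHom (H.obj_wordObj P.I.v u).symm ≫ m ≫
    eqToHom (H.obj_wordObj P.I.v w)) h1
  simp only [Category.assoc, eqToHom_trans, eqToHom_trans_assoc, eqToHom_refl] at h2
  exact ((Category.comp_id _).symm.trans (Category.id_comp _).symm).trans
    (h2.trans ((Category.id_comp _).trans (Category.comp_id _)))

variable {P} {H H' : StrictFunctor Y C}

/-- The monoidal natural transformation given by its components at the generators. -/
def homOf {t : ∀ s, H.obj (P.I.v s) ⟶ H'.obj (P.I.v s)} (ht : (P.I.map H).IsHom (P.I.map H') t) :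
    H ⟶ H' where
  toNatTrans :=
    { app X := eqToHom (P.obj_eq H X) ≫ wordMap t (P.word X) ≫ eqToHom (P.obj_eq H' X).symm
      naturality X Z σ := by
        rw [P.map_eq H σ, P.map_eq H' σ]
        refine (conj_comp_conj _ _ _ _ _).trans (Eq.trans ?_ (conj_comp_conj _ _ _ _ _).symm)
        exact congrArg (fun m => eqToHom _ ≫ m ≫ eqToHom _) (ht.eval_wordMap _) }
  app_unit := by
    dsimp only
    rw [wordMap_congr t P.word_unit]
    exact (conj_conj _ _ _ _ _).trans (conj_id _ _)
  app_tensor X Z := by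
    dsimp only
    rw [wordMap_congr t (P.word_tensor X Z), wordMap_append, conj_tensor_conj]
    simp

theorem app_homOf {t : ∀ s, H.obj (P.I.v s) ⟶ H'.obj (P.I.v s)}
    (ht : (P.I.map H).IsHom (P.I.map H') t) (s : S) :
    StrictFunctor.app (homOf ht) (P.I.v s) = t s := by
  change eqToHom _ ≫ wordMap t (P.word _) ≫ eqToHom _ = _
  rw [wordMap_congr t (P.word_v s)]
  have : wordMap t [s] = eqToHom (IsPermutative.tensor_unit _) ≫ t s ≫
    eqToHom (IsPermutative.tensor_unit _).symm := tensorHom_unit (t s)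
  rw [this]
  exact (congrArg (fun m => eqToHom _ ≫ m ≫ eqToHom _) (conj_conj _ _ _ _ _)).trans
    ((conj_conj _ _ _ _ _).trans (conj_self _ _ _))

end

variable {P} {H H' : StrictFunctor Y C}

/-- Every object is a word in the generators, and the monoidal axioms compute the component at a
word. -/
theorem app_ext {α β : H ⟶ H'}
    (h : ∀ s, StrictFunctor.app α (P.I.v s) = StrictFunctor.app β (P.I.v s)) : α = β := by
  have key : ∀ u : List S, StrictFunctor.app α (wordObj P.I.v u) =
      StrictFunctor.app β (wordObj P.I.v u) := by
    intro u
    induction u with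
    | nil =>
      exact Eq.trans ((α : StrictFunctor.Hom _ _).app_unit) ((β : StrictFunctor.Hom _ _).app_unit).symm
    | cons a u ih =>
      refine ((α : StrictFunctor.Hom _ _).app_tensor _ _).trans
        (Eq.trans ?_ ((β : StrictFunctor.Hom _ _).app_tensor _ _).symm)
      exact congrArg₂ (fun m n => eqToHom _ ≫ (m ⊗ₘ n) ≫ eqToHom _) (h a) ih
  refine StrictFunctor.app_ext fun X => ?_
  have := key (P.word X)
  rwa [P.wordObj_word] at this

/-- Identities at the generators force identities at all words, and naturality then says that the
functors agree on morphisms. This turns lifts up to isomorphism into strict lifts. -/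
theorem eq_of_app_eq {α : H ⟶ H'} (h : ∀ s, ∃ e : H.obj (P.I.v s) = H'.obj (P.I.v s),
    StrictFunctor.app α (P.I.v s) = eqToHom e) : H = H' := by
  have key : ∀ u : List S, ∃ e, StrictFunctor.app α (wordObj P.I.v u) = eqToHom e := by
    intro u
    induction u with
    | nil => exact ⟨_, (α : StrictFunctor.Hom _ _).app_unit⟩
    | cons a u ih =>
      obtain ⟨e, he⟩ := h a
      obtain ⟨e', he'⟩ := ih
      refine ⟨((H.obj_tensor _ _).trans (by rw [e, e'])).trans (H'.obj_tensor _ _).symm,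
        ((α : StrictFunctor.Hom _ _).app_tensor _ _).trans ?_⟩
      refine (congrArg₂ (fun m n => eqToHom _ ≫ (m ⊗ₘ n) ≫ eqToHom _) he he').trans ?_
      rw [eqToHom_tensor_eqToHom]
      simp
      rfl
  have key' : ∀ X, ∃ e, StrictFunctor.app α X = eqToHom e := by
    intro X
    have := key (P.word X)
    rwa [P.wordObj_word] at this
  choose e he using key'
  refine StrictFunctor.toFunctor_injective (CategoryTheory.Functor.ext e fun X Z f => ?_)
  have := StrictFunctor.app_naturality α f
  rw [he, he] at this
  rw [← reassoc_of% this]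
  simp

variable [IsPermutative Y] [IsPermutative C]

/-- The monoidal natural isomorphism given by its components at the generators. -/
def isoOf {t : ∀ s, H.obj (P.I.v s) ≅ H'.obj (P.I.v s)}
    (ht : (P.I.map H).IsHom (P.I.map H') fun s => (t s).hom) : H ≅ H' where
  hom := homOf ht
  inv := homOf (Interp.IsHom.symm (M := P.I.map H) (M' := P.I.map H') (t := t) ht)
  hom_inv_id := app_ext (P := P) fun s => by
    rw [StrictFunctor.app_comp, app_homOf, app_homOf]
    exact (t s).hom_inv_id
  inv_hom_id := app_ext (P := P) fun s => by
    rw [StrictFunctor.app_comp, app_homOf, app_homOf]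
    exact (t s).inv_hom_id

end Presentation
end PermCC

/-! ### Lifting along fully faithful functors and cofibrancy -/

namespace PermCC

namespace Presentation

variable {S : Type} {Pair : S → S → Prop} {Y B E : Type u}
  [Category.{u} Y] [MonoidalCategory Y] [SymmetricCategory Y]
  [Category.{u} B] [MonoidalCategory B] [SymmetricCategory B]
  [Category.{u} E] [MonoidalCategory E] [SymmetricCategory E]
  (P : Presentation S Pair Y) (K : StrictFunctor E B) [K.toFunctor.Full]
  (b : StrictFunctor Y B) {e : S → E} (θ : ∀ s, K.obj (e s) ≅ b.obj (P.I.v s))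

/-- The interpretation of the generators by preimages of the images of the generators. -/
noncomputable def preimageInterp : Interp S Pair E where
  v := e
  cup {x y} h := K.toFunctor.preimage (eqToHom K.obj_unit ≫ b.mapCup (P.I.cup h) ≫
    ((θ x).inv ⊗ₘ (θ y).inv) ≫ eqToHom (K.obj_tensor _ _).symm)
  cap {x y} h := K.toFunctor.preimage (eqToHom (K.obj_tensor _ _) ≫
    ((θ x).hom ⊗ₘ (θ y).hom) ≫ b.mapCap (P.I.cap h) ≫ eqToHom K.obj_unit.symm)

theorem preimageInterp_isHom :
    ((P.preimageInterp K b θ).map K).IsHom (P.I.map b) fun s => (θ s).hom where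
  cup {x y} h := by
    refine (congrArg (fun m => (eqToHom _ ≫ m ≫ eqToHom _) ≫ _) (K.toFunctor.map_preimage _)).trans ?_
    have key : ∀ {U V W : B} (h : V = U) (h' : U = V) {A A' D D' : B} (f : A ≅ A') (g : D ≅ D')
        (k : W = A ⊗ D) (k' : A ⊗ D = W) (m : V ⟶ A' ⊗ D'),
        (eqToHom h ≫ (eqToHom h' ≫ m ≫ (f.inv ⊗ₘ g.inv) ≫ eqToHom k') ≫ eqToHom k) ≫
          (f.hom ⊗ₘ g.hom) = m := by
      intro U V W h h' A A' D D' f g k k' m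
      simp
    exact key _ _ (θ x) (θ y) _ _ _
  cap {x y} h := by
    refine Eq.trans ?_ (congrArg (fun m => (eqToHom _ ≫ m ≫ eqToHom _))
      (K.toFunctor.map_preimage _)).symm
    have key : ∀ {U V W : B} (h : V = U) (h' : U = V) {A Z : B} (k : W = A)
        (k' : A = W) (m : A ⟶ Z) (n : Z ⟶ V),
        m ≫ n = eqToHom k' ≫ (eqToHom k ≫ m ≫ n ≫ eqToHom h) ≫ eqToHom h' := by
      intro U V W h h' A Z k k' m n
      simp
    exact key _ _ _ _ _ _

variable [K.toFunctor.Faithful] [IsPermutative Y] [IsPermutative B] [IsPermutative E]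

/-- The relations hold for the images under `b`, pass along `θ` to the images under `K`, and are
reflected because `K` is faithful. -/
theorem preimageInterp_respects : P.Respects (P.preimageInterp K b θ) := by
  intro u w p q h
  have h1 := Respects.of_isHom (M := (P.preimageInterp K b θ).map K) (M' := P.I.map b)
    (t := θ) (P.preimageInterp_isHom K b θ) (P.respects_map b) h
  apply K.toFunctor.map_injective
  rw [K.map_eval, K.map_eval, h1]

/-- Lifting of strict symmetric monoidal functors along fully faithful ones. -/
theorem exists_lift : ∃ (l : StrictFunctor Y E) (α : l.comp K ≅ b), ∀ s,
    ∃ h : (l.comp K).obj (P.I.v s) = K.obj (e s),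
      StrictFunctor.app α.hom (P.I.v s) = eqToHom h ≫ (θ s).hom := by
  let hM := P.preimageInterp_respects K b θ
  let l : StrictFunctor Y E := lift hM
  let t : ∀ s, (l.comp K).obj (P.I.v s) ≅ b.obj (P.I.v s) := fun s =>
    Iso.refl _ ≪≫ K.toFunctor.mapIso (eqToIso (lift_v hM s)) ≪≫ θ s
  have ht : (P.I.map (l.comp K)).IsHom (P.I.map b) fun s => (t s).hom :=
    (P.I.isHom_map_comp l K).comp (((lift_isHom hM).map K).comp (P.preimageInterp_isHom K b θ))
  refine ⟨l, isoOf ht, fun s => ⟨congrArg K.obj (lift_v hM s), ?_⟩⟩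
  refine (app_homOf ht s).trans ?_
  refine (Category.id_comp _).trans (congrArg (· ≫ (θ s).hom) ?_)
  exact eqToHom_map K.toFunctor (lift_v hM s)

/-- Restriction along a weak equivalence to a presented permutative category is an equivalence. -/
theorem isEquivalence_precomp (P : Presentation S Pair Y) (k : StrictFunctor E Y)
    [k.toFunctor.IsEquivalence] (C : Type u) [Category.{u} C] [MonoidalCategory C] [SymmetricCategory C] :
    (k.precomp C).IsEquivalence := by
  -- The identity of `Y` lifts along `k` to a strict quasi-inverse `r`. For the other composite an
  -- isomorphism is reflected along the fully faithful `k`.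
  obtain ⟨r, φ, -⟩ := P.exists_lift k (StrictFunctor.id Y)
    (fun s => k.toFunctor.objObjPreimageIso (P.I.v s))
  exact StrictFunctor.isEquivalence_precomp φ
    (StrictFunctor.isoOfFullyFaithful (F := k.comp r) (G := StrictFunctor.id E) k
      ((k.precomp Y).mapIso φ)) C

end Presentation

/-- A permutative category with a presentation is cofibrant. -/
theorem PermCat.isCofibrant_of_presentation {S : Type} {Pair : S → S → Prop} {X : PermCat.{u}}
    (P : Presentation S Pair X) : X.IsCofibrant := by
  intro E B p hp hf b
  have : (StrictFunctor.toFunctor p).IsEquivalence := hp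
  -- An acyclic fibration is surjective on objects, so the generators have strict preimages and the
  -- isomorphisms to be lifted are identities.
  have key : ∀ s, ∃ x : E, (StrictFunctor.toFunctor p).obj x =
      (StrictFunctor.toFunctor b).obj (P.I.v s) := by
    intro s
    obtain ⟨x, -, h, -⟩ := hf _ _ ((StrictFunctor.toFunctor p).objObjPreimageIso
      ((StrictFunctor.toFunctor b).obj (P.I.v s)))
    exact ⟨x, h⟩
  choose e he using key
  obtain ⟨l, α, h⟩ := P.exists_lift p b (e := e) fun s => eqToIso (he s)
  refine ⟨l, Presentation.eq_of_app_eq (P := P) (α := α.hom) fun s => ?_⟩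
  obtain ⟨h', h⟩ := h s
  exact ⟨h'.trans (he s), h.trans (eqToHom_trans h' (he s))⟩

/-- The presentation of the free compact closed permutative category. -/
def FrCC.presentation : Presentation PointSign (· ≠ ·) FrCC.{u} where
  I := interp
  word := word
  word_unit := rfl
  word_tensor _ _ := rfl
  word_v _ := rfl
  wordObj_word := by
    rintro ⟨w⟩
    induction w with
    | nil => rfl
    | cons a w ih => exact congrArg (pt a ⊗ ·) ih
  exists_path := exists_path

/-- The presentation of the free permutative category. -/
def FreePerm.presentation : Presentation Unit (fun _ _ => False) FreePerm.{u} where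
  I := interp
  word n := List.replicate n.card ()
  word_unit := rfl
  word_tensor _ _ := List.replicate_add _ _ _
  word_v _ := rfl
  wordObj_word _ := FreePerm.ext ((card_wordObj _).trans List.length_replicate)
  exists_path := exists_path

theorem FrCC.respects {C : Type u} [Category.{u} C] [MonoidalCategory C] [SymmetricCategory C]
    {M : Interp PointSign (· ≠ ·) C} (hM : M.IsDual) : presentation.{u}.Respects M :=
  fun _ _ _ _ h => eval_eq_of_eval_interp_eq hM h

theorem FreePerm.respects {C : Type u} [Category.{u} C] [MonoidalCategory C] [SymmetricCategory C]
    (M : Interp Unit (fun _ _ => False) C) : presentation.{u}.Respects M :=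
  fun _ _ _ _ h => eval_eq_of_eval_interp_eq M h

end PermCC

/-! ### Duality data and their uniqueness -/

namespace PermCC

section Duals

variable {C : Type u} [Category.{u} C] [MonoidalCategory C]

/-- An isomorphism of objects with duals extends to an isomorphism of dualities. -/
theorem exists_dual_iso {c c' d d' : C} [ExactPairing d c] [ExactPairing d' c'] (a : c ≅ c') :
    ∃ t : d ≅ d', η_ d c ≫ (t.hom ⊗ₘ a.hom) = η_ d' c' ∧ (a.hom ⊗ₘ t.hom) ≫ ε_ d' c' = ε_ d c := by
  have key : ∀ (X Y : C) [HasLeftDual X] [HasLeftDual Y] (a : X ≅ Y),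
      ∃ t : (ᘁX) ≅ (ᘁY), η_ (ᘁX) X ≫ (t.hom ⊗ₘ a.hom) = η_ (ᘁY) Y ∧
        (a.hom ⊗ₘ t.hom) ≫ ε_ (ᘁY) Y = ε_ (ᘁX) X := by
    intro X Y _ _ a
    -- Mates reverse direction, so the mate of the inverse leads from the dual of `X` to the dual of
    -- `Y`.
    refine ⟨⟨ᘁa.inv, ᘁa.hom, ?_, ?_⟩, ?_, ?_⟩
    · rw [← comp_leftAdjointMate, a.hom_inv_id, leftAdjointMate_id]
    · rw [← comp_leftAdjointMate, a.inv_hom_id, leftAdjointMate_id]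
    · rw [MonoidalCategory.tensorHom_def, coevaluation_comp_leftAdjointMate_assoc]
      simp [← whiskerLeft_comp]
    · rw [MonoidalCategory.tensorHom_def, Category.assoc, leftAdjointMate_comp_evaluation]
      simp [← comp_whiskerRight_assoc]
  let _ : HasLeftDual c := ⟨d⟩
  let _ : HasLeftDual c' := ⟨d'⟩
  exact key c c' a

/-- A morphism out of `d` is recovered from its composite with the coevaluation by bending back with
the evaluation. -/
theorem eq_of_coevaluation_comp_eq {c c' d d' : C} [ExactPairing d c] {s t : d ⟶ d'} (a : c ≅ c')
    (h : η_ d c ≫ (s ⊗ₘ a.hom) = η_ d c ≫ (t ⊗ₘ a.hom)) : s = t := by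
  rw [MonoidalCategory.tensorHom_def, MonoidalCategory.tensorHom_def, ← Category.assoc,
    ← Category.assoc, cancel_mono] at h
  have key : ∀ s : d ⟶ d', (λ_ d).inv ≫ (η_ d c ≫ s ▷ c) ▷ d ≫ (α_ _ _ _).hom ≫
      d' ◁ ε_ d c ≫ (ρ_ d').hom = s := by
    intro s
    have := ExactPairing.evaluation_coevaluation d c
    rw [comp_whiskerRight, Category.assoc, associator_naturality_left_assoc,
      ← whisker_exchange_assoc, reassoc_of% this]
    simp
  rw [← key s, h, key t]

end Duals

namespace Interp

section

variable {C : Type u} [Category.{u} C] [MonoidalCategory C] [SymmetricCategory C]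

/-- The interpretation of the signs by an object and a dual. -/
def ofExactPairing (d c : C) [ExactPairing d c] : Interp PointSign (· ≠ ·) C where
  v
    | .pos => c
    | .neg => d
  cup {a b} h := match a, b, h with
    | .neg, .pos, _ => η_ d c
    | .pos, .neg, _ => η_ d c ≫ (β_ d c).hom
  cap {a b} h := match a, b, h with
    | .pos, .neg, _ => ε_ d c
    | .neg, .pos, _ => (β_ d c).hom ≫ ε_ d c

theorem ofExactPairing_isDual (d c : C) [ExactPairing d c] : (ofExactPairing d c).IsDual where
  cup_braiding {a b} h := match a, b, h with
    | .neg, .pos, _ => rfl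
    | .pos, .neg, _ => by
      have : (η_ d c ≫ (β_ d c).hom) ≫ (β_ c d).hom = η_ d c := by simp
      exact this
  braiding_cap {a b} h := match a, b, h with
    | .pos, .neg, _ => rfl
    | .neg, .pos, _ => by
      have : (β_ c d).hom ≫ (β_ d c).hom ≫ ε_ d c = ε_ d c := by simp
      exact this
  zigzag {a b} h X := match a, b, h with
    | .pos, .neg, _ => zigzag_left (c := c) (d := d) X
    | .neg, .pos, _ => zigzag_symm (c := c) (d := d) X

variable {M M' : Interp PointSign (· ≠ ·) C}

/-- The duality between the two signs. -/
abbrev IsDual.exactPairing (hM : M.IsDual) : ExactPairing (M.v .neg) (M.v .pos) :=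
  exactPairingOfZigzag (M.cup neg_ne_pos) (M.cap neg_ne_pos.symm)
    (hM.zigzag neg_ne_pos.symm _) (by
      -- By symmetry the second triangle identity is the zigzag of the negative sign.
      rw [← zigzag_symm_eq, hM.cup_braiding, hM.braiding_cap]
      exact hM.zigzag neg_ne_pos _)

/-- The other orientations of cup and cap follow by composition with the symmetry. -/
theorem IsDual.isHom (hM : M.IsDual) (hM' : M'.IsDual) {t : ∀ s, M.v s ⟶ M'.v s}
    (h : M.cup neg_ne_pos ≫ (t .neg ⊗ₘ t .pos) = M'.cup neg_ne_pos)
    (h' : (t .pos ⊗ₘ t .neg) ≫ M'.cap neg_ne_pos.symm = M.cap neg_ne_pos.symm) :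
    M.IsHom M' t where
  cup {a b} k := match a, b, k with
    | .neg, .pos, _ => h
    | .pos, .neg, _ => by
      rw [← hM.cup_braiding neg_ne_pos, ← hM'.cup_braiding neg_ne_pos, ← h, Category.assoc,
        Category.assoc, BraidedCategory.braiding_naturality]
  cap {a b} k := match a, b, k with
    | .pos, .neg, _ => h'
    | .neg, .pos, _ => by
      rw [← hM.braiding_cap neg_ne_pos.symm, ← hM'.braiding_cap neg_ne_pos.symm, ← h',
        BraidedCategory.braiding_naturality_assoc]

/-- An isomorphism between the positive generators extends to the negative ones. -/
theorem IsDual.exists_isHom (hM : M.IsDual) (hM' : M'.IsDual) (a : M.v .pos ≅ M'.v .pos) :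
    ∃ t : ∀ s, M.v s ≅ M'.v s, t .pos = a ∧ M.IsHom M' fun s => (t s).hom := by
  let _ := hM.exactPairing
  let _ := hM'.exactPairing
  obtain ⟨t, h, h'⟩ := exists_dual_iso (d := M.v .neg) (d' := M'.v .neg) a
  refine ⟨fun | .pos => a | .neg => t, rfl, hM.isHom hM' h h'⟩

/-- Compatibility with the coevaluation determines the negative component from the positive one. -/
theorem IsDual.isHom_unique (hM : M.IsDual) {t t' : ∀ s, M.v s ⟶ M'.v s} (ht : M.IsHom M' t)
    (ht' : M.IsHom M' t') (a : M.v .pos ≅ M'.v .pos) (h : t .pos = a.hom) (h' : t' .pos = a.hom)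
    (s : PointSign) : t s = t' s := by
  let _ := hM.exactPairing
  cases s with
  | pos => exact h.trans h'.symm
  | neg =>
    have h1 := (ht.cup neg_ne_pos).trans (ht'.cup neg_ne_pos).symm
    rw [h, h'] at h1
    exact eq_of_coevaluation_comp_eq a h1

end

variable {C D : Type u} [Category.{u} C] [MonoidalCategory C] [SymmetricCategory C]
  [Category.{u} D] [MonoidalCategory D] [SymmetricCategory D]
  {M : Interp PointSign (· ≠ ·) C} [IsPermutative C] [IsPermutative D]

theorem IsDual.map (hM : M.IsDual) (H : StrictFunctor C D) : (M.map H).IsDual where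
  cup_braiding {a b} h := by
    have h1 := congrArg H.map (hM.cup_braiding h)
    rw [H.map_comp, H.map_braiding] at h1
    change (eqToHom _ ≫ H.map _ ≫ eqToHom _) ≫ _ = eqToHom _ ≫ H.map _ ≫ eqToHom _
    rw [← h1]
    simp
  braiding_cap {a b} h := by
    have h1 := congrArg H.map (hM.braiding_cap h)
    rw [H.map_comp, H.map_braiding] at h1
    change _ ≫ (eqToHom _ ≫ H.map _ ≫ eqToHom _) = eqToHom _ ≫ H.map _ ≫ eqToHom _
    rw [← h1]
    simp
  zigzag {a b} h X := by
    -- The object `X` need not be in the image of `H`, so the zigzag is verified at the unit, which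
    -- is.
    refine zigzag_of_zigzag_unit ?_ X
    have h1 := congrArg H.map (hM.zigzag h (𝟙_ C))
    have hu : H.obj (M.v a ⊗ 𝟙_ C) = H.obj (M.v a) ⊗ 𝟙_ D := by rw [H.obj_tensor, H.obj_unit]
    rw [H.map_comp, H.map_conj_whiskerLeft _ _ _ _ _ (H.map_cupW (M.cup h.symm) H.obj_unit),
      H.map_capW _ hu, H.map_id] at h1
    have h2 := congrArg (fun m => eqToHom hu.symm ≫ m ≫ eqToHom hu) h1
    simpa using h2

end Interp
end PermCC

/-! ### Restriction along the inclusion, and locality -/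

namespace PermCC

section Restriction

variable {C : Type u} [Category.{u} C] [MonoidalCategory C] [SymmetricCategory C]

theorem FreePerm.natTrans_ext {F F' : StrictFunctor FreePerm.{u} C} {α β : F ⟶ F'}
    (h : StrictFunctor.app α gen = StrictFunctor.app β gen) : α = β :=
  Presentation.app_ext (P := presentation) fun _ => h

variable [IsPermutative C]

theorem FrCC.isDual_map (G : StrictFunctor FrCC.{u} C) : (FrCC.interp.map G).IsDual :=
  FrCC.interp_isDual.map G

/-- An isomorphism of the images of the generator extends to an isomorphism of functors. -/
theorem FreePerm.exists_iso {F F' : StrictFunctor FreePerm.{u} C} (a : F.obj gen ≅ F'.obj gen) :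
    Nonempty (F ≅ F') :=
  ⟨Presentation.isoOf (P := presentation) (t := fun _ => a) ⟨fun h => h.elim, fun h => h.elim⟩⟩

/-- An isomorphism of the images of the positive generator extends to an isomorphism of functors. -/
theorem FrCC.exists_iso {G G' : StrictFunctor FrCC.{u} C} (a : G.obj (pt .pos) ≅ G'.obj (pt .pos)) :
    ∃ α : G ≅ G', StrictFunctor.app α.hom (pt .pos) = a.hom := by
  obtain ⟨t, h, ht⟩ := (FrCC.isDual_map G).exists_isHom (FrCC.isDual_map G') a
  refine ⟨Presentation.isoOf (P := presentation) (t := t) ht, ?_⟩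
  exact (Presentation.app_homOf (P := presentation) ht .pos).trans (congrArg Iso.hom h)

/-- The component of an isomorphism of functors. -/
def StrictFunctor.appIso {A : Type u} [Category.{u} A] [MonoidalCategory A] [SymmetricCategory A]
    {F G : StrictFunctor A C} (α : F ≅ G) (X : A) : F.obj X ≅ G.obj X :=
  ⟨app α.hom X, app α.inv X, app_hom_inv α X, app_inv_hom α X⟩

/-- The presentation has two letters, but the component at the negative one is forced by duality. -/
theorem FrCC.natTrans_ext {G G' : StrictFunctor FrCC.{u} C} {α β : G ≅ G'}
    (h : StrictFunctor.app α.hom (pt .pos) = StrictFunctor.app β.hom (pt .pos)) :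
    α.hom = β.hom :=
  Presentation.app_ext (P := presentation) ((FrCC.isDual_map G).isHom_unique
    (FrCC.interp.isHom_app α.hom) (FrCC.interp.isHom_app β.hom)
    (StrictFunctor.appIso α (pt .pos)) rfl h.symm)

/-- Restriction to the free permutative category is an equivalence of groupoids if all objects have
duals. -/
theorem FreePerm.isEquivalence_core_precomp_incl
    (hC : ∀ c : C, ∃ d : C, Nonempty (ExactPairing d c)) :
    (incl.{u}.precomp C).core.IsEquivalence where
  faithful := ⟨fun {G G'} α β h => by
    refine CoreHom.ext (Iso.ext (FrCC.natTrans_ext ?_))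
    exact congrArg (fun γ : CoreHom _ _ => StrictFunctor.app γ.iso.hom gen) h⟩
  full := ⟨fun {G G'} γ => by
    obtain ⟨α, hα⟩ := FrCC.exists_iso (G := G.of) (G' := G'.of)
      (StrictFunctor.appIso (CoreHom.iso γ) gen)
    exact ⟨⟨α⟩, CoreHom.ext (Iso.ext (FreePerm.natTrans_ext hα))⟩⟩
  essSurj := ⟨fun F => by
    -- A dual of the image of the generator interprets the negative sign.
    obtain ⟨d, ⟨_⟩⟩ := hC (F.of.obj gen)
    let hM := FrCC.respects (Interp.ofExactPairing_isDual d (F.of.obj gen))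
    let G : StrictFunctor FrCC.{u} C := Presentation.lift hM
    have h : G.obj (FrCC.pt .pos) = F.of.obj gen := Presentation.lift_v hM .pos
    obtain ⟨α⟩ := FreePerm.exists_iso (F := incl.comp G) (F' := F.of) (eqToIso h)
    exact ⟨⟨G⟩, ⟨(Groupoid.isoEquivHom _ _).symm ⟨α⟩⟩⟩⟩

end Restriction

theorem isEquivalence_core {A B : Type u} [Category.{u} A] [Category.{u} B] (F : A ⥤ B)
    [F.IsEquivalence] : F.core.IsEquivalence :=
  F.asEquivalence.core.isEquivalence_functor

namespace PermCat

theorem isCofibrant_freePerm : freePerm.{u}.IsCofibrant :=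
  isCofibrant_of_presentation (X := freePerm) FreePerm.presentation

theorem isCofibrant_frCC : frCC.{u}.IsCofibrant :=
  isCofibrant_of_presentation (X := frCC) FrCC.presentation

theorem isEquivalence_precomp {S : Type} {Pair : S → S → Prop} {X Y : PermCat.{u}}
    (P : Presentation S Pair Y) (k : X ⟶ Y) (hk : weakEquivalences k) (C : PermCat.{u}) :
    (StrictFunctor.precomp k C).IsEquivalence :=
  have : (StrictFunctor.toFunctor k).IsEquivalence := hk
  P.isEquivalence_precomp k C

theorem IsCompactClosed.isLocal {C : PermCat.{u}} (hC : C.IsCompactClosed) :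
    IsLocal inclusion.{u} C := by
  intro K' L' g' k l h
  have hk := isEquivalence_precomp (Y := freePerm) FreePerm.presentation k h.weq_left C
  have hl := isEquivalence_precomp (Y := frCC) FrCC.presentation l h.weq_right C
  have hi : (StrictFunctor.precomp inclusion.{u} C).core.IsEquivalence :=
    FreePerm.isEquivalence_core_precomp_incl hC
  have hk' := isEquivalence_core (StrictFunctor.precomp k C)
  have hl' := isEquivalence_core (StrictFunctor.precomp l C)
  -- The approximation square becomes a square of restriction functors in which the other three
  -- sides are equivalences.
  have e : (StrictFunctor.precomp l C).core ⋙ (StrictFunctor.precomp g' C).core =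
      (StrictFunctor.precomp inclusion C).core ⋙ (StrictFunctor.precomp k C).core :=
    congrArg (fun m : K' ⟶ frCC => (StrictFunctor.precomp m C).core) h.comm
  have he : ((StrictFunctor.precomp l C).core ⋙ (StrictFunctor.precomp g' C).core).IsEquivalence := by
    rw [e]
    infer_instance
  have := Functor.isEquivalence_of_comp_left (StrictFunctor.precomp l C).core
    (StrictFunctor.precomp g' C).core
  exact isWeakHomotopyEquivalence_nerveMap (StrictFunctor.precomp g' C).core

theorem weakEquivalences_id (X : PermCat.{u}) : weakEquivalences (𝟙 X) :=
  inferInstanceAs (𝟭 X).IsEquivalence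

/-- Both ends are presented and hence cofibrant, so locality can be tested on the inclusion itself.
-/
theorem isCofibrantApproximation_inclusion :
    IsCofibrantApproximation inclusion.{u} inclusion.{u} (𝟙 _) (𝟙 _) where
  cofibrant_left := isCofibrant_freePerm
  cofibrant_right := isCofibrant_frCC
  weq_left := weakEquivalences_id _
  weq_right := weakEquivalences_id _
  comm := by rw [Category.comp_id, Category.id_comp]

theorem IsLocal.isCompactClosed {C : PermCat.{u}} (hC : IsLocal inclusion.{u} C) :
    C.IsCompactClosed := by
  intro c
  let M : Interp Unit (fun _ _ => False) C := ⟨fun _ => c, fun h => h.elim, fun h => h.elim⟩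
  let F : StrictFunctor FreePerm.{u} C := Presentation.lift (FreePerm.respects M)
  have hF : F.obj FreePerm.gen = c := Presentation.lift_v (FreePerm.respects M) ()
  -- The functor that sends the generator to `c` is isomorphic to the restriction of some `G`. The
  -- values of `G` at the two points are dual, and the duality is transported to `c`.
  obtain ⟨G, ⟨α⟩⟩ := exists_iso_of_isWeakHomotopyEquivalence
    (StrictFunctor.precomp inclusion.{u} C).core
    (hC _ _ _ isCofibrantApproximation_inclusion) ⟨F⟩
  have a : G.of.obj (FrCC.pt .pos) ≅ c :=
    StrictFunctor.appIso (CoreHom.iso α.hom) FreePerm.gen ≪≫ eqToIso hF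
  let _ : ExactPairing (G.of.obj (FrCC.pt .neg)) (G.of.obj (FrCC.pt .pos)) :=
    (FrCC.isDual_map G.of).exactPairing
  exact ⟨G.of.obj (FrCC.pt .neg), ⟨exactPairingCongrRight
    (X := G.of.obj (FrCC.pt .neg)) (Y' := G.of.obj (FrCC.pt .pos)) a.symm⟩⟩

end PermCat
end PermCC

theorem proposition2p19 (C : PermCC.PermCat.{u}) :
    C.IsCompactClosed ↔ PermCC.PermCat.IsLocal PermCC.PermCat.inclusion.{u} C :=
  ⟨PermCC.PermCat.IsCompactClosed.isLocal, PermCC.PermCat.IsLocal.isCompactClosed⟩
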